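/- Let $n\ge 2$ and let $\Omega\subset\mathbb{R}^n$ be a domain (a connected open set) with $|\Omega|=1$ that belongs to the Maz'ya class $\mathcal{J}_{1-1/n}$: there is $M\in(0,|\Omega|)$ such that \[ \sup_{S}\frac{|S|^{1-1/n}}{s(\Omega\cap\partial S)}<\infty , \] where the supremum is over all bounded open sets $S\subset\Omega$ such that $\Omega\cap\partial S$ is a $C^\infty$ (hypersurface) manifold and $|S|\le M$, and $s$ denotes $(n-1)$-dimensional area. Let $\gamma_n$ be the measure of the unit ball of $\mathbb{R}^n$ and let $B$ be the ball centred at the origin with $|B|=1$. For an integrable $f$ on $\Omega$ let $f^*(t)=\inf\{\lambda\ge 0: |\{x\in\Omega:|f(x)|>\lambda\}|\le t\}$ be its decreasing rearrangement and \[ f^\circ(x)=f^*(\gamma_n|x|^n),\qquad x\in B, \] its symmetric spherical decreasing rearrangement. For a rearrangement invariant (Banach function) space $X(\Omega)$, let $\tilde X(B)$ be its version on $B$, i.e. $\|g\|_{\tilde X(B)}=\|u\|_{X(\Omega)}$ for any $u$ on $\Omega$ equimeasurable with $|g|$. Then there is a constant $C$, depending only on $\Omega$, such that for every rearrangement invariant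 space $X(\Omega)$ and every $f\in W^{1,1}(\Omega)$, \[ \inf_{c\in\mathbb{R}}\bigl\|\nabla (f-c)^\circ\bigr\|_{\tilde X(B)}\le C\,\|\nabla f\|_{X(\Omega)} , \] where gradients are weak gradients, the norm of a gradient is the norm of its Euclidean length, and a norm is $+\infty$ if the function is not in the space or if the weak gradient does not exist. -/

import Mathlib

open MeasureTheory Set
open scoped ENNReal NNReal ContDiff

noncomputable section

namespace PolyaSzego

/-- The Euclidean space `ℝⁿ`. -/
abbrev Eucl (n : ℕ) : Type := EuclideanSpace ℝ (Fin n)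

/-! ### Isoperimetric (Maz'ya) classes -/

/-- `Γ ⊆ ℝⁿ` is an embedded `(n-1)`-dimensional manifold of class `C^∞` (possibly empty, and not
necessarily closed in `ℝⁿ`): locally it is the zero set of a smooth function with nonvanishing
differential. -/
def IsSmoothHypersurface {n : ℕ} (Γ : Set (Eucl n)) : Prop :=
  ∀ x ∈ Γ, ∃ (V : Set (Eucl n)) (g : Eucl n → ℝ), IsOpen V ∧ x ∈ V ∧ ContDiffOn ℝ ∞ g V ∧
    (∀ y ∈ V, fderiv ℝ g y ≠ 0) ∧ Γ ∩ V = {y ∈ V | g y = 0}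

/-- Admissible sets: bounded open subsets `S` of `Ω` such that `Ω ∩ ∂S` is a manifold of class
`C^∞`. -/
def IsAdmissible {n : ℕ} (Ω S : Set (Eucl n)) : Prop :=
  IsOpen S ∧ Bornology.IsBounded S ∧ S ⊆ Ω ∧ IsSmoothHypersurface (Ω ∩ frontier S)

/-- `(n-1)`-dimensional area, i.e. the `(n-1)`-dimensional Hausdorff measure, normalised so as to
agree with Lebesgue measure on `ℝⁿ⁻¹`. -/
def area {n : ℕ} (Γ : Set (Eucl n)) : ℝ≥0∞ :=
  Measure.euclideanHausdorffMeasure (n - 1) Γ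

/-- `U_α(M) = sup |S|^α / s(Ω ∩ ∂S)`, the supremum being over the admissible sets `S` with
`|S| ≤ M`. The quotient is taken in `[0, ∞]`, so that `a / 0 = ∞` for `a > 0`, `0 / 0 = 0` and
`a / ∞ = 0` for finite `a`. -/
def isoperimetricSup {n : ℕ} (Ω : Set (Eucl n)) (α : ℝ) (M : ℝ≥0∞) : ℝ≥0∞ :=
  ⨆ (S : Set (Eucl n)) (_ : IsAdmissible Ω S) (_ : volume S ≤ M),
    volume S ^ α / area (Ω ∩ frontier S)

/-- The Maz'ya class `𝓙_α`: there is `M ∈ (0, |Ω|)` with `U_α(M) < ∞`. -/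
def MazyaClass {n : ℕ} (Ω : Set (Eucl n)) (α : ℝ) : Prop :=
  ∃ M : ℝ≥0∞, 0 < M ∧ M < volume Ω ∧ isoperimetricSup Ω α M < ⊤

/-! ### Sobolev functions -/

/-- `G` is a weak (distributional) gradient of `f` on the open set `Ω`. -/
def HasWeakGradient {n : ℕ} (Ω : Set (Eucl n)) (f : Eucl n → ℝ) (G : Eucl n → Eucl n) : Prop :=
  LocallyIntegrableOn f Ω ∧ LocallyIntegrableOn G Ω ∧
    ∀ φ : Eucl n → ℝ, ContDiff ℝ ∞ φ → HasCompactSupport φ → tsupport φ ⊆ Ω →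
      ∀ i : Fin n, ∫ x in Ω, f x * fderiv ℝ φ x (EuclideanSpace.single i 1) =
        -∫ x in Ω, G x i * φ x

/-- `f ∈ W^{1,1}(Ω)`. -/
def MemW11 {n : ℕ} (Ω : Set (Eucl n)) (f : Eucl n → ℝ) : Prop :=
  IntegrableOn f Ω ∧ ∃ G : Eucl n → Eucl n, HasWeakGradient Ω f G ∧ IntegrableOn G Ω

/-- `‖∇f‖`, the value of a function (quasi)norm `ρ` at `|∇f|`, for the weak gradient of `f` on `Ω`.
The weak gradient is unique up to null sets, so the infimum is over a single value; it is `∞` if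
`f` has no weak gradient on `Ω`. -/
def gradNorm {n : ℕ} (Ω : Set (Eucl n)) (ρ : (Eucl n → ℝ≥0∞) → ℝ≥0∞) (f : Eucl n → ℝ) : ℝ≥0∞ :=
  ⨅ (G : Eucl n → Eucl n) (_ : HasWeakGradient Ω f G), ρ (fun x => ‖G x‖ₑ)

/-! ### Rearrangement invariant spaces -/

/-- Two nonnegative functions, on possibly different measure spaces, are equimeasurable if they
have the same distribution function. -/
def Equimeasurable {α β : Type*} [MeasurableSpace α] [MeasurableSpace β]
    (μ : Measure α) (ν : Measure β) (u : α → ℝ≥0∞) (v : β → ℝ≥0∞) : Prop :=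
  ∀ t : ℝ≥0∞, μ {x | t < u x} = ν {y | t < v y}

/-- A rearrangement invariant Banach function norm on the measure space `(α, μ)`. The r.i. space
`X` that it defines consists of the measurable `f` with `‖f‖_X = toFun |f| < ∞`. -/
structure RINorm {α : Type*} [MeasurableSpace α] (μ : Measure α) where
  /-- the function norm, on nonnegative measurable functions -/
  toFun : (α → ℝ≥0∞) → ℝ≥0∞
  eq_zero_iff : ∀ u, AEMeasurable u μ → (toFun u = 0 ↔ u =ᵐ[μ] 0)
  smul : ∀ (a : ℝ≥0) (u), AEMeasurable u μ → toFun (fun x => a * u x) = a * toFun u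
  add_le : ∀ u v, AEMeasurable u μ → AEMeasurable v μ →
    toFun (fun x => u x + v x) ≤ toFun u + toFun v
  mono : ∀ u v, AEMeasurable u μ → AEMeasurable v μ → u ≤ᵐ[μ] v → toFun u ≤ toFun v
  fatou : ∀ u : ℕ → α → ℝ≥0∞, (∀ k, AEMeasurable (u k) μ) →
    (∀ᵐ x ∂μ, Monotone fun k => u k x) → toFun (fun x => ⨆ k, u k x) = ⨆ k, toFun (u k)
  indicator_lt_top : ∀ A, MeasurableSet A → μ A < ⊤ → toFun (A.indicator fun _ => 1) < ⊤
  lintegral_le : ∀ A, MeasurableSet A → μ A < ⊤ →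
    ∃ C : ℝ≥0, ∀ u, AEMeasurable u μ → ∫⁻ x in A, u x ∂μ ≤ C * toFun u
  rearrangement_invariant : ∀ u v, AEMeasurable u μ → AEMeasurable v μ →
    Equimeasurable μ μ u v → toFun u = toFun v

/-- The version of an r.i. norm on another measure space `(β, ν)`: the norm of `v` is the norm in
the original space of any function `u` equimeasurable with `v`. By rearrangement invariance all
such `u` have the same norm, so the infimum is over a single value. (Such `u` exist when `μ` is
non-atomic and `μ`, `ν` have the same total mass.) -/
def RINorm.version {α β : Type*} [MeasurableSpace α] [MeasurableSpace β] {μ : Measure α}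
    (X : RINorm μ) (ν : Measure β) (v : β → ℝ≥0∞) : ℝ≥0∞ :=
  ⨅ (u : α → ℝ≥0∞) (_ : AEMeasurable u μ) (_ : Equimeasurable μ ν u v), X.toFun u

/-! ### Rearrangements -/

/-- The decreasing rearrangement `f^*(t) = inf {l ≥ 0 : |{x ∈ Ω : |f(x)| > l}| ≤ t}` of a function
`f` on `Ω`. -/
def decreasingRearrangement {n : ℕ} (Ω : Set (Eucl n)) (f : Eucl n → ℝ) (t : ℝ) : ℝ :=
  sInf {l : ℝ | 0 ≤ l ∧ volume {x ∈ Ω | l < |f x|} ≤ ENNReal.ofReal t}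

/-- `γ_n`, the measure of the unit ball of `ℝⁿ`. -/
def unitBallVolume (n : ℕ) : ℝ :=
  (volume (Metric.ball (0 : Eucl n) 1)).toReal

/-- The ball `B` of `ℝⁿ` centred at the origin with `|B| = 1` (for `n ≥ 1`). -/
def unitVolumeBall (n : ℕ) : Set (Eucl n) :=
  Metric.ball 0 (unitBallVolume n ^ (-(1 / (n : ℝ))))

/-- The symmetric spherical decreasing rearrangement `f^∘(x) = f^*(γ_n |x|^n)` of a function `f` on
`Ω`. -/
def sphericalRearrangement {n : ℕ} (Ω : Set (Eucl n)) (f : Eucl n → ℝ) (x : Eucl n) : ℝ :=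
  decreasingRearrangement Ω f (unitBallVolume n * ‖x‖ ^ n)

end PolyaSzego

end

noncomputable section

namespace PolyaSzego

open Filter Topology

/-! ### A coarea inequality -/

/-! Write α = 1 - 1/n, let c be a median of f, put F = f - c, and let r be the decreasing
rearrangement of F. Everything rests on a level gap inequality: for 0 ≤ t₁ < t₂, (t₂ - t₁) |{|F| ≥
t₂}|^α ≤ C ∫ |∇f| over {t₁ < |F| < t₂} (`exists_level_gap_median`). Where superlevel sets are small,
this is the isoperimetric inequality of the Maz'ya class, integrated over the levels by a coarea
inequality (`level_isoperimetric_smooth`). Where they are large, the sublevel sets are large too, by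
the choice of the median, and a Poincaré inequality on the connected set Ω bounds the gap itself
(`exists_level_gap_bound`). Both are proved for smooth functions, almost all of whose levels become
regular after a small linear perturbation, and pass to W^{1,1} by Meyers–Serrin approximation.

At the levels r(t) ≤ r(s), s ≤ t, the inequality reads (r(s) - r(t)) s^α ≤ C ∫ |∇f| over the band
{r(t) < |F| < r(s)}. Such a band has measure at most t - s, and bands of nonoverlapping intervals
are disjoint. Hence r is absolutely continuous away from 0, and s^α (-r'(s)) is at most C times the
lower limit of the averages of |∇f| over the bands of finer and finer uniform partitions
(`rpow_mul_neg_deriv_le_liminf`).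

Averaging over disjoint sets does not increase a rearrangement invariant norm
(`RINorm.partition_average_le`). With the Fatou property this bounds the norm of s^α (-r'(s)) by C
‖∇f‖ (`RINorm.rearrangedSlope_le`). Finally, x ↦ s = γ_n |x|^n carries the measure of B to that of
(0, 1), and the gradient of F^∘ has length n γ_n^{1/n} s^α (-r'(s)); so it is equimeasurable with a
multiple of the function just bounded (`gradNorm_rearrangement_le`). -/

theorem exists_cover_hausdorff {X : Type*} [EMetricSpace X] [MeasurableSpace X] [BorelSpace X]
    {d : ℝ} (hd : 0 < d) {A : Set X} (hA : μH[d] A ≠ ⊤) {r : ℝ≥0∞} (hr : 0 < r) :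
    ∃ t : ℕ → Set X, A ⊆ ⋃ i, t i ∧ (∀ i, Metric.ediam (t i) ≤ r) ∧
      ∑' i, Metric.ediam (t i) ^ d ≤ μH[d] A + r := by
  have h1 : (⨅ (t : ℕ → Set X) (_ : A ⊆ ⋃ n, t n) (_ : ∀ n, Metric.ediam (t n) ≤ r),
      ∑' n, ⨆ _ : (t n).Nonempty, Metric.ediam (t n) ^ d) < μH[d] A + r := by
    refine lt_of_le_of_lt ?_ (ENNReal.lt_add_right hA hr.ne')
    rw [Measure.hausdorffMeasure_apply]
    exact le_iSup₂_of_le r hr le_rfl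
  simp only [iInf_lt_iff] at h1
  obtain ⟨t, h2, h3, h4⟩ := h1
  refine ⟨t, h2, h3, le_trans (ENNReal.tsum_le_tsum fun i => ?_) h4.le⟩
  rcases (t i).eq_empty_or_nonempty with h | h
  · simp [h, hd]
  · exact le_iSup_of_le h le_rfl

/-- Eilenberg's inequality. A fibre meets a piece of a fine cover only if τ lies in the image of the
piece, a set of length at most L times the diameter; summing over the pieces and applying Fatou
along finer covers gives the bound. A measurable majorant avoids the question whether the fibre
measure is measurable in τ. -/
theorem exists_measurable_fiber_bound {X : Type*} [EMetricSpace X] [MeasurableSpace X]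
    [BorelSpace X] {d : ℝ} (hd : 0 < d) {A : Set X} {h : X → ℝ} {L : ℝ≥0}
    (hL : LipschitzOnWith L h A) (hA : μH[d + 1] A ≠ ⊤) :
    ∃ F : ℝ → ℝ≥0∞, Measurable F ∧ (∀ τ, μH[d] (A ∩ {x | h x = τ}) ≤ F τ) ∧
      ∫⁻ τ, F τ ≤ L * μH[d + 1] A := by
  have hr0 : ∀ k : ℕ, (0 : ℝ≥0∞) < ((k : ℝ≥0∞) + 1)⁻¹ := fun k => by
    simp
  have hrt : Tendsto (fun k : ℕ => ((k : ℝ≥0∞) + 1)⁻¹) atTop (𝓝 0) := by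
    have := (tendsto_add_atTop_iff_nat 1).2 ENNReal.tendsto_inv_nat_nhds_zero
    simpa using this
  choose t ht1 ht2 ht3 using fun k : ℕ =>
    exists_cover_hausdorff (d := d + 1) (by linarith) hA (hr0 k)
  -- The closure makes the image measurable and leaves its diameter unchanged.
  let c : ℕ → ℕ → Set ℝ := fun k i => closure (h '' (t k i ∩ A))
  let f : ℕ → ℝ → ℝ≥0∞ := fun k τ =>
    ∑' i, (c k i).indicator (fun _ => Metric.ediam (t k i) ^ d) τ
  have hfm : ∀ k, Measurable (f k) := fun k => Measurable.tsum fun i =>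
    measurable_const.indicator isClosed_closure.measurableSet
  refine ⟨fun τ => liminf (fun k => f k τ) atTop, Measurable.liminf hfm, fun τ => ?_, ?_⟩
  · refine (Measure.hausdorffMeasure_le_liminf_tsum d (A ∩ {x | h x = τ})
      (fun k : ℕ => ((k : ℝ≥0∞) + 1)⁻¹) hrt (fun k i => t k i ∩ (A ∩ {x | h x = τ}))
      (Eventually.of_forall fun k i => (Metric.ediam_mono inter_subset_left).trans (ht2 k i))
      (Eventually.of_forall fun k x hx => ?_)).trans ?_
    · obtain ⟨i, hi⟩ := mem_iUnion.1 (ht1 k hx.1)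
      exact mem_iUnion.2 ⟨i, hi, hx⟩
    · refine liminf_le_liminf (Eventually.of_forall fun k => ENNReal.tsum_le_tsum fun i => ?_)
      rcases (t k i ∩ (A ∩ {x | h x = τ})).eq_empty_or_nonempty with he | ⟨x, hx1, hx2, hx3⟩
      · simp [he, hd]
      · have : τ ∈ c k i := subset_closure ⟨x, ⟨hx1, hx2⟩, hx3⟩
        rw [indicator_of_mem this]
        exact ENNReal.rpow_le_rpow (Metric.ediam_mono inter_subset_left) hd.le
  · refine (lintegral_liminf_le hfm).trans ?_
    have hk : ∀ k, ∫⁻ τ, f k τ ≤ L * (μH[d + 1] A + ((k : ℝ≥0∞) + 1)⁻¹) := fun k => by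
      calc ∫⁻ τ, f k τ = ∑' i, Metric.ediam (t k i) ^ d * volume (c k i) := by
            rw [lintegral_tsum fun i =>
              (measurable_const.indicator isClosed_closure.measurableSet).aemeasurable]
            congr 1; ext i
            rw [lintegral_indicator isClosed_closure.measurableSet, setLIntegral_const]
        _ ≤ ∑' i, L * Metric.ediam (t k i) ^ (d + 1) := by
            refine ENNReal.tsum_le_tsum fun i => ?_
            have h1 : volume (c k i) ≤ L * Metric.ediam (t k i) := by
              refine (Real.volume_le_diam _).trans ?_
              rw [Metric.ediam_closure]
              refine Metric.ediam_image_le_iff.2 fun x hx y hy => (hL hx.2 hy.2).trans ?_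
              exact mul_le_mul_right (Metric.edist_le_ediam_of_mem hx.1 hy.1) _
            have h2 : Metric.ediam (t k i) ^ (d + 1)
                = Metric.ediam (t k i) ^ d * Metric.ediam (t k i) := by
              rw [ENNReal.rpow_add_of_nonneg _ _ hd.le zero_le_one, ENNReal.rpow_one]
            rw [h2]
            calc _ ≤ Metric.ediam (t k i) ^ d * (L * Metric.ediam (t k i)) :=
                  mul_le_mul_right h1 _
              _ = _ := by ring
        _ ≤ _ := by
            rw [ENNReal.tsum_mul_left]
            exact mul_le_mul_right (ht3 k) _
    refine (liminf_le_liminf (Eventually.of_forall hk)).trans ?_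
    refine le_of_eq (Tendsto.liminf_eq ?_)
    have : Tendsto (fun k : ℕ => (L : ℝ≥0∞) * (μH[d + 1] A + ((k : ℝ≥0∞) + 1)⁻¹)) atTop
        (𝓝 (L * (μH[d + 1] A + 0))) :=
      ENNReal.Tendsto.const_mul (tendsto_const_nhds.add hrt) (Or.inr ENNReal.coe_ne_top)
    simpa using this

/-- The ratio between the `n`-dimensional Hausdorff measure and Lebesgue measure on `ℝⁿ`, and the
normalisation of the area, are absorbed in a constant. -/
theorem exists_coarea_bound {n : ℕ} (hn : 2 ≤ n) :
    ∃ c : ℝ≥0, ∀ (U : Set (Eucl n)) (h : Eucl n → ℝ) (ε : ℝ≥0), IsOpen U → volume U ≠ ⊤ →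
      ContDiffOn ℝ 1 h U → 0 < ε →
      ∃ F : ℝ → ℝ≥0∞, Measurable F ∧ (∀ τ, area (U ∩ {x | h x = τ}) ≤ F τ) ∧
        ∫⁻ τ, F τ ≤ c * ∫⁻ x in U, (‖fderiv ℝ h x‖ₑ + ε) := by
  set a := Measure.addHaarScalarFactor (volume : Measure (EuclideanSpace ℝ (Fin n))) μH[n]
    with ha
  set b := Measure.addHaarScalarFactor
    (volume : Measure (EuclideanSpace ℝ (Fin (n - 1)))) μH[(n - 1 : ℕ)] with hb
  have ha0 : a ≠ 0 := Measure.addHaarScalarFactor_volume_hausdorffMeasure_ne_zero n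
  have hvol : ∀ A : Set (Eucl n), μH[n] A = (a⁻¹ : ℝ≥0) * volume A := fun A => by
    rw [← EuclideanSpace.euclideanHausdorffMeasure_eq_volume n,
      Measure.euclideanHausdorffMeasure_def, Measure.smul_apply, ENNReal.smul_def, smul_eq_mul,
      ← mul_assoc, ← ENNReal.coe_mul, inv_mul_cancel₀ ha0]
    simp
  have hn1 : ((n - 1 : ℕ) : ℝ) + 1 = n := by
    have : ((n - 1 : ℕ) : ℝ) = n - 1 := by
      rw [Nat.cast_sub (by omega)]; simp
    rw [this]; ring
  have hd : (0 : ℝ) < ((n - 1 : ℕ) : ℝ) := by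
    exact_mod_cast (by omega : 0 < n - 1)
  refine ⟨b * a⁻¹, fun U h ε hU hUv hh hε => ?_⟩
  -- By strict differentiability and continuity of the derivative, near each point `h` has a
  -- Lipschitz constant that exceeds |Dh| by at most ε at all nearby points. Countably many disjoint
  -- pieces of this kind turn the Lipschitz bound into an integral of |Dh| + ε.
  have hloc : ∀ x ∈ U, ∃ V : Set (Eucl n), IsOpen V ∧ x ∈ V ∧ V ⊆ U ∧ ∃ L : ℝ≥0,
      LipschitzOnWith L h V ∧ ∀ y ∈ V, (L : ℝ≥0∞) ≤ ‖fderiv ℝ h y‖ₑ + ε := by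
    intro x hx
    have hc : ContDiffAt ℝ 1 h x := (hh x hx).contDiffAt (hU.mem_nhds hx)
    have hs : HasStrictFDerivAt h (fderiv ℝ h x) x := hc.hasStrictFDerivAt one_ne_zero
    have hlt : ‖fderiv ℝ h x‖₊ < ‖fderiv ℝ h x‖₊ + ε / 2 := lt_add_of_pos_right _ (by positivity)
    obtain ⟨s, hs1, hs2⟩ := hs.exists_lipschitzOnWith_of_nnnorm_lt _ hlt
    have hcont : ContinuousAt (fun y => ‖fderiv ℝ h y‖₊) x :=
      ((hc.fderiv_right (m := 0) (by norm_num)).continuousAt).nnnorm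
    have hev : ∀ᶠ y in 𝓝 x, ‖fderiv ℝ h x‖₊ < ‖fderiv ℝ h y‖₊ + ε / 2 :=
      (hcont.add continuousAt_const).eventually (lt_mem_nhds hlt)
    obtain ⟨V, hV1, hV2, hV3⟩ :=
      mem_nhds_iff.1 (inter_mem hs1 (inter_mem hev (hU.mem_nhds hx)))
    refine ⟨V, hV2, hV3, fun y hy => (hV1 hy).2.2, ‖fderiv ℝ h x‖₊ + ε / 2,
      hs2.mono fun y hy => (hV1 hy).1, fun y hy => ?_⟩
    have h1 : ‖fderiv ℝ h x‖₊ < ‖fderiv ℝ h y‖₊ + ε / 2 := (hV1 hy).2.1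
    have h2 : ‖fderiv ℝ h x‖₊ + ε / 2 ≤ ‖fderiv ℝ h y‖₊ + ε := by
      calc _ ≤ ‖fderiv ℝ h y‖₊ + ε / 2 + ε / 2 := by gcongr
        _ = _ := by rw [add_assoc, add_halves]
    rw [enorm_eq_nnnorm, ← ENNReal.coe_add]
    exact ENNReal.coe_le_coe.2 h2
  choose! V hVo hxV hVU L hVL hL using hloc
  obtain ⟨T, hTU, hTc, hT⟩ := TopologicalSpace.countable_cover_nhdsWithin (s := U) (f := V)
    fun x hx => mem_nhdsWithin_of_mem_nhds ((hVo x hx).mem_nhds (hxV x hx))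
  rcases T.eq_empty_or_nonempty with rfl | hTne
  · have : U = ∅ := by simpa using hT
    subst this
    exact ⟨0, measurable_const, by simp [area], by simp⟩
  obtain ⟨p, rfl⟩ := hTc.exists_eq_range hTne
  have hp : ∀ i, p i ∈ U := fun i => hTU ⟨i, rfl⟩
  let A : ℕ → Set (Eucl n) := disjointed fun i => V (p i)
  have hAm : ∀ i, MeasurableSet (A i) :=
    MeasurableSet.disjointed fun i => (hVo _ (hp i)).measurableSet
  have hAV : ∀ i, A i ⊆ V (p i) := disjointed_subset _
  have hAU : ⋃ i, A i = U := by
    rw [iUnion_disjointed]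
    refine Subset.antisymm (iUnion_subset fun i => hVU _ (hp i)) fun x hx => ?_
    simpa using hT hx
  have hAfin : ∀ i, μH[((n - 1 : ℕ) : ℝ) + 1] (A i) ≠ ⊤ := fun i => by
    rw [hn1, hvol]
    exact ENNReal.mul_ne_top ENNReal.coe_ne_top
      (measure_ne_top_of_subset ((hAV i).trans (hVU _ (hp i))) hUv)
  choose F hFm hF hFi using fun i =>
    exists_measurable_fiber_bound hd ((hVL _ (hp i)).mono (hAV i)) (hAfin i)
  refine ⟨fun τ => b * ∑' i, F i τ, (Measurable.tsum hFm).const_mul _, fun τ => ?_, ?_⟩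
  · have : U ∩ {x | h x = τ} = ⋃ i, A i ∩ {x | h x = τ} := by
      rw [← iUnion_inter, hAU]
    rw [area, Measure.euclideanHausdorffMeasure_def, Measure.smul_apply, ENNReal.smul_def,
      smul_eq_mul, this]
    exact mul_le_mul_right ((measure_iUnion_le _).trans
      (ENNReal.tsum_le_tsum fun i => hF i τ)) _
  · rw [lintegral_const_mul _ (Measurable.tsum hFm),
      lintegral_tsum fun i => (hFm i).aemeasurable]
    have h1 : ∀ i, ∫⁻ τ, F i τ ≤ (a⁻¹ : ℝ≥0) * ∫⁻ x in A i, (‖fderiv ℝ h x‖ₑ + ε) := fun i => by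
      refine (hFi i).trans ?_
      rw [hn1, hvol, mul_left_comm]
      refine mul_le_mul_right ?_ _
      rw [← setLIntegral_const]
      exact setLIntegral_mono' (hAm i) fun x hx => hL _ (hp i) x (hAV i hx)
    have h2 : ∫⁻ x in U, (‖fderiv ℝ h x‖ₑ + ε) = ∑' i, ∫⁻ x in A i, (‖fderiv ℝ h x‖ₑ + ε) := by
      rw [← hAU, lintegral_iUnion hAm (disjoint_disjointed _)]
    rw [h2, ENNReal.coe_mul, mul_assoc, ← ENNReal.tsum_mul_left (a := ((a⁻¹ : ℝ≥0) : ℝ≥0∞))]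
    exact mul_le_mul_right (ENNReal.tsum_le_tsum h1) _

end PolyaSzego

end

noncomputable section

namespace PolyaSzego

open Filter Topology

/-! ### A Poincaré inequality on connected open sets -/

theorem enorm_sub_le_lintegral_segment {n : ℕ} {B : Set (Eucl n)} (hBo : IsOpen B)
    (hBc : Convex ℝ B) {v : Eucl n → ℝ} (hv : ContDiffOn ℝ 1 v B) {x h : Eucl n}
    (hx : x ∈ B) (hxh : x + h ∈ B) :
    ‖v x - v (x + h)‖ₑ ≤
      ∫⁻ s in Ioc (0 : ℝ) 1, ‖h‖ₑ * B.indicator (fun z => ‖fderiv ℝ v z‖ₑ) (x + s • h) := by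
  have hmem : ∀ s ∈ Icc (0 : ℝ) 1, x + s • h ∈ B := fun s hs =>
    hBc.add_smul_mem hx hxh hs
  have hd : ∀ s ∈ uIcc (0 : ℝ) 1, HasDerivAt (fun s : ℝ => v (x + s • h))
      (fderiv ℝ v (x + s • h) h) s := fun s hs => by
    rw [uIcc_of_le zero_le_one] at hs
    have h1 : HasFDerivAt v (fderiv ℝ v (x + s • h)) (x + s • h) :=
      ((hv.differentiableOn one_ne_zero).differentiableAt (hBo.mem_nhds (hmem s hs))).hasFDerivAt
    have h2 : HasDerivAt (fun s : ℝ => x + s • h) h s := by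
      simpa using ((hasDerivAt_id s).smul_const h).const_add x
    exact h1.comp_hasDerivAt s h2
  have hcont : ContinuousOn (fun s : ℝ => fderiv ℝ v (x + s • h) h) (uIcc 0 1) := by
    rw [uIcc_of_le zero_le_one]
    have h1 : ContinuousOn (fderiv ℝ v) B := hv.continuousOn_fderiv_of_isOpen hBo le_rfl
    exact (h1.comp (by fun_prop) hmem).clm_apply continuousOn_const
  have hint := intervalIntegral.integral_eq_sub_of_hasDerivAt hd hcont.intervalIntegrable
  simp only [one_smul, zero_smul, add_zero] at hint
  rw [← enorm_neg, neg_sub, ← hint, intervalIntegral.integral_of_le zero_le_one]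
  refine (enorm_integral_le_lintegral_enorm _).trans (setLIntegral_mono' measurableSet_Ioc
    fun s hs => ?_)
  rw [indicator_of_mem (hmem s ⟨hs.1.le, hs.2⟩), mul_comm]
  exact (fderiv ℝ v (x + s • h)).le_opENorm h

/-- With y = x + h, the difference is bounded by the gradient along the segment. After exchanging
the integrals, translation invariance makes each inner integral over x at most the total of |Dv|;
the shifts h fill a ball of radius 2r and have length below 2r, which gives the constant. -/
theorem lintegral_ball_enorm_sub_le {n : ℕ} (z : Eucl n) (r : ℝ) :
    ∃ C : ℝ≥0, ∀ v : Eucl n → ℝ, ContDiffOn ℝ 1 v (Metric.ball z r) →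
      ∫⁻ x in Metric.ball z r, ∫⁻ y in Metric.ball z r, ‖v x - v y‖ₑ ≤
        C * ∫⁻ x in Metric.ball z r, ‖fderiv ℝ v x‖ₑ := by
  refine ⟨(volume (Metric.ball (0 : Eucl n) (2 * r))).toNNReal * (2 * r).toNNReal,
    fun v hv => ?_⟩
  have hBo : IsOpen (Metric.ball z r) := Metric.isOpen_ball
  have hBc : Convex ℝ (Metric.ball z r) := convex_ball z r
  have hBd : ∀ x ∈ Metric.ball z r, ∀ h, x + h ∈ Metric.ball z r → ‖h‖ < 2 * r := by
    intro x hx h hxh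
    have h1 : dist x z < r := hx
    have h2 : dist (x + h) z < r := hxh
    have : dist (x + h) x ≤ dist (x + h) z + dist x z := dist_triangle_right _ _ _
    rw [dist_self_add_left] at this
    linarith
  generalize Metric.ball z r = B at *
  set N : Eucl n → ℝ≥0∞ := B.indicator fun w => ‖fderiv ℝ v w‖ₑ with hN
  have hNm : Measurable N :=
    (measurable_fderiv ℝ v).enorm.indicator hBo.measurableSet
  have hDv : volume (Metric.ball (0 : Eucl n) (2 * r)) ≠ ⊤ := measure_ball_lt_top.ne
  have hDo : IsOpen (Metric.ball (0 : Eucl n) (2 * r)) := Metric.isOpen_ball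
  have hDh : ∀ h : Eucl n, ‖h‖ < 2 * r → h ∈ Metric.ball (0 : Eucl n) (2 * r) := by simp
  generalize Metric.ball (0 : Eucl n) (2 * r) = D at *
  have key : ∀ x h, B.indicator (fun x => B.indicator (fun y => ‖v x - v y‖ₑ) (x + h)) x ≤
      D.indicator (fun _ => ENNReal.ofReal (2 * r)) h *
        ∫⁻ s in Ioc (0 : ℝ) 1, N (x + s • h) := by
    intro x h
    by_cases hx : x ∈ B
    · by_cases hxh : x + h ∈ B
      · rw [indicator_of_mem hx, indicator_of_mem hxh]
        have hh : ‖h‖ < 2 * r := hBd x hx h hxh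
        have hhD : h ∈ D := hDh h hh
        rw [indicator_of_mem hhD]
        refine (enorm_sub_le_lintegral_segment hBo hBc hv hx hxh).trans
          ?_
        rw [lintegral_const_mul _ (by exact hNm.comp (by fun_prop))]
        refine mul_le_mul_left ?_ _
        rw [← ofReal_norm]
        exact ENNReal.ofReal_le_ofReal hh.le
      · simp [hx, hxh]
    · simp [hx]
  have hDm : Measurable (D.indicator fun _ : Eucl n => ENNReal.ofReal (2 * r)) :=
    measurable_const.indicator hDo.measurableSet
  have hm3 : Measurable fun p : (Eucl n × Eucl n) × ℝ => N (p.1.1 + p.2 • p.1.2) := by fun_prop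
  have hm2 : Measurable fun p : Eucl n × Eucl n => ∫⁻ s in Ioc (0 : ℝ) 1, N (p.1 + s • p.2) :=
    hm3.lintegral_prod_right'
  calc ∫⁻ x in B, ∫⁻ y in B, ‖v x - v y‖ₑ
      = ∫⁻ x, ∫⁻ h, B.indicator (fun x => B.indicator (fun y => ‖v x - v y‖ₑ) (x + h)) x := by
        rw [← lintegral_indicator hBo.measurableSet]
        congr 1; ext x
        by_cases hx : x ∈ B
        · simp only [indicator_of_mem hx]
          rw [lintegral_add_left_eq_self (fun w => B.indicator (fun y => ‖v x - v y‖ₑ) w) x,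
            lintegral_indicator hBo.measurableSet]
        · simp [hx]
    _ ≤ ∫⁻ x, ∫⁻ h, D.indicator (fun _ => ENNReal.ofReal (2 * r)) h *
        ∫⁻ s in Ioc (0 : ℝ) 1, N (x + s • h) :=
        lintegral_mono fun x => lintegral_mono fun h => key x h
    _ = ∫⁻ h, ∫⁻ x, D.indicator (fun _ => ENNReal.ofReal (2 * r)) h *
        ∫⁻ s in Ioc (0 : ℝ) 1, N (x + s • h) :=
        lintegral_lintegral_swap ((hDm.comp measurable_snd).mul hm2).aemeasurable
    _ = ∫⁻ h, D.indicator (fun _ => ENNReal.ofReal (2 * r)) h * ∫⁻ w, N w := by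
        congr 1; ext h
        have hmh : Measurable fun x => ∫⁻ s in Ioc (0 : ℝ) 1, N (x + s • h) :=
          hm2.comp (measurable_id.prodMk measurable_const)
        rw [lintegral_const_mul _ hmh]
        congr 1
        rw [lintegral_lintegral_swap (by
          exact (show Measurable fun p : Eucl n × ℝ => N (p.1 + p.2 • h) by fun_prop).aemeasurable)]
        simp_rw [fun s : ℝ => lintegral_add_right_eq_self (μ := volume) N (s • h)]
        simp
    _ = _ := by
        rw [lintegral_mul_const _ hDm, lintegral_indicator hDo.measurableSet,
          lintegral_indicator hBo.measurableSet, setLIntegral_const,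
          ENNReal.coe_mul, ENNReal.coe_toNNReal hDv]
        rw [mul_comm (ENNReal.ofReal (2 * r))]
        rfl

/-- The comparison of the means of functions over two sets by their gradients on `Ω`. -/
def OscillationBound {n : ℕ} (Ω : Set (Eucl n)) (A B : Set (Eucl n)) : Prop :=
  ∃ C : ℝ≥0, ∀ v : Eucl n → ℝ, ContDiffOn ℝ 1 v Ω →
    ∫⁻ x in A, ∫⁻ y in B, ‖v x - v y‖ₑ ≤ C * ∫⁻ x in Ω, ‖fderiv ℝ v x‖ₑ

theorem OscillationBound.mono {n : ℕ} {Ω A B A' B' : Set (Eucl n)}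
    (h : OscillationBound Ω A B) (hA : A' ⊆ A) (hB : B' ⊆ B) : OscillationBound Ω A' B' := by
  obtain ⟨C, hC⟩ := h
  refine ⟨C, fun v hv => le_trans ?_ (hC v hv)⟩
  exact (lintegral_mono fun x => lintegral_mono_set hB).trans (lintegral_mono_set hA)

theorem ContDiffOn.aemeasurable_restrict {n : ℕ} {Ω : Set (Eucl n)} (hΩ : IsOpen Ω)
    {v : Eucl n → ℝ} (hv : ContDiffOn ℝ 1 v Ω) {A : Set (Eucl n)} (hA : A ⊆ Ω) :
    AEMeasurable v (volume.restrict A) :=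
  (hv.continuousOn.aemeasurable hΩ.measurableSet).mono_measure (Measure.restrict_mono hA le_rfl)

theorem OscillationBound.symm {n : ℕ} {Ω A B : Set (Eucl n)} (hΩ : IsOpen Ω) (hA : A ⊆ Ω)
    (hB : B ⊆ Ω) (h : OscillationBound Ω A B) : OscillationBound Ω B A := by
  obtain ⟨C, hC⟩ := h
  refine ⟨C, fun v hv => le_trans (le_of_eq ?_) (hC v hv)⟩
  have h1 := ContDiffOn.aemeasurable_restrict hΩ hv hA
  have h2 := ContDiffOn.aemeasurable_restrict hΩ hv hB
  rw [lintegral_lintegral_swap]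
  · simp_rw [fun x y => enorm_sub_rev (v x) (v y)]
  · exact ((h2.comp_fst).sub (h1.comp_snd)).enorm

/-- Insert an intermediate point y of B into v(x) - v(z) and average over y; this divides by the
measure of B, whence B must not be null. -/
theorem OscillationBound.trans {n : ℕ} {Ω A B D : Set (Eucl n)} (hΩ : IsOpen Ω) (hA : A ⊆ Ω)
    (hB : B ⊆ Ω) (hD : D ⊆ Ω) (hA' : volume A ≠ ⊤) (hB' : volume B ≠ ⊤) (hB0 : volume B ≠ 0)
    (hD' : volume D ≠ ⊤)
    (h : OscillationBound Ω A B) (h' : OscillationBound Ω B D) : OscillationBound Ω A D := by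
  obtain ⟨C, hC⟩ := h
  obtain ⟨C', hC'⟩ := h'
  refine ⟨((volume B).toNNReal)⁻¹ * ((volume D).toNNReal * C + (volume A).toNNReal * C'),
    fun v hv => ?_⟩
  have h1 := ContDiffOn.aemeasurable_restrict hΩ hv hA
  have h2 := ContDiffOn.aemeasurable_restrict hΩ hv hB
  have h3 := ContDiffOn.aemeasurable_restrict hΩ hv hD
  set I := ∫⁻ x in Ω, ‖fderiv ℝ v x‖ₑ
  have hb : (volume B).toNNReal ≠ 0 := by simp [ENNReal.toNNReal_eq_zero_iff, hB0, hB']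
  have step : volume B * ∫⁻ x in A, ∫⁻ z in D, ‖v x - v z‖ₑ ≤
      volume D * (C * I) + volume A * (C' * I) := by
    have e1 : volume B * ∫⁻ x in A, ∫⁻ z in D, ‖v x - v z‖ₑ
        = ∫⁻ x in A, ∫⁻ y in B, ∫⁻ z in D, ‖v x - v z‖ₑ := by
      rw [← lintegral_const_mul' _ _ hB']
      simp [mul_comm]
    have e2 : ∫⁻ x in A, ∫⁻ y in B, ∫⁻ z in D, ‖v x - v z‖ₑ ≤
        ∫⁻ x in A, ∫⁻ y in B, (volume D * ‖v x - v y‖ₑ + ∫⁻ z in D, ‖v y - v z‖ₑ) := by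
      refine lintegral_mono fun x => lintegral_mono fun y => ?_
      calc ∫⁻ z in D, ‖v x - v z‖ₑ ≤ ∫⁻ z in D, (‖v x - v y‖ₑ + ‖v y - v z‖ₑ) := by
            refine lintegral_mono fun z => ?_
            rw [← sub_add_sub_cancel (v x) (v y) (v z)]
            exact enorm_add_le _ _
        _ = _ := by
            rw [lintegral_add_left measurable_const, setLIntegral_const, mul_comm]
    have e3 : ∫⁻ x in A, ∫⁻ y in B, (volume D * ‖v x - v y‖ₑ + ∫⁻ z in D, ‖v y - v z‖ₑ) ≤
        volume D * (C * I) + volume A * (C' * I) := by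
      have m1 : AEMeasurable (fun p : Eucl n × Eucl n => ‖v p.1 - v p.2‖ₑ)
          ((volume.restrict A).prod (volume.restrict B)) :=
        ((h1.comp_fst).sub (h2.comp_snd)).enorm
      have m2 : AEMeasurable (fun y => ∫⁻ z in D, ‖v y - v z‖ₑ) (volume.restrict B) :=
        AEMeasurable.lintegral_prod_right' (f := fun p : Eucl n × Eucl n => ‖v p.1 - v p.2‖ₑ)
          ((h2.comp_fst).sub (h3.comp_snd)).enorm
      calc _ = ∫⁻ x in A, (volume D * (∫⁻ y in B, ‖v x - v y‖ₑ) +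
            ∫⁻ y in B, ∫⁻ z in D, ‖v y - v z‖ₑ) := by
            congr 1; ext x
            rw [lintegral_add_right' _ m2, lintegral_const_mul' _ _ hD']
        _ = volume D * (∫⁻ x in A, ∫⁻ y in B, ‖v x - v y‖ₑ) +
            volume A * ∫⁻ y in B, ∫⁻ z in D, ‖v y - v z‖ₑ := by
            rw [lintegral_add_right _ measurable_const, lintegral_const_mul' _ _ hD',
              setLIntegral_const, mul_comm (volume A)]
        _ ≤ _ := by gcongr <;> [exact hC v hv; exact hC' v hv]
    exact e1.le.trans (e2.trans e3)
  rw [ENNReal.coe_mul, ENNReal.coe_inv hb, ENNReal.coe_add, ENNReal.coe_mul, ENNReal.coe_mul,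
    ENNReal.coe_toNNReal hA', ENNReal.coe_toNNReal hB', ENNReal.coe_toNNReal hD', mul_assoc,
    ← ENNReal.div_eq_inv_mul, ENNReal.le_div_iff_mul_le (Or.inl hB0) (Or.inl hB'), mul_comm]
  refine step.trans (le_of_eq ?_)
  ring

/-- A chain of balls in disguise: the relation holds between nearby points by the inequality on one
ball, and it is symmetric and transitive after shrinking to the smaller radius, so connectedness
spreads it to all pairs. -/
theorem exists_oscillationBound_ball {n : ℕ} {Ω : Set (Eucl n)} (hΩ : IsOpen Ω)
    (hc : IsPreconnected Ω) {x y : Eucl n} (hx : x ∈ Ω) (hy : y ∈ Ω) :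
    ∃ r > 0, Metric.ball x r ⊆ Ω ∧ Metric.ball y r ⊆ Ω ∧
      OscillationBound Ω (Metric.ball x r) (Metric.ball y r) := by
  refine hc.induction₂ (fun x y => ∃ r > 0, Metric.ball x r ⊆ Ω ∧ Metric.ball y r ⊆ Ω ∧
      OscillationBound Ω (Metric.ball x r) (Metric.ball y r)) ?_ ?_ ?_ hx hy
  · intro x hx
    obtain ⟨R, hR, hRΩ⟩ := Metric.isOpen_iff.1 hΩ x hx
    filter_upwards [mem_nhdsWithin_of_mem_nhds (Metric.ball_mem_nhds x (half_pos hR))] with y hy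
    have h1 : Metric.ball x (R / 2) ⊆ Metric.ball x R := Metric.ball_subset_ball (by linarith)
    have h2 : Metric.ball y (R / 2) ⊆ Metric.ball x R := by
      refine Metric.ball_subset_ball' ?_
      have : dist y x < R / 2 := hy
      linarith
    refine ⟨R / 2, half_pos hR, h1.trans hRΩ, h2.trans hRΩ, ?_⟩
    obtain ⟨C, hC⟩ := lintegral_ball_enorm_sub_le x R
    have : OscillationBound Ω (Metric.ball x R) (Metric.ball x R) :=
      ⟨C, fun v hv => (hC v (hv.mono hRΩ)).trans (by gcongr)⟩
    exact this.mono h1 h2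
  · rintro x y z - - - ⟨r, hr, hxr, hyr, h⟩ ⟨s, hs, hys, hzs, h'⟩
    have m1 : min r s ≤ r := min_le_left _ _
    have m2 : min r s ≤ s := min_le_right _ _
    refine ⟨min r s, lt_min hr hs, (Metric.ball_subset_ball m1).trans hxr,
      (Metric.ball_subset_ball m2).trans hzs, ?_⟩
    exact OscillationBound.trans hΩ ((Metric.ball_subset_ball m1).trans hxr)
      ((Metric.ball_subset_ball m1).trans hyr) ((Metric.ball_subset_ball m2).trans hzs)
      measure_ball_lt_top.ne measure_ball_lt_top.ne (Metric.measure_ball_pos _ _ (lt_min hr hs)).ne'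
      measure_ball_lt_top.ne
      (h.mono (Metric.ball_subset_ball m1) (Metric.ball_subset_ball m1))
      (h'.mono (Metric.ball_subset_ball m2) (Metric.ball_subset_ball m2))
  · rintro x y - - ⟨r, hr, hxr, hyr, h⟩
    exact ⟨r, hr, hyr, hxr, h.symm hΩ hxr hyr⟩

/-- The radii and constants of the previous lemma depend on the pair of points. Compactness of K × K
leaves finitely many products of balls, and their constants add up. -/
theorem exists_oscillation_bound_compact {n : ℕ} {Ω : Set (Eucl n)} (hΩ : IsOpen Ω)
    (hc : IsPreconnected Ω) {K : Set (Eucl n)} (hK : IsCompact K) (hKΩ : K ⊆ Ω) :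
    ∃ C : ℝ≥0, ∀ v : Eucl n → ℝ, ContDiffOn ℝ 1 v Ω →
      ∫⁻ p in K ×ˢ K, ‖v p.1 - v p.2‖ₑ ∂(volume.prod volume) ≤
        C * ∫⁻ x in Ω, ‖fderiv ℝ v x‖ₑ := by
  refine (hK.prod hK).induction_on (p := fun s => ∃ C : ℝ≥0, ∀ v : Eucl n → ℝ,
      ContDiffOn ℝ 1 v Ω → ∫⁻ p in s, ‖v p.1 - v p.2‖ₑ ∂(volume.prod volume) ≤
        C * ∫⁻ x in Ω, ‖fderiv ℝ v x‖ₑ) ⟨0, by simp⟩ ?_ ?_ ?_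
  · rintro s t hst ⟨C, hC⟩
    exact ⟨C, fun v hv => (lintegral_mono_set hst).trans (hC v hv)⟩
  · rintro s t ⟨C, hC⟩ ⟨C', hC'⟩
    refine ⟨C + C', fun v hv => (lintegral_union_le _ _ _).trans ?_⟩
    rw [ENNReal.coe_add, add_mul]
    exact add_le_add (hC v hv) (hC' v hv)
  · rintro ⟨x, y⟩ ⟨hx, hy⟩
    obtain ⟨r, hr, hxr, hyr, C, hC⟩ := exists_oscillationBound_ball hΩ hc (hKΩ hx) (hKΩ hy)
    refine ⟨Metric.ball x r ×ˢ Metric.ball y r, mem_nhdsWithin_of_mem_nhds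
      (prod_mem_nhds (Metric.ball_mem_nhds x hr) (Metric.ball_mem_nhds y hr)), C, fun v hv => ?_⟩
    refine le_trans (le_of_eq ?_) (hC v hv)
    rw [← Measure.prod_restrict, lintegral_prod]
    exact (((ContDiffOn.aemeasurable_restrict hΩ hv hxr).comp_fst).sub
      ((ContDiffOn.aemeasurable_restrict hΩ hv hyr).comp_snd)).enorm

theorem exists_smoothTransition_deriv_bound :
    ∃ D : ℝ≥0, (∀ s, ‖deriv Real.smoothTransition s‖₊ ≤ D) ∧
      ∀ s ∉ Ioo (0 : ℝ) 1, deriv Real.smoothTransition s = 0 := by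
  have h0 : ∀ s ∉ Ioo (0 : ℝ) 1, deriv Real.smoothTransition s = 0 := by
    intro s hs
    rcases le_or_gt s 0 with h | h
    · refine IsLocalMin.deriv_eq_zero (Eventually.of_forall fun y => ?_)
      rw [Real.smoothTransition.zero_of_nonpos h]
      exact Real.smoothTransition.nonneg y
    · have h1 : 1 ≤ s := not_lt.1 fun h1 => hs ⟨h, h1⟩
      refine IsLocalMax.deriv_eq_zero (Eventually.of_forall fun y => ?_)
      rw [Real.smoothTransition.one_of_one_le h1]
      exact Real.smoothTransition.le_one y
  have hc : Continuous (deriv Real.smoothTransition) :=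
    (Real.smoothTransition.contDiff (n := 1)).continuous_deriv le_rfl
  obtain ⟨D, hD⟩ := isCompact_Icc.exists_bound_of_continuousOn (s := Icc (0 : ℝ) 1) hc.continuousOn
  refine ⟨D.toNNReal, fun s => ?_, h0⟩
  by_cases hs : s ∈ Ioo (0 : ℝ) 1
  · exact NNReal.coe_le_coe.1 ((hD s ⟨hs.1.le, hs.2.le⟩).trans (Real.le_coe_toNNReal D))
  · simp [h0 s hs]

/-- On a connected open set of finite measure, the total variation of a function between two
levels is bounded below if neither the superlevel nor the sublevel set is small. -/
theorem exists_level_gap_bound {n : ℕ} {Ω : Set (Eucl n)} (hΩ : IsOpen Ω)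
    (hc : IsPreconnected Ω) (hv : volume Ω ≠ ⊤) {m : ℝ≥0∞} (hm : m ≠ 0) :
    ∃ C : ℝ≥0, ∀ (g : Eucl n → ℝ) (t₁ t₂ : ℝ), ContDiffOn ℝ 1 g Ω → t₁ < t₂ →
      m ≤ volume (Ω ∩ {x | t₂ ≤ g x}) → m ≤ volume (Ω ∩ {x | g x ≤ t₁}) →
      ENNReal.ofReal (t₂ - t₁) ≤ C * ∫⁻ x in Ω ∩ {x | t₁ < g x ∧ g x < t₂}, ‖fderiv ℝ g x‖ₑ := by
  by_cases hmt : m = ⊤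
  · exact ⟨0, fun g t₁ t₂ _ _ h _ => absurd (top_le_iff.1 (hmt ▸ h))
      (measure_ne_top_of_subset inter_subset_left hv)⟩
  have hm2 : m / 2 ≠ 0 := (ENNReal.half_pos hm).ne'
  -- K misses less than m/2 of Ω, so each of the two large level sets keeps measure at least m/2
  -- inside K.
  obtain ⟨K, hKΩ, hK, hKm⟩ := hΩ.measurableSet.exists_isCompact_sdiff_lt hv hm2
  obtain ⟨C, hC⟩ := exists_oscillation_bound_compact hΩ hc hK hKΩ
  obtain ⟨D, hD, hD0⟩ := exists_smoothTransition_deriv_bound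
  refine ⟨((m / 2).toNNReal * (m / 2).toNNReal)⁻¹ * (C * D), fun g t₁ t₂ hg ht h₂ h₁ => ?_⟩
  set E := Ω ∩ {x | t₁ < g x ∧ g x < t₂} with hE
  have hEm : MeasurableSet E :=
    (hg.continuousOn.isOpen_inter_preimage hΩ isOpen_Ioo).measurableSet
  have hδ : 0 < t₂ - t₁ := sub_pos.2 ht
  -- A smooth truncation of g, equal to 0 where g ≤ t₁ and to 1 where g ≥ t₂. Its gradient lives on
  -- the band `E` and is at most D |∇g| / (t₂ - t₁), while its oscillation over K × K is at least
  -- (m/2)².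
  set v : Eucl n → ℝ := fun x => Real.smoothTransition ((g x - t₁) / (t₂ - t₁)) with hvdef
  have hvC : ContDiffOn ℝ 1 v Ω :=
    (Real.smoothTransition.contDiff (n := 1)).comp_contDiffOn
      ((hg.sub contDiffOn_const).div_const _)
  have hfd : ∀ x ∈ Ω, ‖fderiv ℝ v x‖ₑ ≤
      E.indicator (fun x => D * (ENNReal.ofReal (t₂ - t₁))⁻¹ * ‖fderiv ℝ g x‖ₑ) x := by
    intro x hx
    have h1 : HasFDerivAt g (fderiv ℝ g x) x :=
      ((hg.differentiableOn one_ne_zero).differentiableAt (hΩ.mem_nhds hx)).hasFDerivAt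
    have h2 : HasFDerivAt (fun x => (g x - t₁) / (t₂ - t₁)) ((t₂ - t₁)⁻¹ • fderiv ℝ g x) x := by
      simp_rw [div_eq_inv_mul]
      exact (h1.sub_const t₁).const_mul _
    have h3 : HasDerivAt Real.smoothTransition
        (deriv Real.smoothTransition ((g x - t₁) / (t₂ - t₁))) ((g x - t₁) / (t₂ - t₁)) :=
      ((Real.smoothTransition.contDiff (n := 1)).differentiable one_ne_zero _).hasDerivAt
    have h4 := (h3.comp_hasFDerivAt x h2).fderiv
    change fderiv ℝ v x = _ at h4
    rw [h4]
    by_cases hxE : x ∈ E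
    · rw [indicator_of_mem hxE, enorm_smul, enorm_smul, ← mul_assoc,
        enorm_inv hδ.ne', Real.enorm_of_nonneg hδ.le]
      gcongr
      rw [enorm_eq_nnnorm]
      exact_mod_cast hD _
    · have : (g x - t₁) / (t₂ - t₁) ∉ Ioo (0 : ℝ) 1 := by
        rintro ⟨h5, h6⟩
        rw [div_lt_one hδ] at h6
        rw [lt_div_iff₀ hδ] at h5
        exact hxE ⟨hx, by linarith, by linarith⟩
      rw [hD0 _ this, zero_smul]
      exact (enorm_zero (E := Eucl n →L[ℝ] ℝ)).le.trans bot_le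
  have hup : ∫⁻ x in Ω, ‖fderiv ℝ v x‖ₑ ≤
      D * (ENNReal.ofReal (t₂ - t₁))⁻¹ * ∫⁻ x in E, ‖fderiv ℝ g x‖ₑ := by
    refine (setLIntegral_mono' hΩ.measurableSet hfd).trans ?_
    rw [← lintegral_const_mul _ (measurable_fderiv ℝ g).enorm, ← lintegral_indicator hEm]
    exact setLIntegral_le_lintegral _ _
  have hlow : ∀ A : Set (Eucl n), m ≤ volume (Ω ∩ A) → m / 2 ≤ volume (K ∩ A) := by
    intro A hA
    have h5 : m ≤ volume (K ∩ A) + m / 2 := by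
      refine hA.trans ((measure_mono (fun x hx => ?_ : Ω ∩ A ⊆ (K ∩ A) ∪ (Ω \ K))).trans
        ((measure_union_le _ _).trans (add_le_add le_rfl hKm.le)))
      by_cases hxK : x ∈ K
      · exact Or.inl ⟨hxK, hx.2⟩
      · exact Or.inr ⟨hx.1, hxK⟩
    have h6 : m / 2 + m / 2 ≤ volume (K ∩ A) + m / 2 := by rwa [ENNReal.add_halves]
    exact (ENNReal.add_le_add_iff_right (ENNReal.div_ne_top hmt two_ne_zero)).1 h6
  have hcK : ContinuousOn g K := hg.continuousOn.mono hKΩ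
  have hAm : MeasurableSet (K ∩ {x | t₂ ≤ g x}) :=
    (hcK.preimage_isClosed_of_isClosed hK.isClosed isClosed_Ici).measurableSet
  have hBm : MeasurableSet (K ∩ {x | g x ≤ t₁}) :=
    (hcK.preimage_isClosed_of_isClosed hK.isClosed isClosed_Iic).measurableSet
  have hKK : (m / 2) * (m / 2) ≤ ∫⁻ p in K ×ˢ K, ‖v p.1 - v p.2‖ₑ ∂(volume.prod volume) := by
    calc (m / 2) * (m / 2) ≤ volume (K ∩ {x | t₂ ≤ g x}) * volume (K ∩ {x | g x ≤ t₁}) :=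
          mul_le_mul' (hlow _ h₂) (hlow _ h₁)
      _ = ∫⁻ p in (K ∩ {x | t₂ ≤ g x}) ×ˢ (K ∩ {x | g x ≤ t₁}), 1 ∂(volume.prod volume) := by
          rw [setLIntegral_one, Measure.prod_prod]
      _ ≤ ∫⁻ p in (K ∩ {x | t₂ ≤ g x}) ×ˢ (K ∩ {x | g x ≤ t₁}), ‖v p.1 - v p.2‖ₑ
            ∂(volume.prod volume) := by
          refine setLIntegral_mono' (hAm.prod hBm) fun p hp => ?_
          have e1 : v p.1 = 1 := Real.smoothTransition.one_of_one_le (by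
            rw [one_le_div hδ]; linarith [show t₂ ≤ g p.1 from hp.1.2])
          have e2 : v p.2 = 0 := Real.smoothTransition.zero_of_nonpos (by
            refine div_nonpos_of_nonpos_of_nonneg ?_ hδ.le
            linarith [show g p.2 ≤ t₁ from hp.2.2])
          simp [e1, e2]
      _ ≤ _ := lintegral_mono_set (prod_mono inter_subset_left inter_subset_left)
  have hfin := hKK.trans ((hC v hvC).trans (mul_le_mul_right hup _))
  have hδ0 : ENNReal.ofReal (t₂ - t₁) ≠ 0 := by simpa using ht
  have hm2t : m / 2 ≠ ⊤ := ENNReal.div_ne_top hmt two_ne_zero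
  have hmm : (m / 2).toNNReal * (m / 2).toNNReal ≠ 0 := by
    simp only [ne_eq, mul_self_eq_zero, ENNReal.toNNReal_eq_zero_iff]
    tauto
  rw [ENNReal.coe_mul, ENNReal.coe_inv hmm, ENNReal.coe_mul, ENNReal.coe_toNNReal hm2t, mul_assoc,
    ← ENNReal.div_eq_inv_mul, ENNReal.le_div_iff_mul_le (Or.inl (mul_ne_zero hm2 hm2))
      (Or.inl (ENNReal.mul_ne_top hm2t hm2t))]
  calc ENNReal.ofReal (t₂ - t₁) * (m / 2 * (m / 2))
      ≤ ENNReal.ofReal (t₂ - t₁) * (C * (D * (ENNReal.ofReal (t₂ - t₁))⁻¹ *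
        ∫⁻ x in E, ‖fderiv ℝ g x‖ₑ)) := mul_le_mul_right hfin _
    _ = (ENNReal.ofReal (t₂ - t₁) * (ENNReal.ofReal (t₂ - t₁))⁻¹) *
        (C * D * ∫⁻ x in E, ‖fderiv ℝ g x‖ₑ) := by ring
    _ = _ := by rw [ENNReal.mul_inv_cancel hδ0 ENNReal.ofReal_ne_top, one_mul, ENNReal.coe_mul]

end PolyaSzego

end

noncomputable section

namespace PolyaSzego

open Filter Topology

/-! ### Regular values and the isoperimetric inequality for superlevel sets -/

open scoped Gradient in
/-- After an arbitrarily small linear perturbation, a smooth function has countably many critical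
values. -/
theorem exists_small_tilt_countable_criticalValues {n : ℕ} {Ω : Set (Eucl n)} (hΩ : IsOpen Ω)
    {g : Eucl n → ℝ} (hg : ContDiffOn ℝ ∞ g Ω) {δ : ℝ} (hδ : 0 < δ) :
    ∃ a : Eucl n, ‖a‖ < δ ∧
      {τ | ∃ x ∈ Ω, g x + inner ℝ a x = τ ∧ fderiv ℝ g x + innerSL ℝ a = 0}.Countable := by
  let e := (InnerProductSpace.toDual ℝ (Eucl n)).symm
  let G : Eucl n → Eucl n := fun x => e (fderiv ℝ g x)
  have hG : ∀ x ∈ Ω, HasFDerivAt G (fderiv ℝ G x) x := fun x hx => by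
    have h1 : ContDiffAt ℝ 1 (fderiv ℝ g) x :=
      ((hg x hx).contDiffAt (hΩ.mem_nhds hx)).fderiv_right (m := 1) (by norm_cast)
    have h2 : DifferentiableAt ℝ (fderiv ℝ g) x := h1.differentiableAt one_ne_zero
    exact (e.toContinuousLinearEquiv.differentiableAt.comp x h2).hasFDerivAt
  -- Only the equidimensional case of Sard's theorem is needed: for the gradient map G, the image of
  -- the points with singular Hessian is null, so arbitrarily small vectors `a` avoid it.
  have hnull : volume (G '' {x ∈ Ω | (fderiv ℝ G x).det = 0}) = 0 :=
    addHaar_image_eq_zero_of_det_fderivWithin_eq_zero volume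
      (fun x hx => (hG x hx.1).hasFDerivWithinAt) fun x hx => hx.2
  obtain ⟨a, ha, haG⟩ : ∃ a ∈ Metric.ball (0 : Eucl n) δ,
      a ∉ G '' {x ∈ Ω | (fderiv ℝ G x).det = 0} := by
    by_contra! hcon
    exact (Metric.measure_ball_pos volume (0 : Eucl n) hδ).ne' (measure_mono_null hcon hnull)
  refine ⟨-a, by simpa using ha, ?_⟩
  let Z : Set (Eucl n) := {x ∈ Ω | G x = a}
  -- The critical points of g - ⟨a, x⟩ are the solutions of G = a. By the choice of `a` the Hessian
  -- is invertible at each of them, so they are isolated, hence countable.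
  have hZ : Z.Countable := by
    obtain ⟨t, htZ, htc, ht⟩ := TopologicalSpace.countable_cover_nhdsWithin (s := Z)
      (f := fun x => {x}) fun x hx => by
        have hdet : (fderiv ℝ G x).det ≠ 0 := fun h => haG ⟨x, ⟨hx.1, h⟩, hx.2⟩
        have hanti : ∃ C, AntilipschitzWith C (fderiv ℝ G x) :=
          ⟨_, ((fderiv ℝ G x).toContinuousLinearEquivOfDetNeZero hdet).antilipschitz⟩
        have h1 : ∀ᶠ z in 𝓝[Z \ {x}] x, G z ≠ a :=
          ((hG x hx.1).hasFDerivWithinAt (s := Z)).eventually_ne hanti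
        rw [sdiff_eq, nhdsWithin_inter', eventually_inf_principal] at h1
        filter_upwards [h1, self_mem_nhdsWithin] with z hz hzZ
        by_contra hne
        exact hz hne hzZ.2
    refine htc.mono (ht.trans ?_)
    simp
  refine (hZ.image fun x => g x + inner ℝ (-a) x).mono ?_
  rintro τ ⟨x, hx, rfl, hcrit⟩
  refine ⟨x, ⟨hx, ?_⟩, rfl⟩
  have h3 : fderiv ℝ g x = innerSL ℝ a := by
    rw [map_neg] at hcrit
    exact eq_of_sub_eq_zero (by rw [sub_eq_add_neg]; exact hcrit)
  change e (fderiv ℝ g x) = a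
  rw [h3]
  exact (InnerProductSpace.toDual ℝ (Eucl n)).symm_apply_apply a

/-- The gradient is nonzero on the level τ in W, so the level set is a hypersurface there. It
remains that the boundary of the superlevel set within Ω is locally all of this level set and does
not reach the part of ∂W inside Ω; `hR` and `hRW` exclude the latter. -/
theorem isAdmissible_superlevel {n : ℕ} {Ω W : Set (Eucl n)} {h : Eucl n → ℝ} {τ : ℝ}
    (hW : IsOpen W) (hWΩ : W ⊆ Ω)
    (hh : ContDiffOn ℝ ∞ h W) (hreg : ∀ x ∈ W, h x = τ → fderiv ℝ h x ≠ 0) {R : ℝ}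
    (hR : ∀ x ∈ W, τ < h x → ‖x‖ ≤ R) (hRW : Ω ∩ Metric.closedBall 0 R ⊆ W) :
    IsAdmissible Ω (W ∩ {x | τ < h x}) ∧ Ω ∩ frontier (W ∩ {x | τ < h x}) ⊆ W ∩ {x | h x = τ} := by
  set S := W ∩ {x | τ < h x} with hS
  have hSo : IsOpen S := hh.continuousOn.isOpen_inter_preimage hW isOpen_Ioi
  have hSR : S ⊆ Metric.closedBall 0 R := fun x hx => by simpa using hR x hx.1 hx.2
  have hsub : Ω ∩ frontier S ⊆ W ∩ {x | h x = τ} := by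
    rintro x ⟨hxΩ, hx⟩
    rw [hSo.frontier_eq] at hx
    have hxW : x ∈ W := hRW ⟨hxΩ, closure_minimal hSR Metric.isClosed_closedBall hx.1⟩
    refine ⟨hxW, le_antisymm (not_lt.1 fun hlt => hx.2 ⟨hxW, hlt⟩) ?_⟩
    have hc : ContinuousAt h x := hh.continuousOn.continuousAt (hW.mem_nhds hxW)
    have hne : (𝓝[S] x).NeBot := mem_closure_iff_nhdsWithin_neBot.1 hx.1
    have hct : Tendsto h (𝓝[S] x) (𝓝 (h x)) := hc.mono_left nhdsWithin_le_nhds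
    refine ge_of_tendsto hct ?_
    filter_upwards [self_mem_nhdsWithin] with y hy using hy.2.le
  refine ⟨⟨hSo, Metric.isBounded_closedBall.subset hSR, inter_subset_left.trans hWΩ, ?_⟩, hsub⟩
  intro x hx
  have hxW := hsub hx
  have hcf : ContinuousOn (fderiv ℝ h) W := hh.continuousOn_fderiv_of_isOpen hW (by norm_cast)
  refine ⟨W ∩ fderiv ℝ h ⁻¹' {0}ᶜ, fun y => h y - τ,
    hcf.isOpen_inter_preimage hW isOpen_compl_singleton, ⟨hxW.1, hreg x hxW.1 hxW.2⟩,
    (hh.mono inter_subset_left).sub contDiffOn_const, fun y hy => ?_, ?_⟩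
  · rw [fderiv_sub_const]
    exact hy.2
  · ext y
    constructor
    · rintro ⟨hy1, hy2⟩
      exact ⟨hy2, sub_eq_zero.2 (hsub hy1).2⟩
    · rintro ⟨hy2, hy1⟩
      have hyτ : h y = τ := sub_eq_zero.1 hy1
      refine ⟨⟨hWΩ hy2.1, ?_⟩, hy2⟩
      rw [hSo.frontier_eq]
      refine ⟨?_, fun hyS => absurd hyS.2 (by simp [hyτ])⟩
      -- A regular point of the level is not a local maximum, so it is a limit of points where h >
      -- τ.
      have hnmax : ¬ IsLocalMax h y := fun hm => hy2.2 hm.fderiv_eq_zero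
      rw [mem_closure_iff_frequently]
      have : ∃ᶠ z in 𝓝 y, h y < h z := by
        refine fun hcon => hnmax ?_
        exact hcon.mono fun z hz => not_lt.1 hz
      refine (this.and_eventually (hW.mem_nhds hy2.1)).mono fun z hz => ⟨hz.2, ?_⟩
      exact hyτ ▸ hz.1

/-- For all but countably many levels between s₁ and s₂, the superlevel set of a slightly tilted g
is admissible and lies between {g ≥ s₂} and {g > s₁}. The isoperimetric inequality bounds |{g ≥
s₂}|^α by the area of its boundary, and integration over the levels brings in the coarea inequality.
Vanishing far out keeps the superlevel sets bounded and the tilt uniformly small where it matters.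
-/
theorem level_isoperimetric_of_bounded_support {n : ℕ} (hn : 2 ≤ n) {Ω : Set (Eucl n)}
    (hΩ : IsOpen Ω) (hv : volume Ω ≠ ⊤) {α : ℝ} (hα : 0 ≤ α) {M : ℝ≥0∞} {K : ℝ≥0}
    (hK : ∀ S, IsAdmissible Ω S → volume S ≤ M → volume S ^ α ≤ K * area (Ω ∩ frontier S)) :
    ∃ C : ℝ≥0, ∀ (g : Eucl n → ℝ) (R s₁ s₂ : ℝ), ContDiffOn ℝ ∞ g Ω →
      (∀ x ∈ Ω, R ≤ ‖x‖ → g x = 0) → 0 ≤ s₁ → s₁ < s₂ → volume (Ω ∩ {x | s₁ < g x}) ≤ M →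
      ENNReal.ofReal (s₂ - s₁) * volume (Ω ∩ {x | s₂ ≤ g x}) ^ α ≤
        C * ∫⁻ x in Ω ∩ {x | s₁ < g x ∧ g x < s₂}, ‖fderiv ℝ g x‖ₑ := by
  obtain ⟨c, hc⟩ := exists_coarea_bound hn
  refine ⟨K * c, fun g R s₁ s₂ hg hgR hs₁ hs hM => ?_⟩
  -- The tilt is studied on a ball strictly larger than the one that contains the superlevel sets,
  -- so that their closures stay inside it.
  set R' : ℝ := max R 0 + 1 with hR'
  have hR'0 : 0 < R' := by positivity
  have hRR' : max R 0 < R' := by linarith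
  set b := volume (Ω ∩ {x | s₂ ≤ g x}) ^ α with hb
  have hbt : b ≠ ⊤ :=
    ENNReal.rpow_ne_top_of_nonneg hα (measure_ne_top_of_subset inter_subset_left hv)
  set E := Ω ∩ {x | s₁ < g x ∧ g x < s₂} with hE
  set I := ∫⁻ x in E, ‖fderiv ℝ g x‖ₑ with hI
  have key : ∀ δ : ℝ≥0, 0 < δ → ENNReal.ofReal (s₂ - s₁ - 2 * δ) * b ≤
      K * c * (I + (δ + δ) * volume Ω) := by
    intro δ hδ
    have hδ' : (0 : ℝ) < δ := hδ
    -- The two bounds on `a` make the tilt change the gradient by at most δ everywhere and the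
    -- values by at most δ on the ball of radius `R'`.
    obtain ⟨a, ha, hcrit⟩ := exists_small_tilt_countable_criticalValues hΩ hg
      (δ := min δ (δ / R')) (by positivity)
    have ha1 : ‖a‖ ≤ δ := ha.le.trans (min_le_left _ _)
    have ha2 : ‖a‖ * R' ≤ δ := (le_div_iff₀ hR'0).1 (ha.le.trans (min_le_right _ _))
    set h : Eucl n → ℝ := fun x => g x + inner ℝ a x with hh
    set W := Ω ∩ Metric.ball 0 R' with hW
    have hWo : IsOpen W := hΩ.inter Metric.isOpen_ball
    have hWΩ : W ⊆ Ω := inter_subset_left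
    have hhC : ContDiffOn ℝ ∞ h W :=
      (hg.mono hWΩ).add ((innerSL ℝ a).contDiff.contDiffOn)
    have hin : ∀ x ∈ W, |inner ℝ a x| ≤ (δ : ℝ) := fun x hx => by
      have hx2 : ‖x‖ < R' := by simpa using hx.2
      exact (abs_real_inner_le_norm a x).trans
        ((mul_le_mul_of_nonneg_left hx2.le (norm_nonneg a)).trans ha2)
    have hfd : ∀ x ∈ W, fderiv ℝ h x = fderiv ℝ g x + innerSL ℝ a := fun x hx => by
      have h1 : HasFDerivAt g (fderiv ℝ g x) x :=
        ((hg.differentiableOn (by simp)).differentiableAt (hΩ.mem_nhds hx.1)).hasFDerivAt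
      exact (h1.add (innerSL ℝ a).hasFDerivAt).fderiv
    set U := W ∩ {x | s₁ + δ < h x ∧ h x < s₂ - δ} with hU
    have hUo : IsOpen U := hhC.continuousOn.isOpen_inter_preimage hWo isOpen_Ioo
    have hUE : U ⊆ E := fun x hx => by
      have h1 := abs_le.1 (hin x hx.1)
      have h2 : s₁ + δ < g x + inner ℝ a x := hx.2.1
      have h3 : g x + inner ℝ a x < s₂ - δ := hx.2.2
      exact ⟨hWΩ hx.1, by linarith, by linarith⟩
    obtain ⟨F, hFm, hF, hFi⟩ := hc U h δ hUo
      (measure_ne_top_of_subset (inter_subset_left.trans hWΩ) hv)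
      ((hhC.mono inter_subset_left).of_le (by norm_cast)) hδ
    have hpt : ∀ τ ∈ Ioo (s₁ + δ) (s₂ - δ),
        τ ∉ {τ | ∃ x ∈ Ω, g x + inner ℝ a x = τ ∧ fderiv ℝ g x + innerSL ℝ a = 0} →
        b ≤ K * F τ := by
      intro τ hτ hτc
      have hreg : ∀ x ∈ W, h x = τ → fderiv ℝ h x ≠ 0 := fun x hx hxτ h0 =>
        hτc ⟨x, hWΩ hx, hxτ, (hfd x hx) ▸ h0⟩
      -- Beyond the support the tilted function is at most δ, which is below τ because s₁ ≥ 0.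
      have hbd : ∀ x ∈ W, τ < h x → ‖x‖ ≤ max R 0 := fun x hx hτx => by
        by_contra! hlt
        have h1 := hgR x hx.1 ((le_max_left _ _).trans hlt.le)
        have h2 := abs_le.1 (hin x hx)
        have h3 : τ < g x + inner ℝ a x := hτx
        linarith [hτ.1]
      have hRW : Ω ∩ Metric.closedBall 0 (max R 0) ⊆ W := fun x hx =>
        ⟨hx.1, Metric.closedBall_subset_ball hRR' hx.2⟩
      obtain ⟨hadm, hfr⟩ := isAdmissible_superlevel hWo hWΩ hhC hreg hbd hRW
      have hSM : volume (W ∩ {x | τ < h x}) ≤ M := by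
        refine (measure_mono fun x hx => ?_).trans hM
        have h2 := abs_le.1 (hin x hx.1)
        have h3 : τ < g x + inner ℝ a x := hx.2
        exact ⟨hWΩ hx.1, by simp only [mem_ofPred_eq]; linarith [hτ.1]⟩
      have hbS : b ≤ volume (W ∩ {x | τ < h x}) ^ α := by
        refine ENNReal.rpow_le_rpow (measure_mono fun x hx => ?_) hα
        have hxg : s₂ ≤ g x := hx.2
        have hxR : ‖x‖ < R' := by
          by_contra! hlt
          have h1 := hgR x hx.1 (((le_max_left _ _).trans hRR'.le).trans hlt)
          linarith
        have hxW : x ∈ W := ⟨hx.1, by simpa using hxR⟩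
        have h2 := abs_le.1 (hin x hxW)
        exact ⟨hxW, by simp only [mem_ofPred_eq, hh]; linarith [hτ.2]⟩
      refine hbS.trans ((hK _ hadm hSM).trans (mul_le_mul_right ((measure_mono ?_).trans (hF τ)) _))
      intro x hx
      obtain ⟨hxW, hxτ⟩ := hfr hx
      have hxτ' : h x = τ := hxτ
      exact ⟨⟨hxW, by simpa [hxτ'] using hτ⟩, hxτ⟩
    have hnull : ∀ᵐ τ ∂(volume : Measure ℝ),
        τ ∉ {τ | ∃ x ∈ Ω, g x + inner ℝ a x = τ ∧ fderiv ℝ g x + innerSL ℝ a = 0} :=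
      compl_mem_ae_iff.2 (hcrit.measure_zero volume)
    calc ENNReal.ofReal (s₂ - s₁ - 2 * δ) * b
        = ∫⁻ τ in Ioo (s₁ + (δ : ℝ)) (s₂ - δ), b := by
          rw [setLIntegral_const, Real.volume_Ioo, mul_comm]
          congr 2; ring
      _ ≤ ∫⁻ τ in Ioo (s₁ + (δ : ℝ)) (s₂ - δ), K * F τ := by
          refine lintegral_mono_ae ?_
          filter_upwards [ae_restrict_mem measurableSet_Ioo, ae_restrict_of_ae hnull] with τ h1 h2
            using hpt τ h1 h2
      _ ≤ ∫⁻ τ, K * F τ := setLIntegral_le_lintegral _ _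
      _ = K * ∫⁻ τ, F τ := lintegral_const_mul _ hFm
      _ ≤ K * (c * ∫⁻ x in U, (‖fderiv ℝ h x‖ₑ + δ)) := mul_le_mul_right hFi _
      _ ≤ K * (c * ∫⁻ x in U, (‖fderiv ℝ g x‖ₑ + (δ + δ))) := by
          refine mul_le_mul_right (mul_le_mul_right ?_ _) _
          refine setLIntegral_mono' hUo.measurableSet fun x hx => ?_
          rw [hfd x hx.1, ← add_assoc]
          gcongr
          refine (enorm_add_le (fderiv ℝ g x) (innerSL ℝ a)).trans ?_
          gcongr
          rw [enorm_eq_nnnorm]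
          exact ENNReal.coe_le_coe.2 (NNReal.coe_le_coe.1 (by simpa [innerSL_apply_norm] using ha1))
      _ ≤ K * (c * (I + (δ + δ) * volume Ω)) := by
          refine mul_le_mul_right (mul_le_mul_right ?_ _) _
          rw [lintegral_add_right _ measurable_const, setLIntegral_const]
          exact add_le_add (lintegral_mono_set hUE)
            (mul_le_mul_right (measure_mono (inter_subset_left.trans hWΩ)) _)
      _ = _ := by ring
  have hδt : Tendsto (fun k : ℕ => ((k : ℝ≥0) + 1)⁻¹) atTop (𝓝 0) := by
    have := tendsto_one_div_add_atTop_nhds_zero_nat (𝕜 := ℝ≥0)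
    simpa using this
  have hδe : Tendsto (fun k : ℕ => ((((k : ℝ≥0) + 1)⁻¹ : ℝ≥0) : ℝ≥0∞)) atTop (𝓝 0) := by
    simpa only [ENNReal.coe_zero] using ENNReal.tendsto_coe.2 hδt
  have hδr : Tendsto (fun k : ℕ => ((((k : ℝ≥0) + 1)⁻¹ : ℝ≥0) : ℝ)) atTop (𝓝 0) := by
    simpa only [NNReal.coe_zero] using NNReal.tendsto_coe.2 hδt
  have hleft : Tendsto (fun k : ℕ => ENNReal.ofReal
      (s₂ - s₁ - 2 * ((((k : ℝ≥0) + 1)⁻¹ : ℝ≥0) : ℝ)) * b) atTop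
      (𝓝 (ENNReal.ofReal (s₂ - s₁ - 2 * 0) * b)) :=
    ENNReal.Tendsto.mul_const (ENNReal.tendsto_ofReal (tendsto_const_nhds.sub (hδr.const_mul 2)))
      (Or.inr hbt)
  have hright : Tendsto (fun k : ℕ => (K : ℝ≥0∞) * c *
      (I + (((((k : ℝ≥0) + 1)⁻¹ : ℝ≥0) : ℝ≥0∞) + ((((k : ℝ≥0) + 1)⁻¹ : ℝ≥0) : ℝ≥0∞)) * volume Ω))
      atTop (𝓝 (K * c * (I + (0 + 0) * volume Ω))) := by
    refine ENNReal.Tendsto.const_mul (tendsto_const_nhds.add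
      (ENNReal.Tendsto.mul_const (hδe.add hδe) (Or.inr hv))) (Or.inr ?_)
    exact ENNReal.mul_ne_top ENNReal.coe_ne_top ENNReal.coe_ne_top
  have := le_of_tendsto_of_tendsto' hleft hright fun k => key _ (by positivity)
  simpa using this

/-- Dilates of a single bump function. The decay of their gradients makes the term g ∇χ_k disappear
in the limit for integrable g. -/
theorem exists_cutoff_sequence {n : ℕ} :
    ∃ (D : ℝ≥0) (χ : ℕ → Eucl n → ℝ), (∀ k, ContDiff ℝ ∞ (χ k)) ∧
      (∀ k x, 0 ≤ χ k x ∧ χ k x ≤ 1) ∧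
      (∀ k : ℕ, ∀ x ∈ Metric.closedBall (0 : Eucl n) (k + 1), χ k x = 1) ∧
      (∀ (k : ℕ) (x : Eucl n), 2 * ((k : ℝ) + 1) ≤ ‖x‖ → χ k x = 0) ∧
      ∀ (k : ℕ) (x : Eucl n), ‖fderiv ℝ (χ k) x‖₊ ≤ D * ((k : ℝ≥0) + 1)⁻¹ := by
  let b : ContDiffBump (0 : Eucl n) := ⟨1, 2, one_pos, one_lt_two⟩
  have hb : ContDiff ℝ ∞ b := b.contDiff
  have hcf : Continuous (fderiv ℝ b) := hb.continuous_fderiv (by simp)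
  obtain ⟨D, hD⟩ := hcf.bounded_above_of_compact_support (b.hasCompactSupport.fderiv (𝕜 := ℝ))
  have hpos : ∀ k : ℕ, (0 : ℝ) < (k : ℝ) + 1 := fun k => by positivity
  refine ⟨D.toNNReal, fun k x => b (((k : ℝ) + 1)⁻¹ • x), fun k => hb.comp (by fun_prop),
    fun k x => ⟨b.nonneg, b.le_one⟩, fun k x hx => b.one_of_mem_closedBall ?_,
    fun k x hx => b.zero_of_le_dist ?_, fun k x => ?_⟩
  · rw [mem_closedBall_zero_iff] at hx ⊢
    rw [norm_smul, norm_inv, Real.norm_of_nonneg (hpos k).le, inv_mul_le_iff₀ (hpos k)]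
    simpa [b] using hx
  · rw [dist_zero_right, norm_smul, norm_inv, Real.norm_of_nonneg (hpos k).le,
      le_inv_mul_iff₀ (hpos k)]
    simpa [b, mul_comm] using hx
  · have h1 : fderiv ℝ (fun x => b (((k : ℝ) + 1)⁻¹ • x)) x =
        ((k : ℝ) + 1)⁻¹ • fderiv ℝ b (((k : ℝ) + 1)⁻¹ • x) := by
      rw [fderiv_comp_smul]
    rw [h1, nnnorm_smul, mul_comm]
    refine mul_le_mul' (NNReal.coe_le_coe.1 ((hD _).trans (Real.le_coe_toNNReal D))) (le_of_eq ?_)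
    rw [nnnorm_inv]
    congr 1
    ext
    simp [abs_of_pos (hpos k)]

/-- Cutting g off at larger and larger radii reduces to bounded support. The errors are the integral
of |∇g| far out and a multiple of ∫ |g| / (k + 1); both tend to 0 by integrability. -/
theorem level_isoperimetric_smooth {n : ℕ} (hn : 2 ≤ n) {Ω : Set (Eucl n)}
    (hΩ : IsOpen Ω) (hv : volume Ω ≠ ⊤) {α : ℝ} (hα : 0 ≤ α) {M : ℝ≥0∞} {K : ℝ≥0}
    (hK : ∀ S, IsAdmissible Ω S → volume S ≤ M → volume S ^ α ≤ K * area (Ω ∩ frontier S)) :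
    ∃ C : ℝ≥0, ∀ (g : Eucl n → ℝ) (s₁ s₂ : ℝ), ContDiffOn ℝ ∞ g Ω →
      ∫⁻ x in Ω, ‖g x‖ₑ ≠ ⊤ → ∫⁻ x in Ω, ‖fderiv ℝ g x‖ₑ ≠ ⊤ →
      0 ≤ s₁ → s₁ < s₂ → volume (Ω ∩ {x | s₁ < g x}) ≤ M →
      ENNReal.ofReal (s₂ - s₁) * volume (Ω ∩ {x | s₂ ≤ g x}) ^ α ≤
        C * ∫⁻ x in Ω ∩ {x | s₁ < g x ∧ g x < s₂}, ‖fderiv ℝ g x‖ₑ := by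
  obtain ⟨C, hC⟩ := level_isoperimetric_of_bounded_support hn hΩ hv hα hK
  refine ⟨C, fun g s₁ s₂ hg hgi hgi' hs₁ hs hM => ?_⟩
  obtain ⟨D, χ, hχ, hχ01, hχ1, hχ0, hχD⟩ := exists_cutoff_sequence (n := n)
  set B : ℕ → Set (Eucl n) := fun k => Metric.closedBall 0 (k + 1) with hB
  set E := Ω ∩ {x | s₁ < g x ∧ g x < s₂} with hE
  have hBm : ∀ k, MeasurableSet (B k) := fun k => Metric.isClosed_closedBall.measurableSet
  have hBmono : Monotone B := fun i j hij => Metric.closedBall_subset_closedBall (by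
    have : (i : ℝ) ≤ j := by exact_mod_cast hij
    linarith)
  have hBU : ⋃ k, B k = univ := by
    refine eq_univ_of_forall fun x => ?_
    obtain ⟨k, hk⟩ := exists_nat_ge ‖x‖
    exact mem_iUnion.2 ⟨k, by simp only [hB, mem_closedBall_zero_iff]; linarith⟩
  have key : ∀ k : ℕ, ENNReal.ofReal (s₂ - s₁) * volume (Ω ∩ {x | s₂ ≤ g x} ∩ B k) ^ α ≤
      C * ((∫⁻ x in E, ‖fderiv ℝ g x‖ₑ) + (∫⁻ x in Ω \ B k, ‖fderiv ℝ g x‖ₑ) +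
        ((D * ((k : ℝ≥0) + 1)⁻¹ : ℝ≥0) : ℝ≥0∞) * ∫⁻ x in Ω, ‖g x‖ₑ) := by
    intro k
    set f : Eucl n → ℝ := fun x => χ k x * g x with hf
    have hfC : ContDiffOn ℝ ∞ f Ω := (hχ k).contDiffOn.mul hg
    -- A factor in [0, 1] can only shrink superlevel sets at nonnegative levels, so the bound M on
    -- the measure survives the cutoff.
    have hgt : ∀ x, s₁ < f x → s₁ < g x := fun x hx => by
      have h1 := hχ01 k x
      have h2 : s₁ < χ k x * g x := hx
      have h3 : 0 < g x := by
        by_contra! hneg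
        nlinarith [mul_nonpos_of_nonneg_of_nonpos h1.1 hneg]
      nlinarith [h1.2]
    have h1 := hC f (2 * (k + 1)) s₁ s₂ hfC (fun x _ hx => by simp [hf, hχ0 k x hx]) hs₁ hs
      ((measure_mono (inter_subset_inter_right Ω hgt)).trans hM)
    have hEk : Ω ∩ {x | s₁ < f x ∧ f x < s₂} ⊆ E ∪ (Ω \ B k) := by
      rintro x ⟨hxΩ, hx⟩
      by_cases hxB : x ∈ B k
      · have : f x = g x := by simp [hf, hχ1 k x hxB]
        exact Or.inl ⟨hxΩ, by rwa [mem_ofPred_eq, this] at hx⟩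
      · exact Or.inr ⟨hxΩ, hxB⟩
    refine le_trans (mul_le_mul_right (ENNReal.rpow_le_rpow (measure_mono ?_) hα) _)
      (h1.trans (mul_le_mul_right ?_ _))
    · rintro x ⟨⟨hxΩ, hx⟩, hxB⟩
      have : f x = g x := by simp [hf, hχ1 k x hxB]
      exact ⟨hxΩ, by rwa [mem_ofPred_eq, this]⟩
    · have hfd : ∀ x ∈ Ω, ‖fderiv ℝ f x‖ₑ ≤ ‖fderiv ℝ g x‖ₑ +
          ((D * ((k : ℝ≥0) + 1)⁻¹ : ℝ≥0) : ℝ≥0∞) * ‖g x‖ₑ := fun x hx => by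
        have d1 : HasFDerivAt g (fderiv ℝ g x) x :=
          ((hg.differentiableOn (by simp)).differentiableAt (hΩ.mem_nhds hx)).hasFDerivAt
        have d2 : HasFDerivAt (χ k) (fderiv ℝ (χ k) x) x :=
          ((hχ k).differentiable (by simp) x).hasFDerivAt
        have d3 : fderiv ℝ f x = χ k x • fderiv ℝ g x + g x • fderiv ℝ (χ k) x :=
          (d2.mul d1).fderiv
        rw [d3]
        refine (enorm_add_le (χ k x • fderiv ℝ g x) (g x • fderiv ℝ (χ k) x)).trans (add_le_add ?_ ?_)
        · rw [enorm_smul]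
          refine mul_le_of_le_one_left' ?_
          rw [Real.enorm_of_nonneg (hχ01 k x).1]
          exact ENNReal.ofReal_le_one.2 (hχ01 k x).2
        · rw [enorm_smul, mul_comm]
          refine mul_le_mul_left ?_ _
          rw [enorm_eq_nnnorm]
          exact ENNReal.coe_le_coe.2 (hχD k x)
      have hm1 : Measurable fun x => ‖fderiv ℝ g x‖ₑ := (measurable_fderiv ℝ g).enorm
      calc ∫⁻ x in Ω ∩ {x | s₁ < f x ∧ f x < s₂}, ‖fderiv ℝ f x‖ₑ
          ≤ ∫⁻ x in Ω ∩ {x | s₁ < f x ∧ f x < s₂}, (‖fderiv ℝ g x‖ₑ +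
          ((D * ((k : ℝ≥0) + 1)⁻¹ : ℝ≥0) : ℝ≥0∞) * ‖g x‖ₑ) :=
            setLIntegral_mono' (hfC.continuousOn.isOpen_inter_preimage hΩ
              isOpen_Ioo).measurableSet fun x hx => hfd x hx.1
        _ ≤ (∫⁻ x in E ∪ (Ω \ B k), ‖fderiv ℝ g x‖ₑ) +
            ∫⁻ x in Ω, ((D * ((k : ℝ≥0) + 1)⁻¹ : ℝ≥0) : ℝ≥0∞) * ‖g x‖ₑ := by
            rw [lintegral_add_left hm1]
            exact add_le_add (lintegral_mono_set hEk) (lintegral_mono_set inter_subset_left)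
        _ ≤ _ := by
            rw [lintegral_const_mul' _ _ ENNReal.coe_ne_top]
            exact add_le_add (lintegral_union_le _ _ _) le_rfl
  have hleft : Tendsto (fun k => ENNReal.ofReal (s₂ - s₁) *
      volume (Ω ∩ {x | s₂ ≤ g x} ∩ B k) ^ α) atTop
      (𝓝 (ENNReal.ofReal (s₂ - s₁) * volume (Ω ∩ {x | s₂ ≤ g x}) ^ α)) := by
    refine ENNReal.Tendsto.const_mul ?_ (Or.inr ENNReal.ofReal_ne_top)
    refine (ENNReal.continuous_rpow_const.tendsto _).comp ?_
    have := tendsto_measure_iUnion_atTop (μ := volume)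
      (s := fun k => Ω ∩ {x | s₂ ≤ g x} ∩ B k)
      fun i j hij => inter_subset_inter_right _ (hBmono hij)
    rwa [← inter_iUnion, hBU, inter_univ] at this
  have htail : Tendsto (fun k => ∫⁻ x in Ω \ B k, ‖fderiv ℝ g x‖ₑ) atTop (𝓝 0) := by
    have h1 : Tendsto (fun k => volume.restrict Ω (B k)ᶜ) atTop (𝓝 0) := by
      have := tendsto_measure_iInter_atTop (μ := volume.restrict Ω) (s := fun k => (B k)ᶜ)
        (fun k => (hBm k).compl.nullMeasurableSet)
        (fun i j hij => compl_subset_compl.2 (hBmono hij))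
        ⟨0, (measure_lt_top_of_subset (subset_univ _) (by simpa using hv)).ne⟩
      rwa [← compl_iUnion, hBU, compl_univ, measure_empty] at this
    have h2 := tendsto_setLIntegral_zero (μ := volume.restrict Ω) hgi' h1
    refine h2.congr fun k => ?_
    rw [Measure.restrict_restrict (hBm k).compl, Set.sdiff_eq, inter_comm]
  have hε : Tendsto (fun k : ℕ => ((D * ((k : ℝ≥0) + 1)⁻¹ : ℝ≥0) : ℝ≥0∞)) atTop (𝓝 0) := by
    have h1 : Tendsto (fun k : ℕ => D * ((k : ℝ≥0) + 1)⁻¹) atTop (𝓝 (D * 0)) := by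
      refine Tendsto.const_mul D ?_
      have := tendsto_one_div_add_atTop_nhds_zero_nat (𝕜 := ℝ≥0)
      simpa using this
    rw [mul_zero] at h1
    simpa only [ENNReal.coe_zero] using ENNReal.tendsto_coe.2 h1
  have hright : Tendsto (fun k : ℕ => (C : ℝ≥0∞) * ((∫⁻ x in E, ‖fderiv ℝ g x‖ₑ) +
      (∫⁻ x in Ω \ B k, ‖fderiv ℝ g x‖ₑ) +
        ((D * ((k : ℝ≥0) + 1)⁻¹ : ℝ≥0) : ℝ≥0∞) * ∫⁻ x in Ω, ‖g x‖ₑ)) atTop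
      (𝓝 (C * ((∫⁻ x in E, ‖fderiv ℝ g x‖ₑ) + 0 + 0 * ∫⁻ x in Ω, ‖g x‖ₑ))) :=
    ENNReal.Tendsto.const_mul ((tendsto_const_nhds.add htail).add
      (ENNReal.Tendsto.mul_const hε (Or.inr hgi))) (Or.inr ENNReal.coe_ne_top)
  have := le_of_tendsto_of_tendsto' hleft hright key
  simpa using this

theorem MazyaClass.exists_isoperimetric {n : ℕ} {Ω : Set (Eucl n)} {α : ℝ} (h : MazyaClass Ω α) :
    ∃ (M : ℝ≥0∞) (K : ℝ≥0), 0 < M ∧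
      ∀ S, IsAdmissible Ω S → volume S ≤ M → volume S ^ α ≤ K * area (Ω ∩ frontier S) := by
  obtain ⟨M, hM, -, hK⟩ := h
  -- The added 1 makes the constant positive, so that the product is infinite when the area is. If
  -- the area vanishes, finiteness of the supremum forces |S|^α = 0.
  refine ⟨M, (isoperimetricSup Ω α M).toNNReal + 1, hM, fun S hS hSM => ?_⟩
  have h1 : volume S ^ α / area (Ω ∩ frontier S) ≤ isoperimetricSup Ω α M :=
    le_iSup_of_le S (le_iSup₂_of_le hS hSM le_rfl)
  rw [ENNReal.coe_add, ENNReal.coe_toNNReal hK.ne]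
  by_cases ht : area (Ω ∩ frontier S) = ⊤
  · simp [ht]
  by_cases h0 : area (Ω ∩ frontier S) = 0
  · by_cases hS0 : volume S ^ α = 0
    · simp [hS0]
    · rw [h0, ENNReal.div_zero hS0] at h1
      exact absurd (top_le_iff.1 h1) hK.ne
  · rw [ENNReal.div_le_iff h0 ht] at h1
    exact h1.trans (mul_le_mul_left le_self_add _)

/-- Split at the midpoint s of the levels. If {g ≥ s} is small, the isoperimetric bound applies
between s and t₂. Otherwise {g ≥ s} and {g ≤ t₁} both have measure bounded below, and the Poincaré
bound controls s - t₁, while the power of the measure is at most 1 because |Ω| = 1. Halving the gap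
costs the factor 2. -/
theorem level_gap_smooth {n : ℕ} (hn : 2 ≤ n) {Ω : Set (Eucl n)}
    (hΩ : IsOpen Ω) (hc : IsPreconnected Ω) (hv : volume Ω = 1) {α : ℝ} (hα : 0 ≤ α)
    (hM : MazyaClass Ω α) {m : ℝ≥0∞} (hm : m ≠ 0) :
    ∃ C : ℝ≥0, ∀ (g : Eucl n → ℝ) (t₁ t₂ : ℝ), ContDiffOn ℝ ∞ g Ω →
      ∫⁻ x in Ω, ‖g x‖ₑ ≠ ⊤ → ∫⁻ x in Ω, ‖fderiv ℝ g x‖ₑ ≠ ⊤ →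
      0 ≤ t₁ → t₁ < t₂ → m ≤ volume (Ω ∩ {x | g x ≤ t₁}) →
      ENNReal.ofReal (t₂ - t₁) * volume (Ω ∩ {x | t₂ ≤ g x}) ^ α ≤
        C * ∫⁻ x in Ω ∩ {x | t₁ < g x ∧ g x < t₂}, ‖fderiv ℝ g x‖ₑ := by
  have hvt : volume Ω ≠ ⊤ := by simp [hv]
  obtain ⟨M, K, hM0, hK⟩ := hM.exists_isoperimetric
  obtain ⟨C₁, hC₁⟩ := level_isoperimetric_smooth hn hΩ hvt hα hK
  obtain ⟨C₂, hC₂⟩ := exists_level_gap_bound hΩ hc hvt (m := min M m) (by simp [hM0.ne', hm])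
  refine ⟨2 * (C₁ + C₂), fun g t₁ t₂ hg hgi hgi' ht₁ ht hmt => ?_⟩
  set s : ℝ := (t₁ + t₂) / 2 with hs
  have hs1 : t₁ < s := by linarith
  have hs2 : s < t₂ := by linarith
  set I := ∫⁻ x in Ω ∩ {x | t₁ < g x ∧ g x < t₂}, ‖fderiv ℝ g x‖ₑ with hI
  have e1 : ENNReal.ofReal (t₂ - t₁) = 2 * ENNReal.ofReal (t₂ - s) := by
    rw [← ENNReal.ofReal_ofNat, ← ENNReal.ofReal_mul (by norm_num)]
    congr 1
    simp only [hs]; ring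
  have e2 : ENNReal.ofReal (t₂ - s) = ENNReal.ofReal (s - t₁) := by
    congr 1
    simp only [hs]; ring
  rw [e1, ENNReal.coe_mul, ENNReal.coe_ofNat, mul_assoc, mul_assoc]
  refine mul_le_mul_right ?_ _
  rw [ENNReal.coe_add, add_mul]
  rcases le_or_gt (volume (Ω ∩ {x | s ≤ g x})) M with hle | hgt
  · refine le_add_right ((hC₁ g s t₂ hg hgi hgi' (by linarith) hs2
      ((measure_mono (inter_subset_inter_right _ fun x hx => ?_)).trans hle)).trans
      (mul_le_mul_right (lintegral_mono_set (inter_subset_inter_right _ fun x hx => ?_)) _))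
    · exact (show s < g x from hx).le
    · exact ⟨hs1.trans hx.1, hx.2⟩
  · refine le_add_left ?_
    have h1 : volume (Ω ∩ {x | t₂ ≤ g x}) ^ α ≤ 1 :=
      ENNReal.rpow_le_one ((measure_mono inter_subset_left).trans hv.le) hα
    refine (mul_le_of_le_one_right' h1).trans ?_
    rw [e2]
    refine (hC₂ g t₁ s (hg.of_le (by norm_cast)) hs1 ((min_le_left _ _).trans hgt.le)
      ((min_le_right _ _).trans hmt)).trans
      (mul_le_mul_right (lintegral_mono_set (inter_subset_inter_right _ fun x hx => ?_)) _)
    exact ⟨hx.1, hx.2.trans hs2⟩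

end PolyaSzego

end

noncomputable section

namespace PolyaSzego

open Filter Topology

/-! ### Approximation by smooth functions -/

theorem exists_lintegral_translate_sub_le {n : ℕ} {F : Type*} [NormedAddCommGroup F]
    [NormedSpace ℝ F] {H : Eucl n → F} (hH : Integrable H) {ε : ℝ≥0∞} (hε : ε ≠ 0) :
    ∃ δ > 0, ∀ s : Eucl n, ‖s‖ < δ → ∫⁻ x, ‖H (x - s) - H x‖ₑ ≤ ε := by
  have hε3 : ε / 3 ≠ 0 := (ENNReal.div_pos hε (by simp)).ne'
  obtain ⟨k, hkc, hkε, hk, hki⟩ := hH.exists_hasCompactSupport_lintegral_sub_le hε3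
  have hK' : IsCompact (Metric.cthickening 1 (tsupport k)) := hkc.isCompact.cthickening
  obtain ⟨η, hη, hηε⟩ := ENNReal.exists_nnreal_pos_mul_lt (hK'.measure_lt_top (μ := volume)).ne hε3
  obtain ⟨δ, hδ, hkδ⟩ := Metric.uniformContinuous_iff.1
    (hkc.uniformContinuous_of_continuous hk) η hη
  refine ⟨min δ 1, lt_min hδ one_pos, fun s hs => ?_⟩
  have hm : AEStronglyMeasurable (fun x => H x - k x) := (hH.sub hki).aestronglyMeasurable
  have h1 : ∫⁻ x, ‖H (x - s) - k (x - s)‖ₑ ≤ ε / 3 := by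
    rwa [lintegral_sub_right_eq_self (fun x => ‖H x - k x‖ₑ) s]
  have h2 : ∫⁻ x, ‖k (x - s) - k x‖ₑ ≤ ε / 3 := by
    refine le_trans ?_ hηε.le
    rw [← lintegral_indicator_const hK'.isClosed.measurableSet]
    refine lintegral_mono fun x => ?_
    by_cases hx : x ∈ Metric.cthickening 1 (tsupport k)
    · rw [indicator_of_mem hx, enorm_eq_nnnorm]
      refine ENNReal.coe_le_coe.2 (NNReal.coe_le_coe.1 ?_)
      have := hkδ (a := x - s) (b := x) (by simpa using hs.trans_le (min_le_left _ _))
      rw [dist_eq_norm] at this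
      exact this.le
    · have hx1 : k x = 0 := image_eq_zero_of_notMem_tsupport fun h =>
        hx (Metric.self_subset_cthickening _ h)
      have hx2 : k (x - s) = 0 := image_eq_zero_of_notMem_tsupport fun h =>
        hx (Metric.mem_cthickening_of_dist_le x (x - s) 1 _ h
          (by simpa using (hs.trans_le (min_le_right _ _)).le))
      simp [hx1, hx2]
  calc ∫⁻ x, ‖H (x - s) - H x‖ₑ
      ≤ ∫⁻ x, (‖H (x - s) - k (x - s)‖ₑ + (‖k (x - s) - k x‖ₑ + ‖H x - k x‖ₑ)) := by
        refine lintegral_mono fun x => ?_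
        have : H (x - s) - H x = (H (x - s) - k (x - s)) + ((k (x - s) - k x) - (H x - k x)) := by
          abel
        rw [this]
        exact (enorm_add_le _ _).trans (add_le_add le_rfl enorm_sub_le)
    _ = (∫⁻ x, ‖H (x - s) - k (x - s)‖ₑ) + ((∫⁻ x, ‖k (x - s) - k x‖ₑ) + ∫⁻ x, ‖H x - k x‖ₑ) := by
        rw [lintegral_add_left', lintegral_add_left]
        · exact (by fun_prop : Continuous fun x => ‖k (x - s) - k x‖ₑ).measurable
        · exact ((hm.comp_quasiMeasurePreserving
            (measurePreserving_sub_right volume s).quasiMeasurePreserving)).enorm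
    _ ≤ ε / 3 + (ε / 3 + ε / 3) := add_le_add h1 (add_le_add h2 hkε)
    _ = ε := by rw [← add_assoc, ENNReal.add_thirds]

/-- Since η has integral 1, the difference is the η-average of H(· - s) - H over shifts s shorter
than δ, and Tonelli passes the L¹ bound through the average. -/
theorem lintegral_mollify_sub_le {n : ℕ} {F : Type*} [NormedAddCommGroup F]
    [NormedSpace ℝ F] [CompleteSpace F] {H : Eucl n → F} (hH : Integrable H) {ε : ℝ≥0∞} {δ : ℝ}
    (hδ : ∀ s : Eucl n, ‖s‖ < δ → ∫⁻ x, ‖H (x - s) - H x‖ₑ ≤ ε) {η : Eucl n → ℝ}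
    (hη : Continuous η) (hηc : HasCompactSupport η) (hη0 : ∀ x, 0 ≤ η x)
    (hηδ : ∀ x, δ ≤ ‖x‖ → η x = 0) (hη1 : ∫ x, η x = 1) :
    ∫⁻ x, ‖(∫ t, η (x - t) • H t) - H x‖ₑ ≤ ε := by
  have hηi : Integrable η := hη.integrable_of_hasCompactSupport hηc
  obtain ⟨C, hC⟩ := hη.bounded_above_of_compact_support hηc
  have hsub : ∀ x, (∫ t, η (x - t) • H t) - H x = ∫ s, η s • (H (x - s) - H x) := fun x => by
    have h1 : ∫ t, η (x - t) • H t = ∫ s, η s • H (x - s) := by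
      rw [← integral_sub_left_eq_self (fun t => η (x - t) • H t) volume x]
      simp
    have i1 : Integrable fun s => η s • H (x - s) :=
      (hH.comp_sub_left x).bdd_smul C hη.aestronglyMeasurable (Eventually.of_forall hC)
    have i2 : Integrable fun s => η s • H x := hηi.smul_const _
    simp_rw [smul_sub]
    rw [integral_sub i1 i2, integral_smul_const, hη1, one_smul, h1]
  have hpt : ∀ x, ‖(∫ t, η (x - t) • H t) - H x‖ₑ ≤
      ∫⁻ s, ENNReal.ofReal (η s) * ‖H (x - s) - H x‖ₑ := fun x => by
    rw [hsub]
    refine (enorm_integral_le_lintegral_enorm _).trans (lintegral_mono fun s => ?_)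
    rw [enorm_smul, Real.enorm_of_nonneg (hη0 s)]
  have hmη : Measurable fun s => ENNReal.ofReal (η s) := hη.measurable.ennreal_ofReal
  have hm : AEMeasurable (fun p : Eucl n × Eucl n =>
      ENNReal.ofReal (η p.2) * ‖H (p.1 - p.2) - H p.1‖ₑ) (volume.prod volume) := by
    refine (hmη.comp measurable_snd).aemeasurable.mul (AEStronglyMeasurable.enorm ?_)
    exact (hH.aestronglyMeasurable.comp_quasiMeasurePreserving
      (quasiMeasurePreserving_sub volume volume)).sub hH.aestronglyMeasurable.comp_fst
  calc ∫⁻ x, ‖(∫ t, η (x - t) • H t) - H x‖ₑ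
      ≤ ∫⁻ x, ∫⁻ s, ENNReal.ofReal (η s) * ‖H (x - s) - H x‖ₑ := lintegral_mono hpt
    _ = ∫⁻ s, ∫⁻ x, ENNReal.ofReal (η s) * ‖H (x - s) - H x‖ₑ := lintegral_lintegral_swap hm
    _ = ∫⁻ s, ENNReal.ofReal (η s) * ∫⁻ x, ‖H (x - s) - H x‖ₑ := by
        congr 1; ext s
        rw [lintegral_const_mul' _ _ ENNReal.ofReal_ne_top]
    _ ≤ ∫⁻ s, ENNReal.ofReal (η s) * ε := by
        refine lintegral_mono fun s => ?_
        rcases lt_or_ge ‖s‖ δ with hs | hs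
        · exact mul_le_mul_right (hδ s hs) _
        · simp [hηδ s hs]
    _ = ε := by
        rw [lintegral_mul_const _ hmη, ← ofReal_integral_eq_lintegral_ofReal hηi
          (Eventually.of_forall hη0), hη1, ENNReal.ofReal_one, one_mul]

theorem eq_innerSL_of_apply_single {n : ℕ} {L : Eucl n →L[ℝ] ℝ} {v : Eucl n}
    (h : ∀ i, L (EuclideanSpace.single i 1) = v i) : L = innerSL ℝ v := by
  refine ContinuousLinearMap.coe_injective
    ((EuclideanSpace.basisFun (Fin n) ℝ).toBasis.ext fun i => ?_)
  simp [h, EuclideanSpace.inner_single_right]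

theorem enorm_innerSL {n : ℕ} (v : Eucl n) : ‖innerSL ℝ v‖ₑ = ‖v‖ₑ := by
  rw [enorm_eq_nnnorm, enorm_eq_nnnorm]
  congr 1
  exact NNReal.eq (innerSL_apply_norm ℝ v)

/-- A compactly supported integrable function with integrable weak gradient is approximated by
smooth functions supported near its support. -/
theorem exists_contDiff_approx_of_compactSupport {n : ℕ} {h : Eucl n → ℝ} {H : Eucl n → Eucl n}
    (hh : Integrable h) (hH : Integrable H)
    (hw : ∀ φ : Eucl n → ℝ, ContDiff ℝ ∞ φ → HasCompactSupport φ → ∀ i : Fin n,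
      ∫ x, h x * fderiv ℝ φ x (EuclideanSpace.single i 1) = -∫ x, H x i * φ x)
    {K V : Set (Eucl n)} (hK : IsCompact K) (hV : IsOpen V) (hKV : K ⊆ V)
    (hhK : ∀ x ∉ K, h x = 0) {ε : ℝ≥0∞} (hε : ε ≠ 0) :
    ∃ g : Eucl n → ℝ, ContDiff ℝ ∞ g ∧ (∀ x ∉ V, g x = 0) ∧ ∫⁻ x, ‖h x - g x‖ₑ ≤ ε ∧
      ∫⁻ x, ‖innerSL ℝ (H x) - fderiv ℝ g x‖ₑ ≤ ε := by
  obtain ⟨δ₁, hδ₁, h1⟩ := exists_lintegral_translate_sub_le hh hε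
  obtain ⟨δ₂, hδ₂, h2⟩ := exists_lintegral_translate_sub_le hH hε
  obtain ⟨δ₃, hδ₃, h3⟩ := hK.exists_cthickening_subset_open hV hKV
  -- The three requirements are: small translation error for h, the same for H, and mollification
  -- that does not leave V.
  set δ := min δ₁ (min δ₂ δ₃) with hδ
  have hδ0 : 0 < δ := by positivity
  let b : ContDiffBump (0 : Eucl n) := ⟨δ / 2, δ, half_pos hδ0, half_lt_self hδ0⟩
  set η : Eucl n → ℝ := b.normed volume with hη
  have hηC : ContDiff ℝ ∞ η := b.contDiff_normed
  have hηc : HasCompactSupport η := b.hasCompactSupport_normed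
  have hη0 : ∀ x, 0 ≤ η x := b.nonneg_normed
  have hη1 : ∫ x, η x = 1 := b.integral_normed
  have hηδ : ∀ x, δ ≤ ‖x‖ → η x = 0 := fun x hx => by
    have : x ∉ Function.support (b.normed volume) := by
      rw [b.support_normed_eq]
      simpa [b] using hx
    simpa using this
  obtain ⟨C, hC⟩ := hηC.continuous.bounded_above_of_compact_support hηc
  set L : ℝ →L[ℝ] ℝ →L[ℝ] ℝ := ContinuousLinearMap.mul ℝ ℝ with hL
  set g : Eucl n → ℝ := convolution h η L volume with hg
  have hgapp : ∀ x, g x = ∫ t, η (x - t) • h t := fun x => by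
    simp only [hg, convolution, hL, ContinuousLinearMap.mul_apply', smul_eq_mul, mul_comm]
  -- The gradient of the mollified function is the mollified weak gradient, since t ↦ η(x - t) is
  -- itself a test function and its derivative has the opposite sign.
  have hgd : ∀ x, fderiv ℝ g x = innerSL ℝ (∫ t, η (x - t) • H t) := fun x => by
    have e1 := hηc.hasFDerivAt_convolution_right L hh.locallyIntegrable (hηC.of_le (by norm_cast)) x
    rw [e1.fderiv]
    refine eq_innerSL_of_apply_single fun i => ?_
    have i1 : Integrable fun t => η (x - t) • H t :=
      hH.bdd_smul C (hηC.continuous.comp (by fun_prop)).aestronglyMeasurable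
        (Eventually.of_forall fun t => hC _)
    have e2 : (∫ t, η (x - t) • H t) i = ∫ t, H t i * η (x - t) := by
      have := (EuclideanSpace.proj (𝕜 := ℝ) i).integral_comp_comm i1
      simp only [PiLp.proj_apply, PiLp.smul_apply, smul_eq_mul] at this
      rw [← this]
      simp_rw [mul_comm]
    rw [convolution_precompR_apply L hh.locallyIntegrable (hηc.fderiv (𝕜 := ℝ))
      (hηC.continuous_fderiv (by simp)), e2]
    have hψC : ContDiff ℝ ∞ fun t => η (x - t) := hηC.comp (by fun_prop)
    have hψc : HasCompactSupport fun t => η (x - t) :=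
      hηc.comp_homeomorph (Homeomorph.subLeft x)
    have e3 := hw _ hψC hψc i
    rw [← neg_eq_iff_eq_neg, ← integral_neg] at e3
    rw [← e3]
    refine integral_congr_ae (Eventually.of_forall fun t => ?_)
    have d1 : HasFDerivAt η (fderiv ℝ η (x - t)) (x - t) :=
      (hηC.differentiable (by simp) _).hasFDerivAt
    have d2 : HasFDerivAt (fun t : Eucl n => x - t) (-ContinuousLinearMap.id ℝ (Eucl n)) t :=
      (hasFDerivAt_id t).const_sub x
    have d3 := (d1.comp t d2).fderiv
    change fderiv ℝ (fun t => η (x - t)) t = _ at d3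
    simp [d3, hL]
  refine ⟨g, hηc.contDiff_convolution_right L hh.locallyIntegrable hηC, fun x hx => ?_, ?_, ?_⟩
  · rw [hgapp]
    refine integral_eq_zero_of_ae (Eventually.of_forall fun t => ?_)
    by_cases ht : t ∈ K
    · have : η (x - t) = 0 := hηδ _ (not_lt.1 fun hlt => hx (h3
        (Metric.mem_cthickening_of_dist_le x t _ _ ht (by
          rw [dist_eq_norm]
          exact hlt.le.trans ((min_le_right _ _).trans (min_le_right _ _))))))
      simp [this]
    · simp [hhK t ht]
  · simp_rw [hgapp, fun x => enorm_sub_rev (h x)]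
    exact lintegral_mollify_sub_le hh (fun s hs => h1 s (hs.trans_le (min_le_left _ _)))
      hηC.continuous hηc hη0 hηδ hη1
  · simp_rw [hgd, ← map_sub]
    simp_rw [enorm_innerSL, fun x => enorm_sub_rev (H x)]
    exact lintegral_mollify_sub_le hH (fun s hs => h2 s (hs.trans_le
      ((min_le_right _ _).trans (min_le_left _ _)))) hηC.continuous hηc hη0 hηδ hη1

end PolyaSzego

end

/-! ### Global smooth approximation by a partition of unity -/

noncomputable section

namespace PolyaSzego

open Filter Topology
open scoped Manifold

theorem exists_compact_exhaustion {n : ℕ} {Ω : Set (Eucl n)} (hΩ : IsOpen Ω) :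
    ∃ K : ℕ → Set (Eucl n), (∀ k, IsCompact (K k)) ∧ (∀ k, K k ⊆ interior (K (k + 1))) ∧
      ⋃ k, K k = Ω := by
  have : LocallyCompactSpace Ω := hΩ.locallyCompactSpace
  let E := CompactExhaustion.choice Ω
  refine ⟨fun k => Subtype.val '' E k, fun k => (E.isCompact k).image continuous_subtype_val,
    fun k => ?_, ?_⟩
  · exact (image_mono (E.subset_interior_succ k)).trans
      (hΩ.isOpenMap_subtype_val.image_interior_subset _)
  · rw [← image_iUnion, E.iUnion_eq, image_univ, Subtype.range_coe]

/-- A smooth cutoff between a compact set and the interior of a larger set. -/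
theorem exists_contDiff_cutoff {n : ℕ} {K L : Set (Eucl n)} (hK : IsCompact K)
    (hKL : K ⊆ interior L) :
    ∃ χ : Eucl n → ℝ, ContDiff ℝ ∞ χ ∧ (∀ x ∈ K, χ =ᶠ[𝓝 x] 1) ∧ (∀ x ∉ L, χ x = 0) := by
  obtain ⟨χ, h1, h2, -⟩ := exists_contMDiffMap_one_nhds_of_subset_interior (n := ⊤) 𝓘(ℝ, Eucl n)
    hK.isClosed hKL
  exact ⟨χ, χ.contMDiff.contDiff, fun x hx => (eventually_nhdsSet_iff_forall.1 h1 x hx), h2⟩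

/-- The vector that represents a linear functional. -/
def dualVector {n : ℕ} (L : Eucl n →L[ℝ] ℝ) : Eucl n :=
  (InnerProductSpace.toDual ℝ (Eucl n)).symm L

theorem innerSL_dualVector {n : ℕ} (L : Eucl n →L[ℝ] ℝ) : innerSL ℝ (dualVector L) = L :=
  (InnerProductSpace.toDual ℝ (Eucl n)).apply_symm_apply L

theorem continuous_dualVector {n : ℕ} : Continuous (dualVector (n := n)) :=
  (InnerProductSpace.toDual ℝ (Eucl n)).symm.continuous

theorem norm_dualVector {n : ℕ} (L : Eucl n →L[ℝ] ℝ) : ‖dualVector L‖ = ‖L‖ :=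
  (InnerProductSpace.toDual ℝ (Eucl n)).symm.norm_map L

theorem innerSL_apply_single {n : ℕ} (v : Eucl n) (i : Fin n) :
    innerSL ℝ v (EuclideanSpace.single i 1) = v i := by
  simp [EuclideanSpace.inner_single_right]

/-- The product rule for weak gradients. -/
theorem weak_gradient_mul {n : ℕ} {Ω : Set (Eucl n)}
    {f : Eucl n → ℝ} {G : Eucl n → Eucl n} (hf : Integrable f) (hG : Integrable G)
    (hw : ∀ φ : Eucl n → ℝ, ContDiff ℝ ∞ φ → HasCompactSupport φ → tsupport φ ⊆ Ω →
      ∀ i : Fin n, ∫ x, f x * fderiv ℝ φ x (EuclideanSpace.single i 1) = -∫ x, G x i * φ x)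
    {φ : Eucl n → ℝ} (hφ : ContDiff ℝ ∞ φ) (hφc : HasCompactSupport φ) (hφΩ : tsupport φ ⊆ Ω) :
    Integrable (fun x => φ x * f x) ∧
    Integrable (fun x => φ x • G x +
      f x • dualVector (fderiv ℝ φ x)) ∧
    ∀ ψ : Eucl n → ℝ, ContDiff ℝ ∞ ψ → HasCompactSupport ψ → ∀ i : Fin n,
      ∫ x, (φ x * f x) * fderiv ℝ ψ x (EuclideanSpace.single i 1) =
        -∫ x, (φ x • G x +
          f x • dualVector (fderiv ℝ φ x)) i * ψ x := by
  obtain ⟨C, hC⟩ := hφ.continuous.bounded_above_of_compact_support hφc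
  have hdc : Continuous (fderiv ℝ φ) := hφ.continuous_fderiv (by simp)
  obtain ⟨D, hD⟩ := hdc.bounded_above_of_compact_support (hφc.fderiv (𝕜 := ℝ))
  have hJi : ∀ (L : Eucl n →L[ℝ] ℝ) i, dualVector L i = L (EuclideanSpace.single i 1) := fun L i => by
    rw [← innerSL_apply_single (dualVector L) i, innerSL_dualVector]
  have i1 : Integrable fun x => φ x * f x :=
    hf.bdd_mul (c := C) hφ.continuous.aestronglyMeasurable (Eventually.of_forall hC)
  have i2 : Integrable fun x => φ x • G x :=
    hG.bdd_smul C hφ.continuous.aestronglyMeasurable (Eventually.of_forall hC)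
  have i3 : Integrable fun x => f x • dualVector (fderiv ℝ φ x) :=
    hf.smul_bdd D (continuous_dualVector.comp hdc).aestronglyMeasurable
      (Eventually.of_forall fun x => (norm_dualVector _).trans_le (hD x))
  refine ⟨i1, i2.add i3, fun ψ hψ hψc i => ?_⟩
  obtain ⟨C', hC'⟩ := hψ.continuous.bounded_above_of_compact_support hψc
  have hdc' : Continuous (fderiv ℝ ψ) := hψ.continuous_fderiv (by simp)
  obtain ⟨D', hD'⟩ := hdc'.bounded_above_of_compact_support (hψc.fderiv (𝕜 := ℝ))
  have hGi : Integrable fun x => G x i := (EuclideanSpace.proj (𝕜 := ℝ) i).integrable_comp hG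
  -- The product is supported in Ω through φ alone, so no condition is needed on the support of ψ.
  have e := hw (fun x => φ x * ψ x) (hφ.mul hψ) hφc.mul_right
    ((tsupport_mul_subset_left).trans hφΩ) i
  have hd : ∀ x, fderiv ℝ (fun x => φ x * ψ x) x (EuclideanSpace.single i 1) =
      φ x * fderiv ℝ ψ x (EuclideanSpace.single i 1) +
        ψ x * fderiv ℝ φ x (EuclideanSpace.single i 1) := fun x => by
    have := ((hφ.differentiable (by simp) x).hasFDerivAt.mul
      (hψ.differentiable (by simp) x).hasFDerivAt).fderiv
    change fderiv ℝ (fun x => φ x * ψ x) x = _ at this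
    simp [this]
  have hs : ‖(EuclideanSpace.single i 1 : Eucl n)‖ = 1 := by simp
  have j1 : Integrable fun x => (φ x * f x) * fderiv ℝ ψ x (EuclideanSpace.single i 1) := by
    refine i1.mul_bdd (c := D') (hdc'.clm_apply continuous_const).aestronglyMeasurable
      (Eventually.of_forall fun x => ?_)
    exact ((fderiv ℝ ψ x).le_opNorm _).trans (by rw [hs, mul_one]; exact hD' x)
  have j2 : Integrable fun x => (f x * fderiv ℝ φ x (EuclideanSpace.single i 1)) * ψ x := by
    refine Integrable.mul_bdd (c := C') ?_ hψ.continuous.aestronglyMeasurable (Eventually.of_forall hC')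
    refine hf.mul_bdd (c := D) (hdc.clm_apply continuous_const).aestronglyMeasurable
      (Eventually.of_forall fun x => ?_)
    exact ((fderiv ℝ φ x).le_opNorm _).trans (by rw [hs, mul_one]; exact hD x)
  have j3 : Integrable fun x => (φ x * G x i) * ψ x :=
    Integrable.mul_bdd (c := C') (hGi.bdd_mul (c := C) hφ.continuous.aestronglyMeasurable
      (Eventually.of_forall hC)) hψ.continuous.aestronglyMeasurable (Eventually.of_forall hC')
  have e1 : ∫ x, f x * fderiv ℝ (fun x => φ x * ψ x) x (EuclideanSpace.single i 1) =
      (∫ x, (φ x * f x) * fderiv ℝ ψ x (EuclideanSpace.single i 1)) +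
        ∫ x, (f x * fderiv ℝ φ x (EuclideanSpace.single i 1)) * ψ x := by
    rw [← integral_add j1 j2]
    refine integral_congr_ae (Eventually.of_forall fun x => ?_)
    simp only [hd]; ring
  have e2 : ∫ x, (φ x • G x + f x • dualVector (fderiv ℝ φ x)) i * ψ x =
      (∫ x, (φ x * G x i) * ψ x) +
        ∫ x, (f x * fderiv ℝ φ x (EuclideanSpace.single i 1)) * ψ x := by
    rw [← integral_add j3 j2]
    refine integral_congr_ae (Eventually.of_forall fun x => ?_)
    simp only [PiLp.add_apply, PiLp.smul_apply, smul_eq_mul, hJi]; ring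
  have e3 : ∫ x, G x i * (φ x * ψ x) = ∫ x, (φ x * G x i) * ψ x := by
    refine integral_congr_ae (Eventually.of_forall fun x => ?_)
    simp only []; ring
  rw [e1, e3] at e
  rw [e2]
  linarith

/-- The Meyers–Serrin theorem for `W^{1,1}`. -/
theorem exists_contDiffOn_approx {n : ℕ} {Ω : Set (Eucl n)} (hΩ : IsOpen Ω)
    {f : Eucl n → ℝ} {G : Eucl n → Eucl n} (hf : Integrable f) (hG : Integrable G)
    (hw : ∀ φ : Eucl n → ℝ, ContDiff ℝ ∞ φ → HasCompactSupport φ → tsupport φ ⊆ Ω →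
      ∀ i : Fin n, ∫ x, f x * fderiv ℝ φ x (EuclideanSpace.single i 1) = -∫ x, G x i * φ x)
    {ε : ℝ≥0∞} (hε : ε ≠ 0) :
    ∃ g : Eucl n → ℝ, ContDiffOn ℝ ∞ g Ω ∧ ∫⁻ x in Ω, ‖f x - g x‖ₑ ≤ ε ∧
      ∫⁻ x in Ω, ‖innerSL ℝ (G x) - fderiv ℝ g x‖ₑ ≤ ε := by
  obtain ⟨K, hK, hKi, hKΩ⟩ := exists_compact_exhaustion hΩ
  have hKmono : Monotone K := monotone_nat_of_le_succ fun k => (hKi k).trans interior_subset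
  choose χ hχ hχ1 hχ0 using fun k => exists_contDiff_cutoff (hK k) (hKi k)
  -- A telescoping partition of unity: the partial sums are χ_N, which is 1 near K_N. The term φ_j
  -- is supported in K_{j+1} and away from `L j`, which is K_{j-1}.
  let φ : ℕ → Eucl n → ℝ := fun j => match j with
    | 0 => χ 0
    | j + 1 => fun x => χ (j + 1) x - χ j x
  let L : ℕ → Set (Eucl n) := fun j => match j with
    | 0 => ∅
    | j + 1 => K j
  have hφ : ∀ j, ContDiff ℝ ∞ (φ j) := fun j => by
    cases j with
    | zero => exact hχ 0
    | succ j => exact (hχ (j + 1)).sub (hχ j)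
  have hφK : ∀ j, tsupport (φ j) ⊆ K (j + 1) := fun j => by
    refine closure_minimal (fun x hx => ?_) (hK _).isClosed
    by_contra hxK
    refine hx ?_
    cases j with
    | zero => exact hχ0 0 x hxK
    | succ j =>
      change χ (j + 1) x - χ j x = 0
      rw [hχ0 (j + 1) x hxK, hχ0 j x fun h => hxK (hKmono (by omega) h), sub_zero]
  have hφL : ∀ j, tsupport (φ j) ⊆ (L j)ᶜ := fun j x hx hxL => by
    cases j with
    | zero => exact hxL
    | succ j =>
      refine (notMem_tsupport_iff_eventuallyEq.2 ?_) hx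
      filter_upwards [hχ1 j x hxL, hχ1 (j + 1) x (hKmono (by omega) hxL)] with y h1 h2
      change χ (j + 1) y - χ j y = 0
      rw [h1, h2]; simp
  have hφc : ∀ j, HasCompactSupport (φ j) := fun j =>
    (hK (j + 1)).of_isClosed_subset (isClosed_tsupport _) (hφK j)
  have hφΩ : ∀ j, tsupport (φ j) ⊆ Ω := fun j =>
    (hφK j).trans (hKΩ ▸ subset_iUnion K (j + 1))
  have hφsum : ∀ N x, ∑ j ∈ Finset.range (N + 1), φ j x = χ N x := fun N x => by
    induction N with
    | zero => simp [φ]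
    | succ N ih => rw [Finset.sum_range_succ, ih]; simp [φ]
  -- Each piece φ_j f is mollified on its own, with errors that sum to less than ε. The mollified
  -- pieces still vanish near K_{j-1}, so their sum is locally finite.
  obtain ⟨ε', hε', hεsum⟩ := ENNReal.exists_pos_sum_of_countable' hε ℕ
  let H : ℕ → Eucl n → Eucl n := fun j x => φ j x • G x + f x • dualVector (fderiv ℝ (φ j) x)
  have hloc : ∀ j, ∃ g : Eucl n → ℝ, ContDiff ℝ ∞ g ∧
      (∀ x ∉ interior (K (j + 2)) ∩ (L j)ᶜ, g x = 0) ∧ ∫⁻ x, ‖φ j x * f x - g x‖ₑ ≤ ε' j ∧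
      ∫⁻ x, ‖innerSL ℝ (H j x) - fderiv ℝ g x‖ₑ ≤ ε' j := fun j => by
    obtain ⟨i1, i2, i3⟩ := weak_gradient_mul hf hG hw (hφ j) (hφc j) (hφΩ j)
    have hLc : IsClosed (L j) := by
      cases j with
      | zero => exact isClosed_empty
      | succ j => exact (hK j).isClosed
    exact exists_contDiff_approx_of_compactSupport i1 i2 i3 (hφc j).isCompact
      (isOpen_interior.inter hLc.isOpen_compl)
      (subset_inter ((hφK j).trans (hKi (j + 1))) (hφL j))
      (fun x hx => by simp [image_eq_zero_of_notMem_tsupport hx]) (hε' j).ne'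
  choose g hgC hg0 hgf hgH using hloc
  have hvan : ∀ m j, m + 1 ≤ j → ∀ x ∈ K m, g j x = 0 := fun m j hj x hx => by
    refine hg0 j x fun h => h.2 ?_
    obtain ⟨i, rfl⟩ : ∃ i, j = i + 1 := ⟨j - 1, by omega⟩
    exact hKmono (by omega : m ≤ i) hx
  let s : Eucl n → ℝ := fun x => ∑' j, g j x
  -- On K_m the first m + 2 terms suffice; the corresponding φ_j add up to χ_{m+1}, which is 1 near
  -- K_m.
  have hs : ∀ m, ∀ x ∈ K m, s x = ∑ j ∈ Finset.range (m + 2), g j x := fun m x hx =>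
    tsum_eq_sum fun j hj => hvan m j (by simp at hj; omega) x hx
  have hxm : ∀ x ∈ Ω, ∃ m, K m ∈ 𝓝 x := fun x hx => by
    rw [← hKΩ] at hx
    obtain ⟨m, hm⟩ := mem_iUnion.1 hx
    exact ⟨m + 1, mem_interior_iff_mem_nhds.1 (hKi m hm)⟩
  have hsev : ∀ x m, K m ∈ 𝓝 x → s =ᶠ[𝓝 x] fun y => ∑ j ∈ Finset.range (m + 2), g j y :=
    fun x m hm => by filter_upwards [hm] with y hy using hs m y hy
  have hsum1 : ∀ m, ∀ x ∈ K m, f x - s x =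
      ∑ j ∈ Finset.range (m + 2), (φ j x * f x - g j x) := fun m x hx => by
    rw [Finset.sum_sub_distrib, ← Finset.sum_mul, hφsum, hs m x hx,
      (hχ1 (m + 1) x (hKmono (by omega) hx)).eq_of_nhds]
    simp
  have hsum2 : ∀ x m, K m ∈ 𝓝 x → innerSL ℝ (G x) - fderiv ℝ s x =
      ∑ j ∈ Finset.range (m + 2), (innerSL ℝ (H j x) - fderiv ℝ (g j) x) := fun x m hm => by
    have hxK : x ∈ K (m + 1) := hKmono (by omega) (mem_of_mem_nhds hm)
    have d1 : fderiv ℝ s x = ∑ j ∈ Finset.range (m + 2), fderiv ℝ (g j) x := by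
      rw [(hsev x m hm).fderiv_eq]
      exact fderiv_fun_sum fun j _ => (hgC j).differentiable (by simp) x
    -- The φ_j sum to 1 near x, so the extra terms f ∇φ_j of the product rule cancel.
    have d2 : ∑ j ∈ Finset.range (m + 2), fderiv ℝ (φ j) x = 0 := by
      rw [← fderiv_fun_sum fun j _ => (hφ j).differentiable (by simp) x]
      have : (fun y => ∑ j ∈ Finset.range (m + 2), φ j y) = χ (m + 1) :=
        funext fun y => hφsum (m + 1) y
      rw [this, (hχ1 (m + 1) x hxK).fderiv_eq]
      simp
    have d3 : ∀ j, innerSL ℝ (H j x) = φ j x • innerSL ℝ (G x) + f x • fderiv ℝ (φ j) x :=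
      fun j => by
        simp only [H, map_add, map_smul]
        rw [innerSL_dualVector]
    rw [Finset.sum_sub_distrib, d1]
    simp_rw [d3]
    rw [Finset.sum_add_distrib, ← Finset.sum_smul, ← Finset.smul_sum, d2, hφsum,
      (hχ1 (m + 1) x hxK).eq_of_nhds]
    simp
  refine ⟨s, fun x hx => ?_, ?_, ?_⟩
  · obtain ⟨m, hm⟩ := hxm x hx
    refine (ContDiffAt.congr_of_eventuallyEq ?_ (hsev x m hm)).contDiffWithinAt
    exact (ContDiff.sum fun j _ => hgC j).contDiffAt
  · calc ∫⁻ x in Ω, ‖f x - s x‖ₑ ≤ ∫⁻ x in Ω, ∑' j, ‖φ j x * f x - g j x‖ₑ := by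
          refine setLIntegral_mono' hΩ.measurableSet fun x hx => ?_
          obtain ⟨m, hm⟩ := hxm x hx
          rw [hsum1 m x (mem_of_mem_nhds hm)]
          exact (enorm_sum_le _ _).trans (ENNReal.sum_le_tsum _)
      _ = ∑' j, ∫⁻ x in Ω, ‖φ j x * f x - g j x‖ₑ := by
          refine lintegral_tsum fun j => (AEStronglyMeasurable.enorm ?_).restrict
          exact ((hφ j).continuous.aestronglyMeasurable.mul hf.aestronglyMeasurable).sub
            (hgC j).continuous.aestronglyMeasurable
      _ ≤ ∑' j, ε' j := ENNReal.tsum_le_tsum fun j =>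
          (setLIntegral_le_lintegral _ _).trans (hgf j)
      _ ≤ ε := hεsum.le
  · calc ∫⁻ x in Ω, ‖innerSL ℝ (G x) - fderiv ℝ s x‖ₑ
        ≤ ∫⁻ x in Ω, ∑' j, ‖innerSL ℝ (H j x) - fderiv ℝ (g j) x‖ₑ := by
          refine setLIntegral_mono' hΩ.measurableSet fun x hx => ?_
          obtain ⟨m, hm⟩ := hxm x hx
          rw [hsum2 x m hm]
          exact (enorm_sum_le (Finset.range (m + 2))
            fun j => innerSL ℝ (H j x) - fderiv ℝ (g j) x).trans (ENNReal.sum_le_tsum _)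
      _ = ∑' j, ∫⁻ x in Ω, ‖innerSL ℝ (H j x) - fderiv ℝ (g j) x‖ₑ := by
          refine lintegral_tsum fun j => (AEStronglyMeasurable.enorm ?_).restrict
          have hHm : AEStronglyMeasurable (H j) volume :=
            (weak_gradient_mul hf hG hw (hφ j) (hφc j) (hφΩ j)).2.1.aestronglyMeasurable
          exact ((innerSL ℝ).continuous.comp_aestronglyMeasurable hHm).sub
            ((hgC j).continuous_fderiv (by simp)).aestronglyMeasurable
      _ ≤ ∑' j, ε' j := ENNReal.tsum_le_tsum fun j =>
          (setLIntegral_le_lintegral _ _).trans (hgH j)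
      _ ≤ ε := hεsum.le

end PolyaSzego

end

noncomputable section

namespace PolyaSzego

open Filter Topology

/-! ### The level gap inequality for Sobolev functions -/

/-- Approximate f and its gradient in L¹ by smooth g_k. By Chebyshev, |f - g_k| < δ off a set B_k of
vanishing measure, so the band of g_k between t₁ + δ and t₂ - δ lies in the band of f up to B_k,
where the integral of |G| tends to 0. The margin δ stays fixed, and no convergence of level sets is
needed. -/
theorem level_gap_sobolev {n : ℕ} (hn : 2 ≤ n) {Ω : Set (Eucl n)}
    (hΩ : IsOpen Ω) (hc : IsPreconnected Ω) (hv : volume Ω = 1) {α : ℝ} (hα : 0 ≤ α)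
    (hM : MazyaClass Ω α) :
    ∃ C : ℝ≥0, ∀ (f : Eucl n → ℝ) (G : Eucl n → Eucl n) (t₁ t₂ : ℝ), Measurable f →
      Integrable f → Integrable G →
      (∀ φ : Eucl n → ℝ, ContDiff ℝ ∞ φ → HasCompactSupport φ → tsupport φ ⊆ Ω →
        ∀ i : Fin n, ∫ x, f x * fderiv ℝ φ x (EuclideanSpace.single i 1) = -∫ x, G x i * φ x) →
      0 ≤ t₁ → t₁ < t₂ → 1 / 2 ≤ volume (Ω ∩ {x | f x ≤ t₁}) →
      ENNReal.ofReal (t₂ - t₁) * volume (Ω ∩ {x | t₂ ≤ f x}) ^ α ≤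
        C * ∫⁻ x in Ω ∩ {x | t₁ < f x ∧ f x < t₂}, ‖G x‖ₑ := by
  have hvt : volume Ω ≠ ⊤ := by simp [hv]
  -- Of the half of Ω where f ≤ t₁, at least a quarter remains for the approximants once |B_k| ≤
  -- 1/4.
  obtain ⟨C, hC⟩ := level_gap_smooth hn hΩ hc hv hα hM (m := 1 / 2 - 1 / 4) (by
    refine (tsub_pos_of_lt ?_).ne'
    rw [ENNReal.div_lt_iff (by simp) (by simp), mul_comm, ← mul_div_assoc,
      ENNReal.lt_div_iff_mul_lt (by simp) (by simp)]
    norm_num)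
  refine ⟨2 * C, fun f G t₁ t₂ hfm hf hG hw ht₁ ht hhalf => ?_⟩
  -- The shifted levels are half as far apart as the original ones, which accounts for the factor 2.
  set δ : ℝ := (t₂ - t₁) / 4 with hδ
  have hδ0 : 0 < δ := by simp only [hδ]; linarith
  have hδ0' : ENNReal.ofReal δ ≠ 0 := by simpa using hδ0
  set E := Ω ∩ {x | t₁ < f x ∧ f x < t₂} with hE
  let e : ℕ → ℝ≥0∞ := fun k => ((k : ℝ≥0∞) + 1)⁻¹
  have he0 : ∀ k, e k ≠ 0 := fun k => by simp [e]
  have het : Tendsto e atTop (𝓝 0) := by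
    have := (tendsto_add_atTop_iff_nat 1).2 ENNReal.tendsto_inv_nat_nhds_zero
    simpa [e] using this
  have hefin : ∀ k, e k ≠ ⊤ := fun k => by simp [e]
  choose g hg hgf hgG using fun k => exists_contDiffOn_approx hΩ hf hG hw (he0 k)
  let B : ℕ → Set (Eucl n) := fun k => {x ∈ Ω | ENNReal.ofReal δ ≤ ‖f x - g k x‖ₑ}
  have hgm : ∀ k, AEMeasurable (g k) (volume.restrict Ω) := fun k =>
    (hg k).continuousOn.aemeasurable hΩ.measurableSet
  have hBv : ∀ k, volume (B k) ≤ e k / ENNReal.ofReal δ := fun k => by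
    have h1 := meas_ge_le_lintegral_div (μ := volume.restrict Ω)
      (f := fun x => ‖f x - g k x‖ₑ) ((hfm.aemeasurable.sub (hgm k)).enorm) hδ0'
      ENNReal.ofReal_ne_top
    rw [Measure.restrict_apply' hΩ.measurableSet] at h1
    refine le_trans (measure_mono fun x hx => ?_) (h1.trans (ENNReal.div_le_div_right (hgf k) _))
    exact ⟨hx.2, hx.1⟩
  have hBt : Tendsto (fun k => volume (B k)) atTop (𝓝 0) := by
    refine tendsto_of_tendsto_of_tendsto_of_le_of_le tendsto_const_nhds ?_ (fun _ => zero_le) hBv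
    have := ENNReal.Tendsto.div_const het (Or.inr hδ0')
    simpa using this
  have hgood : ∀ k, ∀ x ∈ Ω, x ∉ B k → |f x - g k x| < δ := fun k x hx hxB => by
    have h1 : ‖f x - g k x‖ₑ < ENNReal.ofReal δ := not_le.1 fun h => hxB ⟨hx, h⟩
    rw [← ofReal_norm, ENNReal.ofReal_lt_ofReal_iff hδ0] at h1
    exact h1
  have hGfin : ∫⁻ x, ‖G x‖ₑ ≠ ⊤ := hG.2.ne
  have hquarter : ∀ᶠ k in atTop, volume (B k) ≤ 1 / 4 :=
    hBt.eventually (ge_mem_nhds (by simp))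
  have key : ∀ᶠ k in atTop, ENNReal.ofReal ((t₂ - δ) - (t₁ + δ)) *
      (volume (Ω ∩ {x | t₂ ≤ f x}) - volume (B k)) ^ α ≤
      C * ((∫⁻ x in E, ‖G x‖ₑ) + (∫⁻ x in B k, ‖G x‖ₑ) + e k) := by
    filter_upwards [hquarter] with k hk
    have hi1 : ∫⁻ x in Ω, ‖g k x‖ₑ ≠ ⊤ := by
      refine ne_top_of_le_ne_top (b := (∫⁻ x, ‖f x‖ₑ) + e k)
        (ENNReal.add_ne_top.2 ⟨hf.2.ne, hefin k⟩) ?_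
      calc ∫⁻ x in Ω, ‖g k x‖ₑ ≤ ∫⁻ x in Ω, (‖f x‖ₑ + ‖f x - g k x‖ₑ) := by
            refine lintegral_mono fun x => ?_
            have : g k x = f x - (f x - g k x) := by abel
            conv_lhs => rw [this]
            exact enorm_sub_le
        _ = (∫⁻ x in Ω, ‖f x‖ₑ) + ∫⁻ x in Ω, ‖f x - g k x‖ₑ :=
            lintegral_add_left hfm.enorm _
        _ ≤ _ := add_le_add (setLIntegral_le_lintegral _ _) (hgf k)
    have hfd : ∀ S ⊆ Ω, (∫⁻ x in S, ‖fderiv ℝ (g k) x‖ₑ) ≤ (∫⁻ x in S, ‖G x‖ₑ) + e k :=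
      fun S hS => by
      calc ∫⁻ x in S, ‖fderiv ℝ (g k) x‖ₑ
          ≤ ∫⁻ x in S, (‖G x‖ₑ + ‖innerSL ℝ (G x) - fderiv ℝ (g k) x‖ₑ) := by
            refine lintegral_mono fun x => ?_
            have : fderiv ℝ (g k) x = innerSL ℝ (G x) -
              (innerSL ℝ (G x) - fderiv ℝ (g k) x) := by abel
            conv_lhs => rw [this]
            refine (enorm_sub_le (a := innerSL ℝ (G x))).trans ?_
            rw [enorm_innerSL]
        _ = (∫⁻ x in S, ‖G x‖ₑ) + ∫⁻ x in S, ‖innerSL ℝ (G x) - fderiv ℝ (g k) x‖ₑ :=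
            lintegral_add_left' hG.aestronglyMeasurable.enorm.restrict _
        _ ≤ _ := add_le_add le_rfl ((lintegral_mono_set hS).trans (hgG k))
    have hi2 : ∫⁻ x in Ω, ‖fderiv ℝ (g k) x‖ₑ ≠ ⊤ := by
      refine ne_top_of_le_ne_top ?_ (hfd Ω subset_rfl)
      exact ENNReal.add_ne_top.2 ⟨ne_top_of_le_ne_top hGfin (setLIntegral_le_lintegral _ _), hefin k⟩
    have hlow : 1 / 2 - 1 / 4 ≤ volume (Ω ∩ {x | g k x ≤ t₁ + δ}) := by
      rw [tsub_le_iff_right]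
      refine hhalf.trans ((measure_mono fun x hx => ?_).trans ((measure_union_le _ (B k)).trans
        (add_le_add le_rfl hk)))
      by_cases hxB : x ∈ B k
      · exact Or.inr hxB
      · have h1 := abs_lt.1 (hgood k x hx.1 hxB)
        have h2 : f x ≤ t₁ := hx.2
        exact Or.inl ⟨hx.1, by simp only [mem_ofPred_eq]; linarith⟩
    have hup : volume (Ω ∩ {x | t₂ ≤ f x}) - volume (B k) ≤
        volume (Ω ∩ {x | t₂ - δ ≤ g k x}) := by
      rw [tsub_le_iff_right]
      refine (measure_mono fun x hx => ?_).trans (measure_union_le _ (B k))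
      by_cases hxB : x ∈ B k
      · exact Or.inr hxB
      · have h1 := abs_lt.1 (hgood k x hx.1 hxB)
        have h2 : t₂ ≤ f x := hx.2
        exact Or.inl ⟨hx.1, by simp only [mem_ofPred_eq]; linarith⟩
    have hsub : Ω ∩ {x | t₁ + δ < g k x ∧ g k x < t₂ - δ} ⊆ E ∪ B k := fun x hx => by
      by_cases hxB : x ∈ B k
      · exact Or.inr hxB
      · have h1 := abs_lt.1 (hgood k x hx.1 hxB)
        have h2 := hx.2.1
        have h3 := hx.2.2
        exact Or.inl ⟨hx.1, by linarith, by linarith⟩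
    refine (mul_le_mul_right (ENNReal.rpow_le_rpow hup hα) _).trans
      ((hC (g k) (t₁ + δ) (t₂ - δ) (hg k) hi1 hi2 (by linarith) (by simp only [hδ]; linarith)
        hlow).trans (mul_le_mul_right ((hfd _ inter_subset_left).trans ?_) _))
    exact add_le_add ((lintegral_mono_set hsub).trans (lintegral_union_le _ _ _)) le_rfl
  have hleft : Tendsto (fun k => ENNReal.ofReal ((t₂ - δ) - (t₁ + δ)) *
      (volume (Ω ∩ {x | t₂ ≤ f x}) - volume (B k)) ^ α) atTop
      (𝓝 (ENNReal.ofReal ((t₂ - δ) - (t₁ + δ)) * (volume (Ω ∩ {x | t₂ ≤ f x}) - 0) ^ α)) := by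
    refine ENNReal.Tendsto.const_mul ?_ (Or.inr ENNReal.ofReal_ne_top)
    refine (ENNReal.continuous_rpow_const.tendsto _).comp ?_
    exact ENNReal.Tendsto.sub tendsto_const_nhds hBt (Or.inr ENNReal.zero_ne_top)
  have hright : Tendsto (fun k => (C : ℝ≥0∞) * ((∫⁻ x in E, ‖G x‖ₑ) + (∫⁻ x in B k, ‖G x‖ₑ) + e k))
      atTop (𝓝 (C * ((∫⁻ x in E, ‖G x‖ₑ) + 0 + 0))) :=
    ENNReal.Tendsto.const_mul ((tendsto_const_nhds.add
      (tendsto_setLIntegral_zero hGfin hBt)).add het) (Or.inr ENNReal.coe_ne_top)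
  have hlim := le_of_tendsto_of_tendsto hleft hright key
  simp only [tsub_zero, add_zero] at hlim
  have e1 : ENNReal.ofReal (t₂ - t₁) = 2 * ENNReal.ofReal ((t₂ - δ) - (t₁ + δ)) := by
    rw [← ENNReal.ofReal_ofNat, ← ENNReal.ofReal_mul (by norm_num)]
    congr 1
    simp only [hδ]; ring
  rw [e1, mul_assoc, ENNReal.coe_mul, ENNReal.coe_ofNat, mul_assoc]
  exact mul_le_mul_right hlim _

theorem exists_median {X : Type*} [MeasurableSpace X] (μ : Measure X) [IsProbabilityMeasure μ]
    {f : X → ℝ} (hf : Measurable f) :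
    ∃ c : ℝ, 1 / 2 ≤ μ {x | f x ≤ c} ∧ 1 / 2 ≤ μ {x | c ≤ f x} := by
  have hhalf : (1 / 2 : ℝ≥0∞) < 1 := ENNReal.half_lt_self one_ne_zero ENNReal.one_ne_top
  set A : Set ℝ := {t | 1 / 2 ≤ μ {x | f x ≤ t}} with hA
  have hmono : ∀ {s t : ℝ}, s ≤ t → {x | f x ≤ s} ⊆ {x | f x ≤ t} := fun h x hx => le_trans hx h
  have hAup : ∀ {s t : ℝ}, s ∈ A → s ≤ t → t ∈ A := fun {s t} hs h => by
    have hs' : 1 / 2 ≤ μ {x | f x ≤ s} := hs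
    exact hs'.trans (measure_mono (hmono h))
  have hne : A.Nonempty := by
    have h1 := tendsto_measure_iUnion_atTop (μ := μ) (s := fun k : ℕ => {x | f x ≤ k})
      fun i j hij => hmono (by exact_mod_cast hij)
    have h2 : ⋃ k : ℕ, {x | f x ≤ k} = univ :=
      eq_univ_of_forall fun x => mem_iUnion.2 (exists_nat_ge (f x))
    rw [h2, measure_univ] at h1
    obtain ⟨k, hk⟩ := (h1.eventually (lt_mem_nhds hhalf)).exists
    exact ⟨k, hk.le⟩
  have hbdd : BddBelow A := by
    have h1 := tendsto_measure_iInter_atTop (μ := μ) (s := fun k : ℕ => {x | f x ≤ -k})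
      (fun k => (measurableSet_le hf measurable_const).nullMeasurableSet)
      (fun i j hij => hmono (by
        have : (i : ℝ) ≤ j := by exact_mod_cast hij
        linarith)) ⟨0, measure_ne_top _ _⟩
    have h2 : ⋂ k : ℕ, {x | f x ≤ -k} = ∅ := by
      refine eq_empty_of_forall_notMem fun x hx => ?_
      obtain ⟨k, hk⟩ := exists_nat_gt (-f x)
      have := mem_iInter.1 hx k
      simp only [mem_ofPred_eq] at this
      linarith
    rw [h2, measure_empty] at h1
    obtain ⟨k, hk⟩ := (h1.eventually (gt_mem_nhds (show (0 : ℝ≥0∞) < 1 / 2 by simp))).exists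
    refine ⟨-k, fun t ht => ?_⟩
    by_contra! hlt
    exact absurd (hAup ht hlt.le) (not_le.2 hk)
  -- Levels just above c lie in `A`, levels below c do not; continuity of the measure along 1/(k +
  -- 1) gives the two inequalities.
  set c := sInf A with hcdef
  have hseq : Tendsto (fun k : ℕ => ((k : ℝ) + 1)⁻¹) atTop (𝓝 0) := by
    simpa using tendsto_one_div_add_atTop_nhds_zero_nat (𝕜 := ℝ)
  have hanti : Antitone fun k : ℕ => ((k : ℝ) + 1)⁻¹ := fun i j hij => by
    have : (i : ℝ) ≤ j := by exact_mod_cast hij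
    simp only
    gcongr
  refine ⟨c, ?_, ?_⟩
  · have h1 := tendsto_measure_iInter_atTop (μ := μ)
      (s := fun k : ℕ => {x | f x ≤ c + ((k : ℝ) + 1)⁻¹})
      (fun k => (measurableSet_le hf measurable_const).nullMeasurableSet)
      (fun i j hij => hmono (by have := hanti hij; simp only at this; linarith))
      ⟨0, measure_ne_top _ _⟩
    have h2 : ⋂ k : ℕ, {x | f x ≤ c + ((k : ℝ) + 1)⁻¹} = {x | f x ≤ c} := by
      ext x
      simp only [mem_iInter, mem_ofPred_eq]
      refine ⟨fun h => ?_, fun h k => h.trans (by simp; positivity)⟩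
      have := hseq.const_add c
      rw [add_zero] at this
      exact ge_of_tendsto' this h
    rw [h2] at h1
    refine ge_of_tendsto' h1 fun k => ?_
    obtain ⟨t, ht, htc⟩ := exists_lt_of_csInf_lt hne
      (show c < c + ((k : ℝ) + 1)⁻¹ by simp; positivity)
    exact hAup ht htc.le
  · have h1 := tendsto_measure_iInter_atTop (μ := μ)
      (s := fun k : ℕ => {x | c - ((k : ℝ) + 1)⁻¹ < f x})
      (fun k => (measurableSet_lt measurable_const hf).nullMeasurableSet)
      (fun i j hij x hx => by
        have h3 := hanti hij
        have h4 : c - ((j : ℝ) + 1)⁻¹ < f x := hx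
        simp only at h3
        change c - ((i : ℝ) + 1)⁻¹ < f x
        linarith)
      ⟨0, measure_ne_top _ _⟩
    have h2 : ⋂ k : ℕ, {x | c - ((k : ℝ) + 1)⁻¹ < f x} = {x | c ≤ f x} := by
      ext x
      simp only [mem_iInter, mem_ofPred_eq]
      refine ⟨fun h => ?_, fun h k => lt_of_lt_of_le (by simp; positivity) h⟩
      have := hseq.const_sub c
      rw [sub_zero] at this
      exact le_of_tendsto' this fun k => (h k).le
    rw [h2] at h1
    refine ge_of_tendsto' h1 fun k => ?_
    have h3 : c - ((k : ℝ) + 1)⁻¹ ∉ A := fun h => by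
      have := csInf_le hbdd h
      have h5 : (0 : ℝ) < ((k : ℝ) + 1)⁻¹ := by positivity
      linarith
    have h4 : μ {x | f x ≤ c - ((k : ℝ) + 1)⁻¹} ≤ 1 / 2 := (not_le.1 h3).le
    have h5 : {x | c - ((k : ℝ) + 1)⁻¹ < f x} = {x | f x ≤ c - ((k : ℝ) + 1)⁻¹}ᶜ := by
      ext x; simp
    change 1 / 2 ≤ μ {x | c - ((k : ℝ) + 1)⁻¹ < f x}
    rw [h5, prob_compl_eq_one_sub (measurableSet_le hf measurable_const)]
    refine le_trans (le_of_eq ?_) (tsub_le_tsub_left h4 1)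
    rw [one_div, ENNReal.one_sub_inv_two]

/-- Constants have zero weak gradient, which lets the median be subtracted without changing the
gradient. -/
theorem integral_fderiv_apply_eq_zero {n : ℕ} {φ : Eucl n → ℝ} (hφ : ContDiff ℝ ∞ φ)
    (hφc : HasCompactSupport φ) (v : Eucl n) : ∫ x, fderiv ℝ φ x v = 0 := by
  have hc : Continuous fun x => fderiv ℝ φ x v :=
    (hφ.continuous_fderiv (by simp)).clm_apply continuous_const
  have h := integral_mul_fderiv_eq_neg_fderiv_mul_of_integrable (μ := volume)
    (f := fun _ : Eucl n => (1 : ℝ)) (g := φ) (v := v) (by simp)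
    (by simpa using hc.integrable_of_hasCompactSupport (hφc.fderiv_apply (𝕜 := ℝ) v))
    (by simpa using hφ.continuous.integrable_of_hasCompactSupport hφc)
    (fun x _ => differentiableAt_const _) (fun x _ => hφ.differentiable (by simp) x)
  simpa using h

/-- The level gap inequality for the deviation from a median. -/
theorem exists_level_gap_median {n : ℕ} (hn : 2 ≤ n) {Ω : Set (Eucl n)}
    (hΩ : IsOpen Ω) (hc : IsPreconnected Ω) (hv : volume Ω = 1) {α : ℝ} (hα : 0 ≤ α)
    (hα1 : α ≤ 1) (hM : MazyaClass Ω α) :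
    ∃ C : ℝ≥0, ∀ (f : Eucl n → ℝ) (G : Eucl n → Eucl n), IntegrableOn f Ω → IntegrableOn G Ω →
      HasWeakGradient Ω f G → ∃ (c : ℝ) (F : Eucl n → ℝ), Measurable F ∧ Integrable F ∧
        (∀ᵐ x ∂volume.restrict Ω, f x - c = F x) ∧ ∀ t₁ t₂ : ℝ, 0 ≤ t₁ → t₁ < t₂ →
          ENNReal.ofReal (t₂ - t₁) * volume (Ω ∩ {x | t₂ ≤ |F x|}) ^ α ≤
            C * ∫⁻ x in Ω ∩ {x | t₁ < |F x| ∧ |F x| < t₂}, ‖G x‖ₑ := by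
  obtain ⟨C, hC⟩ := level_gap_sobolev hn hΩ hc hv hα hM
  refine ⟨C + C, fun f G hf hG hw => ?_⟩
  have hfin : IsFiniteMeasure (volume.restrict Ω) := ⟨by simp [hv]⟩
  have hprob : IsProbabilityMeasure (volume.restrict Ω) := ⟨by simp [hv]⟩
  obtain ⟨f₁, hf₁m, hf₁⟩ := hf.aestronglyMeasurable.aemeasurable
  obtain ⟨c, hc1, hc2⟩ := exists_median (volume.restrict Ω) hf₁m
  have hΩm := hΩ.measurableSet
  rw [Measure.restrict_apply' hΩm, inter_comm] at hc1 hc2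
  -- A measurable representative, extended by zero; the gradient is extended likewise, so that the
  -- approximation theorem on the whole space applies.
  set F : Eucl n → ℝ := Ω.indicator fun x => f₁ x - c with hF
  have hFm : Measurable F := (hf₁m.sub_const c).indicator hΩm
  have hFae : ∀ᵐ x ∂volume.restrict Ω, f x - c = F x := by
    filter_upwards [hf₁, ae_restrict_mem hΩm] with x h1 h2
    rw [hF, indicator_of_mem h2, h1]
  have hFi : Integrable F := by
    rw [hF, integrable_indicator_iff hΩm]
    exact (Integrable.congr hf hf₁).sub (integrable_const c)
  set G₁ : Eucl n → Eucl n := Ω.indicator G with hG₁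
  have hG₁i : Integrable G₁ := (integrable_indicator_iff hΩm).2 hG
  have hwF : ∀ φ : Eucl n → ℝ, ContDiff ℝ ∞ φ → HasCompactSupport φ → tsupport φ ⊆ Ω →
      ∀ i : Fin n, ∫ x, F x * fderiv ℝ φ x (EuclideanSpace.single i 1) = -∫ x, G₁ x i * φ x := by
    intro φ hφ hφc hφΩ i
    have hcd : Continuous fun x => fderiv ℝ φ x (EuclideanSpace.single i 1) :=
      (hφ.continuous_fderiv (by simp)).clm_apply continuous_const
    have hdi : Integrable fun x => fderiv ℝ φ x (EuclideanSpace.single i 1) :=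
      hcd.integrable_of_hasCompactSupport (hφc.fderiv_apply (𝕜 := ℝ) _)
    obtain ⟨D, hD⟩ := hcd.bounded_above_of_compact_support (hφc.fderiv_apply (𝕜 := ℝ) _)
    have h0 : ∫ x in Ω, fderiv ℝ φ x (EuclideanSpace.single i 1) = 0 := by
      rw [setIntegral_eq_integral_of_forall_compl_eq_zero, integral_fderiv_apply_eq_zero hφ hφc]
      intro x hx
      rw [fderiv_of_notMem_tsupport (𝕜 := ℝ) fun h => hx (hφΩ h)]
      simp
    have h1 : ∫ x, F x * fderiv ℝ φ x (EuclideanSpace.single i 1) =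
        ∫ x in Ω, (f x * fderiv ℝ φ x (EuclideanSpace.single i 1) -
          c * fderiv ℝ φ x (EuclideanSpace.single i 1)) := by
      rw [← setIntegral_eq_integral_of_forall_compl_eq_zero (s := Ω) fun x hx => by
        rw [hF, indicator_of_notMem hx, zero_mul]]
      refine integral_congr_ae ?_
      filter_upwards [hFae] with x hx
      rw [← hx]; ring
    have h2 : ∫ x, G₁ x i * φ x = ∫ x in Ω, G x i * φ x := by
      rw [← setIntegral_eq_integral_of_forall_compl_eq_zero (s := Ω) fun x hx => by
        rw [hG₁, indicator_of_notMem hx, PiLp.zero_apply, zero_mul]]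
      refine setIntegral_congr_fun hΩm fun x hx => ?_
      simp only [hG₁, indicator_of_mem hx]
    rw [h1, h2, integral_sub, hw.2.2 φ hφ hφc hφΩ i, integral_const_mul, h0, mul_zero, sub_zero]
    · exact hf.mul_bdd (c := D) hcd.aestronglyMeasurable (Eventually.of_forall hD)
    · exact (hdi.const_mul c).restrict
  have hwN : ∀ φ : Eucl n → ℝ, ContDiff ℝ ∞ φ → HasCompactSupport φ → tsupport φ ⊆ Ω →
      ∀ i : Fin n, ∫ x, (-F x) * fderiv ℝ φ x (EuclideanSpace.single i 1) =
        -∫ x, (-G₁ x) i * φ x := by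
    intro φ hφ hφc hφΩ i
    have := hwF φ hφ hφc hφΩ i
    simp only [PiLp.neg_apply, neg_mul, integral_neg, this]
  have hEm : ∀ t₁ t₂ : ℝ, MeasurableSet (Ω ∩ {x | t₁ < |F x| ∧ |F x| < t₂}) := fun t₁ t₂ =>
    hΩm.inter ((measurableSet_lt measurable_const hFm.abs).inter
      (measurableSet_lt hFm.abs measurable_const))
  have hGG : ∀ t₁ t₂ : ℝ, ∫⁻ x in Ω ∩ {x | t₁ < |F x| ∧ |F x| < t₂}, ‖G₁ x‖ₑ =
      ∫⁻ x in Ω ∩ {x | t₁ < |F x| ∧ |F x| < t₂}, ‖G x‖ₑ := fun t₁ t₂ =>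
    setLIntegral_congr_fun (hEm t₁ t₂) fun x hx => by simp only [hG₁, indicator_of_mem hx.1]
  refine ⟨c, F, hFm, hFi, hFae, fun t₁ t₂ ht₁ ht => ?_⟩
  -- The median makes {F ≤ 0} and {-F ≤ 0} each at least half of Ω, so the one-sided inequality
  -- holds for F and for -F. The two are added by subadditivity of the power α ≤ 1, as their bands
  -- are the positive and negative parts of the band of |F|.
  have hp := hC F G₁ t₁ t₂ hFm hFi hG₁i hwF ht₁ ht (hc1.trans (measure_mono fun x hx => by
    have h1 : f₁ x ≤ c := hx.2
    refine ⟨hx.1, ?_⟩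
    simp only [mem_ofPred_eq, hF, indicator_of_mem hx.1]
    linarith))
  have hn := hC (fun x => -F x) (fun x => -G₁ x) t₁ t₂ hFm.neg hFi.neg hG₁i.neg hwN ht₁ ht
    (hc2.trans (measure_mono fun x hx => by
      have h1 : c ≤ f₁ x := hx.2
      refine ⟨hx.1, ?_⟩
      simp only [mem_ofPred_eq, hF, indicator_of_mem hx.1]
      linarith))
  have hsplit : volume (Ω ∩ {x | t₂ ≤ |F x|}) ^ α ≤
      volume (Ω ∩ {x | t₂ ≤ F x}) ^ α + volume (Ω ∩ {x | t₂ ≤ -F x}) ^ α := by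
    refine le_trans (ENNReal.rpow_le_rpow ?_ hα) (ENNReal.rpow_add_le_add_rpow _ _ hα hα1)
    refine (measure_mono fun x hx => ?_).trans (measure_union_le _ _)
    rcases le_abs.1 (show t₂ ≤ |F x| from hx.2) with h | h
    · exact Or.inl ⟨hx.1, h⟩
    · exact Or.inr ⟨hx.1, h⟩
  refine (mul_le_mul_right hsplit _).trans ?_
  rw [mul_add, ENNReal.coe_add, add_mul, ← hGG]
  refine add_le_add (hp.trans (mul_le_mul_right (lintegral_mono_set ?_) _))
    (hn.trans (mul_le_mul_right ?_ _))
  · intro x hx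
    have h1 : t₁ < F x := hx.2.1
    have h2 : |F x| = F x := abs_of_pos (ht₁.trans_lt h1)
    exact ⟨hx.1, by simpa only [mem_ofPred_eq, h2] using hx.2⟩
  · simp only [enorm_neg]
    refine lintegral_mono_set fun x hx => ?_
    have h1 : t₁ < -F x := hx.2.1
    have h2 : |F x| = -F x := abs_of_neg (by linarith)
    exact ⟨hx.1, by simpa only [mem_ofPred_eq, h2] using hx.2⟩

end PolyaSzego

end

noncomputable section

namespace PolyaSzego

open Filter Topology

/-! ### The decreasing rearrangement: level bands, absolute continuity, derivative -/

section Rearrangement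

variable {X : Type*} [MeasurableSpace X] {μ : Measure X} {F : X → ℝ}

/-- The decreasing rearrangement of `|F|` on the measure space `(X, μ)`. -/
def rearrangement (μ : Measure X) (F : X → ℝ) (s : ℝ) : ℝ :=
  sInf {l : ℝ | 0 ≤ l ∧ μ {x | l < |F x|} ≤ ENNReal.ofReal s}

lemma bddBelow_rearrangement_set (s : ℝ) :
    BddBelow {l : ℝ | 0 ≤ l ∧ μ {x | l < |F x|} ≤ ENNReal.ofReal s} :=
  ⟨0, fun _ h => h.1⟩

lemma nonempty_rearrangement_set [IsFiniteMeasure μ] (hF : Measurable F) {s : ℝ} (hs : 0 < s) :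
    {l : ℝ | 0 ≤ l ∧ μ {x | l < |F x|} ≤ ENNReal.ofReal s}.Nonempty := by
  have h : Tendsto (fun k : ℕ => μ {x | (k : ℝ) < |F x|}) atTop
      (𝓝 (μ (⋂ k : ℕ, {x | (k : ℝ) < |F x|}))) := by
    refine tendsto_measure_iInter_atTop
      (fun k => (measurableSet_lt measurable_const hF.abs).nullMeasurableSet) ?_
      ⟨0, measure_ne_top _ _⟩
    intro i j hij x (hx : (j : ℝ) < |F x|)
    exact lt_of_le_of_lt (by exact_mod_cast hij) hx
  have he : (⋂ k : ℕ, {x | (k : ℝ) < |F x|}) = ∅ := by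
    refine eq_empty_of_forall_notMem fun x hx => ?_
    obtain ⟨k, hk⟩ := exists_nat_ge |F x|
    exact absurd (mem_iInter.1 hx k) (not_lt.2 hk)
  rw [he, measure_empty] at h
  obtain ⟨k, hk⟩ := (h.eventually (gt_mem_nhds (ENNReal.ofReal_pos.2 hs))).exists
  exact ⟨k, by positivity, hk.le⟩

lemma rearrangement_nonneg (s : ℝ) : 0 ≤ rearrangement μ F s :=
  Real.sInf_nonneg fun _ h => h.1

/-- The distribution function is right continuous, by continuity of the measure from below.
Positivity of s makes the defining set nonempty; on an empty set the real infimum would be the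
default value 0. -/
lemma lt_rearrangement_iff [IsFiniteMeasure μ] (hF : Measurable F) {s l : ℝ} (hs : 0 < s)
    (hl : 0 ≤ l) : l < rearrangement μ F s ↔ ENNReal.ofReal s < μ {x | l < |F x|} := by
  constructor
  · intro h
    by_contra hc
    exact absurd (csInf_le (bddBelow_rearrangement_set s) ⟨hl, not_lt.1 hc⟩) (not_le.2 h)
  · intro h
    by_contra hc
    refine absurd h (not_lt.2 ?_)
    have hun : {x | l < |F x|} = ⋃ k : ℕ, {x | l + 1 / ((k : ℝ) + 1) < |F x|} := by
      ext x
      simp only [mem_ofPred_eq, mem_iUnion]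
      constructor
      · intro hx
        obtain ⟨k, hk⟩ := exists_nat_one_div_lt (sub_pos.2 hx)
        exact ⟨k, by linarith⟩
      · rintro ⟨k, hk⟩
        have : 0 < 1 / ((k : ℝ) + 1) := by positivity
        linarith
    have ht : Tendsto (fun k : ℕ => μ {x | l + 1 / ((k : ℝ) + 1) < |F x|}) atTop
        (𝓝 (μ {x | l < |F x|})) := by
      rw [hun]
      refine tendsto_measure_iUnion_atTop ?_
      intro i j hij x (hx : l + 1 / ((i : ℝ) + 1) < |F x|)
      have : 1 / ((j : ℝ) + 1) ≤ 1 / ((i : ℝ) + 1) := Nat.one_div_le_one_div hij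
      exact lt_of_le_of_lt (by linarith) hx
    refine le_of_tendsto' ht fun k => ?_
    have hk : 0 < 1 / ((k : ℝ) + 1) := by positivity
    obtain ⟨l', hl', hlt⟩ := exists_lt_of_csInf_lt (nonempty_rearrangement_set hF hs)
      (lt_of_le_of_lt (not_lt.1 hc) (lt_add_of_pos_right l hk))
    exact (measure_mono fun x (hx : _ < |F x|) => hlt.trans hx).trans hl'.2

lemma rearrangement_antitone [IsFiniteMeasure μ] (hF : Measurable F) {s t : ℝ} (hs : 0 < s)
    (hst : s ≤ t) : rearrangement μ F t ≤ rearrangement μ F s :=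
  csInf_le_csInf (bddBelow_rearrangement_set t) (nonempty_rearrangement_set hF hs)
    fun _ h => ⟨h.1, h.2.trans (ENNReal.ofReal_le_ofReal hst)⟩

lemma measure_rearrangement_lt_le [IsFiniteMeasure μ] (hF : Measurable F) {s : ℝ} (hs : 0 < s) :
    μ {x | rearrangement μ F s < |F x|} ≤ ENNReal.ofReal s :=
  not_lt.1 fun h => lt_irrefl _ ((lt_rearrangement_iff hF hs (rearrangement_nonneg s)).2 h)

/-- Every level below r(s) is exceeded on a set of measure greater than s; let the level increase to
r(s). If r(s) = 0 there is no such level, but the set is then the whole space, and s ≤ 1 suffices.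
-/
lemma le_measure_rearrangement_le [IsProbabilityMeasure μ] (hF : Measurable F) {s : ℝ}
    (hs : 0 < s) (hs1 : s ≤ 1) : ENNReal.ofReal s ≤ μ {x | rearrangement μ F s ≤ |F x|} := by
  rcases (rearrangement_nonneg (μ := μ) (F := F) s).eq_or_lt with h0 | h0
  · rw [← h0]
    simpa using hs1
  set r := rearrangement μ F s with hr
  have hin : {x | r ≤ |F x|} = ⋂ k : ℕ, {x | r - r * (1 / ((k : ℝ) + 1)) < |F x|} := by
    ext x
    simp only [mem_ofPred_eq, mem_iInter]
    constructor
    · intro hx k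
      have : 0 < r * (1 / ((k : ℝ) + 1)) := by positivity
      linarith
    · intro h
      by_contra! hc
      obtain ⟨k, hk⟩ := exists_nat_one_div_lt (div_pos (sub_pos.2 hc) h0)
      rw [lt_div_iff₀ h0] at hk
      nlinarith [h k]
  have ht : Tendsto (fun k : ℕ => μ {x | r - r * (1 / ((k : ℝ) + 1)) < |F x|}) atTop
      (𝓝 (μ {x | r ≤ |F x|})) := by
    rw [hin]
    refine tendsto_measure_iInter_atTop
      (fun k => (measurableSet_lt measurable_const hF.abs).nullMeasurableSet) ?_
      ⟨0, measure_ne_top _ _⟩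
    intro i j hij x (hx : _ < |F x|)
    have : 1 / ((j : ℝ) + 1) ≤ 1 / ((i : ℝ) + 1) := Nat.one_div_le_one_div hij
    have := mul_le_mul_of_nonneg_left this h0.le
    exact lt_of_le_of_lt (by linarith) hx
  refine ge_of_tendsto' ht fun k => ?_
  have hk : 0 < r * (1 / ((k : ℝ) + 1)) := by positivity
  have hk1 : 1 / ((k : ℝ) + 1) ≤ 1 := by
    rw [div_le_one (by positivity)]
    linarith [(Nat.cast_nonneg k : (0 : ℝ) ≤ k)]
  exact ((lt_rearrangement_iff hF hs (by nlinarith)).1 (by rw [← hr]; linarith)).le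

/-- The points at which `|F|` lies strictly between two values of its rearrangement. -/
def levelBand (μ : Measure X) (F : X → ℝ) (s t : ℝ) : Set X :=
  {x | rearrangement μ F t < |F x| ∧ |F x| < rearrangement μ F s}

lemma measurableSet_levelBand (hF : Measurable F) (s t : ℝ) :
    MeasurableSet (levelBand μ F s t) :=
  (measurableSet_lt measurable_const hF.abs).inter (measurableSet_lt hF.abs measurable_const)

lemma disjoint_levelBand [IsFiniteMeasure μ] (hF : Measurable F) {s t s' t' : ℝ} (ht : 0 < t)
    (h : t ≤ s') : Disjoint (levelBand μ F s t) (levelBand μ F s' t') := by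
  refine disjoint_left.2 fun x hx hx' => ?_
  have h1 := rearrangement_antitone (μ := μ) hF ht h
  linarith [hx.1, hx'.2]

/-- The open superlevel set at r(t) has measure at most t and the closed one at r(s) has measure at
least s. Strict inequalities at both ends exclude plateaus of |F|, which could be larger than t - s.
-/
lemma measure_levelBand_le [IsProbabilityMeasure μ] (hF : Measurable F) {s t : ℝ} (hs : 0 < s)
    (hst : s ≤ t) (hs1 : s ≤ 1) : μ (levelBand μ F s t) ≤ ENNReal.ofReal (t - s) := by
  rcases (rearrangement_antitone (μ := μ) hF hs hst).eq_or_lt with he | hlt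
  · have : levelBand μ F s t = ∅ :=
      eq_empty_of_forall_notMem fun x hx => by linarith [hx.1.trans hx.2]
    simp [this]
  have hsub : levelBand μ F s t ⊆
      {x | rearrangement μ F t < |F x|} \ {x | rearrangement μ F s ≤ |F x|} :=
    fun x hx => ⟨hx.1, not_le.2 hx.2⟩
  refine (measure_mono hsub).trans ?_
  have hss : {x | rearrangement μ F s ≤ |F x|} ⊆ {x | rearrangement μ F t < |F x|} :=
    fun x (hx : _ ≤ |F x|) => lt_of_lt_of_le hlt hx
  rw [measure_sdiff hss (measurableSet_le measurable_const hF.abs).nullMeasurableSet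
    (measure_ne_top _ _), ENNReal.ofReal_sub _ hs.le]
  exact tsub_le_tsub (measure_rearrangement_lt_le hF (hs.trans_le hst))
    (le_measure_rearrangement_le hF hs hs1)

variable {w : X → ℝ≥0∞} {α : ℝ} {C : ℝ≥0}

lemma rearrangement_sub_le [IsProbabilityMeasure μ] (hF : Measurable F) (hα : 0 ≤ α)
    (hgap : ∀ t₁ t₂ : ℝ, 0 ≤ t₁ → t₁ < t₂ → ENNReal.ofReal (t₂ - t₁) * μ {x | t₂ ≤ |F x|} ^ α ≤
      C * ∫⁻ x in {x | t₁ < |F x| ∧ |F x| < t₂}, w x ∂μ) {s t : ℝ} (hs : 0 < s) (hst : s ≤ t)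
    (hs1 : s ≤ 1) :
    ENNReal.ofReal (rearrangement μ F s - rearrangement μ F t) * ENNReal.ofReal s ^ α ≤
      C * ∫⁻ x in levelBand μ F s t, w x ∂μ := by
  rcases (rearrangement_antitone (μ := μ) hF hs hst).eq_or_lt with he | hlt
  · simp [he]
  · refine le_trans ?_ (hgap _ _ (rearrangement_nonneg t) hlt)
    gcongr
    exact le_measure_rearrangement_le hF hs hs1

/-- Disjoint intervals of small total length give disjoint sets of small total measure, over which
the integral of w is small by its absolute continuity. -/
lemma absolutelyContinuousOnInterval_of_le_setLIntegral {r : ℝ → ℝ}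
    {a b : ℝ} (hab : a ≤ b) {K : ℝ≥0} (hw : ∫⁻ x, w x ∂μ ≠ ⊤)
    (E : ℝ → ℝ → Set X) (hE : ∀ s t, MeasurableSet (E s t))
    (hEd : ∀ s t s' t', a ≤ s → s ≤ t → t ≤ s' → s' ≤ t' → t' ≤ b → Disjoint (E s t) (E s' t'))
    (hEm : ∀ s t, a ≤ s → s ≤ t → t ≤ b → μ (E s t) ≤ ENNReal.ofReal (t - s))
    (hr : ∀ s t, a ≤ s → s ≤ t → t ≤ b →
      ENNReal.ofReal |r s - r t| ≤ K * ∫⁻ x in E s t, w x ∂μ) :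
    AbsolutelyContinuousOnInterval r a b := by
  rw [absolutelyContinuousOnInterval_iff]
  intro ε hε
  have hK : (K : ℝ≥0∞) + 1 ≠ ⊤ := by simp
  obtain ⟨δ', hδ', hδ⟩ := exists_pos_setLIntegral_lt_of_measure_lt hw
    (ε := ENNReal.ofReal ε / (K + 1)) (ENNReal.div_pos (ENNReal.ofReal_pos.2 hε).ne' hK).ne'
  have hm0 : min δ' 1 ≠ 0 := (lt_min hδ' one_pos).ne'
  have hmt : min δ' 1 ≠ ⊤ := (lt_of_le_of_lt (min_le_right _ _) ENNReal.one_lt_top).ne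
  refine ⟨(min δ' 1).toReal, ENNReal.toReal_pos hm0 hmt, ?_⟩
  rintro ⟨n, I⟩ ⟨hI, hdis⟩ hlen
  simp only at hI hdis hlen ⊢
  rw [uIcc_of_le hab] at hI
  set p : ℕ → ℝ := fun i => min (I i).1 (I i).2 with hp
  set q : ℕ → ℝ := fun i => max (I i).1 (I i).2 with hq
  -- Endpoints may come in either order and may coincide. Degenerate intervals contribute nothing
  -- and are dropped; the remaining disjoint ones are then linearly ordered.
  set T := (Finset.range n).filter fun i => p i < q i with hT
  have hpa : ∀ i ∈ T, a ≤ p i ∧ p i ≤ q i ∧ q i ≤ b := fun i hi => by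
    have h := hI i (Finset.mem_filter.1 hi).1
    exact ⟨le_min h.1.1 h.2.1, min_le_max, max_le h.1.2 h.2.2⟩
  have hdist : ∀ f : ℝ → ℝ, ∑ i ∈ Finset.range n, dist (f (I i).1) (f (I i).2) =
      ∑ i ∈ T, |f (p i) - f (q i)| := fun f => by
    rw [hT, Finset.sum_filter]
    refine Finset.sum_congr rfl fun i _ => ?_
    rcases lt_trichotomy (I i).1 (I i).2 with h | h | h
    · simp [hp, hq, min_eq_left h.le, max_eq_right h.le, h, Real.dist_eq]
    · simp [hp, hq, h]
    · simp [hp, hq, min_eq_right h.le, max_eq_left h.le, h, Real.dist_eq, abs_sub_comm]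
  have hpd : (T : Set ℕ).PairwiseDisjoint fun i => E (p i) (q i) := by
    intro i hi j hj hij
    have hd := hdis (Finset.mem_coe.2 (Finset.mem_filter.1 hi).1)
      (Finset.mem_coe.2 (Finset.mem_filter.1 hj).1) hij
    have hi' := hpa i hi
    have hj' := hpa j hj
    have hil := (Finset.mem_filter.1 hi).2
    have hjl := (Finset.mem_filter.1 hj).2
    rcases le_or_gt (q i) (p j) with h | h
    · exact hEd _ _ _ _ hi'.1 hi'.2.1 h hj'.2.1 hj'.2.2
    rcases le_or_gt (q j) (p i) with h' | h'
    · exact (hEd _ _ _ _ hj'.1 hj'.2.1 h' hi'.2.1 hi'.2.2).symm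
    · exact absurd (Set.disjoint_left.1 hd
        (⟨lt_min hil h', min_le_left _ _⟩ : min (q i) (q j) ∈ Ioc (p i) (q i))
        ⟨lt_min h hjl, min_le_right _ _⟩) id
  have hsum0 : ∑ i ∈ T, |p i - q i| < (min δ' 1).toReal := by
    rw [← hdist fun x => x]
    exact hlen
  have hmeas : μ (⋃ i ∈ T, E (p i) (q i)) < δ' := by
    refine lt_of_lt_of_le ?_ (min_le_left δ' 1)
    calc μ (⋃ i ∈ T, E (p i) (q i)) ≤ ∑ i ∈ T, μ (E (p i) (q i)) := measure_biUnion_finset_le _ _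
      _ ≤ ∑ i ∈ T, ENNReal.ofReal |p i - q i| := by
          refine Finset.sum_le_sum fun i hi => ?_
          obtain ⟨h1, h2, h3⟩ := hpa i hi
          rw [abs_sub_comm, abs_of_nonneg (sub_nonneg.2 h2)]
          exact hEm _ _ h1 h2 h3
      _ = ENNReal.ofReal (∑ i ∈ T, |p i - q i|) :=
          (ENNReal.ofReal_sum_of_nonneg fun _ _ => abs_nonneg _).symm
      _ < min δ' 1 := (ENNReal.ofReal_lt_iff_lt_toReal
          (Finset.sum_nonneg fun _ _ => abs_nonneg _) hmt).2 hsum0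
  have hfin : ENNReal.ofReal (∑ i ∈ T, |r (p i) - r (q i)|) < ENNReal.ofReal ε := by
    calc ENNReal.ofReal (∑ i ∈ T, |r (p i) - r (q i)|)
        = ∑ i ∈ T, ENNReal.ofReal |r (p i) - r (q i)| :=
          ENNReal.ofReal_sum_of_nonneg fun _ _ => abs_nonneg _
      _ ≤ ∑ i ∈ T, K * ∫⁻ x in E (p i) (q i), w x ∂μ := by
          refine Finset.sum_le_sum fun i hi => ?_
          obtain ⟨h1, h2, h3⟩ := hpa i hi
          exact hr _ _ h1 h2 h3
      _ = K * ∫⁻ x in ⋃ i ∈ T, E (p i) (q i), w x ∂μ := by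
          rw [lintegral_biUnion_finset hpd (fun _ _ => hE _ _), Finset.mul_sum]
      _ ≤ (K + 1) * ∫⁻ x in ⋃ i ∈ T, E (p i) (q i), w x ∂μ := by
          gcongr
          exact le_self_add
      _ < ENNReal.ofReal ε := ENNReal.mul_lt_of_lt_div' (hδ _ hmeas)
  rw [hdist r]
  exact (ENNReal.ofReal_lt_ofReal_iff hε).1 hfin

lemma absolutelyContinuousOnInterval_rearrangement [IsProbabilityMeasure μ] (hF : Measurable F)
    (hα : 0 ≤ α) (hw : ∫⁻ x, w x ∂μ ≠ ⊤)
    (hgap : ∀ t₁ t₂ : ℝ, 0 ≤ t₁ → t₁ < t₂ → ENNReal.ofReal (t₂ - t₁) * μ {x | t₂ ≤ |F x|} ^ α ≤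
      C * ∫⁻ x in {x | t₁ < |F x| ∧ |F x| < t₂}, w x ∂μ) {a : ℝ} (ha : 0 < a) (ha1 : a ≤ 1) :
    AbsolutelyContinuousOnInterval (rearrangement μ F) a 1 := by
  have ha' : a.toNNReal ≠ 0 := (Real.toNNReal_pos.2 ha).ne'
  have hcoe : ((C / a.toNNReal ^ α : ℝ≥0) : ℝ≥0∞) = C / ENNReal.ofReal a ^ α := by
    rw [ENNReal.coe_div (NNReal.rpow_pos (pos_iff_ne_zero.2 ha')).ne',
      ENNReal.coe_rpow_of_ne_zero ha', ENNReal.ofReal]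
  -- On [a, 1] the factor s^α is at least a^α, which is moved into the constant.
  refine absolutelyContinuousOnInterval_of_le_setLIntegral ha1
    (K := C / a.toNNReal ^ α) hw (levelBand μ F) (measurableSet_levelBand hF) ?_ ?_ ?_
  · intro s t s' t' h1 h2 h3 _ _
    exact disjoint_levelBand hF (ha.trans_le (h1.trans h2)) h3
  · intro s t h1 h2 h3
    exact measure_levelBand_le hF (ha.trans_le h1) h2 (h2.trans h3)
  · intro s t h1 h2 h3
    have hs := ha.trans_le h1
    have h := rearrangement_sub_le (w := w) hF hα hgap hs h2 (h2.trans h3)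
    rw [abs_of_nonneg (sub_nonneg.2 (rearrangement_antitone hF hs h2)), hcoe,
      div_eq_mul_inv, mul_right_comm, ← div_eq_mul_inv]
    have ha0 : ENNReal.ofReal a ^ α ≠ 0 := by
      simp [ENNReal.rpow_eq_zero_iff, ha, not_lt.2 hα]
    have hat : ENNReal.ofReal a ^ α ≠ ⊤ := ENNReal.rpow_ne_top_of_nonneg hα ENNReal.ofReal_ne_top
    rw [ENNReal.le_div_iff_mul_le (Or.inl ha0) (Or.inl hat)]
    refine le_trans ?_ h
    gcongr

lemma rearrangement_eq_integral [IsProbabilityMeasure μ] (hF : Measurable F)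
    (hα : 0 ≤ α) (hw : ∫⁻ x, w x ∂μ ≠ ⊤)
    (hgap : ∀ t₁ t₂ : ℝ, 0 ≤ t₁ → t₁ < t₂ → ENNReal.ofReal (t₂ - t₁) * μ {x | t₂ ≤ |F x|} ^ α ≤
      C * ∫⁻ x in {x | t₁ < |F x| ∧ |F x| < t₂}, w x ∂μ) {s : ℝ} (hs : 0 < s) (hs1 : s ≤ 1) :
    rearrangement μ F s = rearrangement μ F 1 +
      ∫ t in s..1, -deriv (rearrangement μ F) t := by
  have h := (absolutelyContinuousOnInterval_rearrangement hF hα hw hgap hs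
    hs1).integral_deriv_eq_sub
  rw [intervalIntegral.integral_neg, h]
  ring

/-- The intervals contain s, so the errors at the two endpoints, each a small multiple of its
distance to s, add up to a small multiple of the whole length y - x. -/
lemma tendsto_mul_sub_of_hasDerivAt {r : ℝ → ℝ} {d s : ℝ} (h : HasDerivAt r d s)
    {x y : ℕ → ℝ} (hx : ∀ N, x N ≤ s) (hy : ∀ N, s ≤ y N)
    (hxy : ∀ N, y N - x N = 1 / ((N : ℝ) + 1)) :
    Tendsto (fun N : ℕ => ((N : ℝ) + 1) * (r (x N) - r (y N))) atTop (𝓝 (-d)) := by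
  have h0 := tendsto_one_div_add_atTop_nhds_zero_nat (𝕜 := ℝ)
  have hxs : Tendsto x atTop (𝓝 s) := by
    refine tendsto_of_tendsto_of_tendsto_of_le_of_le (g := fun N : ℕ => s - 1 / ((N : ℝ) + 1))
      (by simpa using tendsto_const_nhds.sub h0) tendsto_const_nhds (fun N => ?_) hx
    have := hxy N; have := hy N
    simp only
    linarith
  have hys : Tendsto y atTop (𝓝 s) := by
    refine tendsto_of_tendsto_of_tendsto_of_le_of_le (h := fun N : ℕ => s + 1 / ((N : ℝ) + 1))
      tendsto_const_nhds (by simpa using tendsto_const_nhds.add h0) hy (fun N => ?_)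
    have := hxy N; have := hx N
    simp only
    linarith
  rw [Metric.tendsto_atTop]
  intro ε hε
  have ho := (hasDerivAt_iff_isLittleO.1 h).bound (half_pos hε)
  obtain ⟨N₀, hN₀⟩ := eventually_atTop.1 ((hxs.eventually ho).and (hys.eventually ho))
  refine ⟨N₀, fun N hN => ?_⟩
  obtain ⟨h1, h2⟩ := hN₀ N hN
  have hN0 : (0 : ℝ) < (N : ℝ) + 1 := by positivity
  have hd := hxy N
  rw [Real.norm_eq_abs, Real.norm_eq_abs, smul_eq_mul] at h1 h2
  rw [abs_of_nonpos (sub_nonpos.2 (hx N))] at h1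
  rw [abs_of_nonneg (sub_nonneg.2 (hy N))] at h2
  rw [abs_le] at h1 h2
  have hkey : |r (x N) - r (y N) + d * (y N - x N)| ≤ ε / 2 * (y N - x N) := by
    rw [abs_le]
    constructor <;> nlinarith [h1.1, h1.2, h2.1, h2.2]
  rw [Real.dist_eq]
  have he : ((N : ℝ) + 1) * (r (x N) - r (y N)) - -d =
      ((N : ℝ) + 1) * (r (x N) - r (y N) + d * (y N - x N)) := by
    rw [hd]
    field_simp
    ring
  rw [he, abs_mul, abs_of_pos hN0]
  calc ((N : ℝ) + 1) * |r (x N) - r (y N) + d * (y N - x N)|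
      ≤ ((N : ℝ) + 1) * (ε / 2 * (y N - x N)) := by gcongr
    _ = ε / 2 := by
        rw [hd]
        field_simp
    _ < ε := by linarith

/-- The averages of `w`, on the scale of a uniform partition, over the level bands of the rearrangement. -/
def bandAverage (μ : Measure X) (E : ℕ → ℕ → Set X) (w : X → ℝ≥0∞) (N : ℕ) (s : ℝ) : ℝ≥0∞ :=
  ((N : ℝ≥0∞) + 1) * ∫⁻ x in E N ⌊s * ((N : ℝ) + 1)⌋₊, w x ∂μ

/-- The level bands at the points of the uniform partition of `[0, 1]` into `N + 1` intervals. The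
first one is taken to be empty. -/
def partitionBand (μ : Measure X) (F : X → ℝ) (N j : ℕ) : Set X :=
  if j = 0 then ∅ else levelBand μ F ((j : ℝ) / ((N : ℝ) + 1)) (((j : ℝ) + 1) / ((N : ℝ) + 1))

/-- Apply `rearrangement_sub_le` to the partition interval that contains s and multiply by N + 1:
the left side is a difference quotient and converges, the right side is a band average, of which
only a lower limit is available. -/
lemma rpow_mul_neg_deriv_le_liminf [IsProbabilityMeasure μ] (hF : Measurable F) (hα : 0 ≤ α)
    (hgap : ∀ t₁ t₂ : ℝ, 0 ≤ t₁ → t₁ < t₂ → ENNReal.ofReal (t₂ - t₁) * μ {x | t₂ ≤ |F x|} ^ α ≤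
      C * ∫⁻ x in {x | t₁ < |F x| ∧ |F x| < t₂}, w x ∂μ) {s : ℝ} (hs : 0 < s) (hs1 : s < 1)
    (hd : DifferentiableAt ℝ (rearrangement μ F) s) :
    ENNReal.ofReal s ^ α * ENNReal.ofReal (-deriv (rearrangement μ F) s) ≤
      C * liminf (fun N => bandAverage μ (partitionBand μ F) w N s) atTop := by
  set r := rearrangement μ F
  set x : ℕ → ℝ := fun N => (⌊s * ((N : ℝ) + 1)⌋₊ : ℝ) / ((N : ℝ) + 1) with hx
  set y : ℕ → ℝ := fun N => ((⌊s * ((N : ℝ) + 1)⌋₊ : ℝ) + 1) / ((N : ℝ) + 1) with hy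
  have hxs : ∀ N, x N ≤ s := fun N => by
    rw [hx, div_le_iff₀ (by positivity)]
    exact Nat.floor_le (by positivity)
  have hys : ∀ N, s ≤ y N := fun N => by
    rw [hy, le_div_iff₀ (by positivity)]
    exact (Nat.lt_floor_add_one _).le
  have hxy : ∀ N, y N - x N = 1 / ((N : ℝ) + 1) := fun N => by
    simp only [hx, hy]
    ring
  have ht := tendsto_mul_sub_of_hasDerivAt hd.hasDerivAt hxs hys hxy
  have h0 := tendsto_one_div_add_atTop_nhds_zero_nat (𝕜 := ℝ)
  have hxt : Tendsto x atTop (𝓝 s) := by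
    refine tendsto_of_tendsto_of_tendsto_of_le_of_le (g := fun N : ℕ => s - 1 / ((N : ℝ) + 1))
      (by simpa using tendsto_const_nhds.sub h0) tendsto_const_nhds (fun N => ?_) hxs
    have := hxy N; have := hys N
    simp only
    linarith
  have hlim : Tendsto (fun N : ℕ => ENNReal.ofReal (x N) ^ α *
      ENNReal.ofReal (((N : ℝ) + 1) * (r (x N) - r (y N)))) atTop
      (𝓝 (ENNReal.ofReal s ^ α * ENNReal.ofReal (-deriv r s))) := by
    refine ENNReal.Tendsto.mul ((ENNReal.continuous_rpow_const.tendsto _).comp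
      (ENNReal.tendsto_ofReal hxt)) (Or.inr ENNReal.ofReal_ne_top) (ENNReal.tendsto_ofReal ht)
      (Or.inr (ENNReal.rpow_ne_top_of_nonneg hα ENNReal.ofReal_ne_top))
  rw [← hlim.liminf_eq, ← ENNReal.liminf_const_mul_of_ne_top ENNReal.coe_ne_top]
  refine liminf_le_liminf ?_
  have hev : ∀ᶠ N in atTop, 0 < x N := hxt.eventually (lt_mem_nhds hs)
  filter_upwards [hev] with N hN
  -- The empty band j = 0 does no harm, since for large N the left endpoint is positive.
  have hfl : ⌊s * ((N : ℝ) + 1)⌋₊ ≠ 0 := fun h => by simp [hx, h] at hN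
  have hle := rearrangement_sub_le (w := w) hF hα hgap hN ((hxs N).trans (hys N))
    ((hxs N).trans hs1.le)
  rw [bandAverage, partitionBand, if_neg hfl, ENNReal.ofReal_mul (by positivity)]
  have hN1 : ENNReal.ofReal ((N : ℝ) + 1) = (N : ℝ≥0∞) + 1 := by
    rw [ENNReal.ofReal_add (by positivity) zero_le_one]
    simp
  rw [hN1]
  calc ENNReal.ofReal (x N) ^ α * (((N : ℝ≥0∞) + 1) * ENNReal.ofReal (r (x N) - r (y N)))
      = ((N : ℝ≥0∞) + 1) * (ENNReal.ofReal (r (x N) - r (y N)) * ENNReal.ofReal (x N) ^ α) := by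
        ring
    _ ≤ ((N : ℝ≥0∞) + 1) * (C * ∫⁻ x in levelBand μ F (x N) (y N), w x ∂μ) := by gcongr
    _ = _ := by ring

end Rearrangement

end PolyaSzego

end

noncomputable section

namespace PolyaSzego

open Filter Topology

/-! ### Rearrangement invariant norms through quantile functions -/

section Quantile

variable {α : Type*} [MeasurableSpace α] {μ : Measure α}

/-- The decreasing rearrangement of an extended nonnegative function. -/
def quantile (μ : Measure α) (u : α → ℝ≥0∞) (s : ℝ) : ℝ≥0∞ :=
  sInf {t : ℝ≥0∞ | μ {x | t < u x} ≤ ENNReal.ofReal s}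

lemma lt_quantile_iff {u : α → ℝ≥0∞} {s : ℝ} {t : ℝ≥0∞} :
    t < quantile μ u s ↔ ENNReal.ofReal s < μ {x | t < u x} := by
  constructor
  · intro h
    by_contra hc
    have hm : t ∈ {t : ℝ≥0∞ | μ {x | t < u x} ≤ ENNReal.ofReal s} := not_lt.1 hc
    exact absurd (sInf_le hm) (not_le.2 h)
  · intro h
    by_contra hc
    have hc := not_lt.1 hc
    have htop : t < ⊤ := by
      refine lt_top_iff_ne_top.2 fun ht => ?_
      simp [ht] at h
    refine absurd h (not_lt.2 ?_)
    obtain ⟨v, hv, hvt, hlim⟩ := exists_seq_strictAnti_tendsto' htop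
    have hun : {x | t < u x} = ⋃ k : ℕ, {x | v k < u x} := by
      ext x
      simp only [mem_ofPred_eq, mem_iUnion]
      exact ⟨fun hx => (hlim.eventually (gt_mem_nhds hx)).exists,
        fun ⟨k, hk⟩ => (hvt k).1.trans hk⟩
    have ht : Tendsto (fun k : ℕ => μ {x | v k < u x}) atTop (𝓝 (μ {x | t < u x})) := by
      rw [hun]
      exact tendsto_measure_iUnion_atTop
        fun i j hij x (hx : v i < u x) => lt_of_le_of_lt (hv.antitone hij) hx
    refine le_of_tendsto' ht fun k => ?_
    obtain ⟨l, hl, hlt⟩ := exists_lt_of_csInf_lt (⟨⊤, by simp⟩ :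
      {t : ℝ≥0∞ | μ {x | t < u x} ≤ ENNReal.ofReal s}.Nonempty) (hc.trans_lt (hvt k).1)
    exact (measure_mono fun x (hx : _ < u x) => hlt.trans hx).trans hl

lemma quantile_antitone (u : α → ℝ≥0∞) : Antitone (quantile μ u) := fun _ _ h =>
  sInf_le_sInf fun _ ht => le_trans ht (ENNReal.ofReal_le_ofReal h)

lemma quantile_mono {u v : α → ℝ≥0∞} (h : ∀ t, μ {x | t < u x} ≤ μ {x | t < v x}) (s : ℝ) :
    quantile μ u s ≤ quantile μ v s :=
  sInf_le_sInf fun t ht => (h t).trans ht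

lemma volume_Ioo_inter_ofReal_lt {m : ℝ≥0∞} (hm : m ≤ 1) :
    volume.restrict (Ioo (0 : ℝ) 1) {s | ENNReal.ofReal s < m} = m := by
  have hmt : m ≠ ⊤ := (hm.trans_lt ENNReal.one_lt_top).ne
  have : {s | ENNReal.ofReal s < m} ∩ Ioo (0 : ℝ) 1 = Ioo 0 m.toReal := by
    ext s
    simp only [mem_inter_iff, mem_ofPred_eq, mem_Ioo]
    constructor
    · rintro ⟨h, h0, -⟩
      exact ⟨h0, (ENNReal.ofReal_lt_iff_lt_toReal h0.le hmt).1 h⟩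
    · rintro ⟨h0, h⟩
      exact ⟨(ENNReal.ofReal_lt_iff_lt_toReal h0.le hmt).2 h, h0,
        h.trans_le (by simpa using ENNReal.toReal_mono ENNReal.one_ne_top hm)⟩
  rw [Measure.restrict_apply' measurableSet_Ioo, this, Real.volume_Ioo, sub_zero,
    ENNReal.ofReal_toReal hmt]

variable {T : α → ℝ}

/-- The quantile exceeds t exactly for s below the measure of {u > t}, and the uniform variable T
takes such values with just that probability. -/
lemma equimeasurable_quantile [IsProbabilityMeasure μ]
    (hT : MeasurePreserving T μ (volume.restrict (Ioo (0 : ℝ) 1))) (u : α → ℝ≥0∞) :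
    Equimeasurable μ μ (fun x => quantile μ u (T x)) u := fun t => by
  have hms : MeasurableSet {s | ENNReal.ofReal s < μ {x | t < u x}} :=
    measurableSet_lt ENNReal.measurable_ofReal measurable_const
  have he : {x | t < quantile μ u (T x)} = T ⁻¹' {s | ENNReal.ofReal s < μ {x | t < u x}} := by
    ext x
    exact lt_quantile_iff
  rw [he, hT.measure_preimage hms.nullMeasurableSet, volume_Ioo_inter_ofReal_lt prob_le_one]

lemma aemeasurable_quantile_comp (hT : Measurable T) (u : α → ℝ≥0∞) :
    AEMeasurable (fun x => quantile μ u (T x)) μ :=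
  ((quantile_antitone u).measurable.comp hT).aemeasurable

/-- Rearranging both functions along the same uniform variable T turns the comparison of
distributions into a pointwise one. -/
lemma RINorm.le_of_distribution_le [IsProbabilityMeasure μ] (X : RINorm μ)
    (hT : MeasurePreserving T μ (volume.restrict (Ioo (0 : ℝ) 1))) {u v : α → ℝ≥0∞}
    (hu : AEMeasurable u μ) (hv : AEMeasurable v μ)
    (h : ∀ t, μ {x | t < u x} ≤ μ {x | t < v x}) : X.toFun u ≤ X.toFun v := by
  rw [← X.rearrangement_invariant _ _ (aemeasurable_quantile_comp hT.measurable u) hu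
    (equimeasurable_quantile hT u), ← X.rearrangement_invariant _ _
    (aemeasurable_quantile_comp hT.measurable v) hv (equimeasurable_quantile hT v)]
  exact X.mono _ _ (aemeasurable_quantile_comp hT.measurable u)
    (aemeasurable_quantile_comp hT.measurable v) (ae_of_all _ fun x => quantile_mono h _)

lemma RINorm.liminf_le (X : RINorm μ) {u : ℕ → α → ℝ≥0∞} (hu : ∀ k, AEMeasurable (u k) μ)
    {R : ℝ≥0∞} (hR : ∀ k, X.toFun (u k) ≤ R) :
    X.toFun (fun x => liminf (fun k => u k x) atTop) ≤ R := by
  simp_rw [liminf_eq_iSup_iInf_of_nat]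
  have hm : ∀ n : ℕ, AEMeasurable (fun x => ⨅ i, ⨅ (_ : i ≥ n), u i x) μ := fun n =>
    AEMeasurable.iInf fun i => AEMeasurable.iInf fun _ => hu i
  rw [X.fatou _ hm (ae_of_all _ fun x m n hmn =>
    biInf_mono fun i (hi : i ≥ n) => (hmn.trans hi : m ≤ i))]
  exact iSup_le fun n => (X.mono _ _ (hm n) (hu n)
    (ae_of_all _ fun x => iInf₂_le n le_rfl)).trans (hR n)

lemma RINorm.sum_le (X : RINorm μ) {ι : Type*} (s : Finset ι) {u : ι → α → ℝ≥0∞}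
    (hu : ∀ k, AEMeasurable (u k) μ) :
    X.toFun (fun x => ∑ k ∈ s, u k x) ≤ ∑ k ∈ s, X.toFun (u k) := by
  classical
  induction s using Finset.induction_on with
  | empty =>
    simp only [Finset.sum_empty]
    exact ((X.eq_zero_iff _ aemeasurable_const).2 (ae_of_all _ fun _ => rfl)).le
  | insert a s ha ih =>
    simp only [Finset.sum_insert ha]
    exact (X.add_le _ _ (hu a) (Finset.aemeasurable_fun_sum s fun k _ => hu k)).trans
      (add_le_add le_rfl ih)

end Quantile

/-! ### Averaging over disjoint sets is a contraction -/

section Averaging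

lemma sum_range_mul_div_mod {M : Type*} [AddCommMonoid M] (f : ℕ → ℕ → M) (P : ℕ) {Q : ℕ}
    (hQ : 0 < Q) : ∑ l ∈ Finset.range (P * Q), f (l / Q) (l % Q) =
      ∑ j ∈ Finset.range P, ∑ i ∈ Finset.range Q, f j i := by
  induction P with
  | zero => simp
  | succ P ih =>
    rw [Nat.succ_mul, Finset.sum_range_add, ih, Finset.sum_range_succ]
    congr 1
    refine Finset.sum_congr rfl fun i hi => ?_
    have hi := Finset.mem_range.1 hi
    rw [Nat.mul_comm P Q, Nat.mul_add_div hQ, Nat.mul_add_mod, Nat.div_eq_of_lt hi,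
      Nat.mod_eq_of_lt hi, add_zero]

lemma sum_range_add_mod {M : Type*} [AddCommMonoid M] (g : ℕ → M) {a Q : ℕ} (ha : a < Q) :
    ∑ k ∈ Finset.range Q, g ((a + k) % Q) = ∑ i ∈ Finset.range Q, g i := by
  have : NeZero Q := ⟨by omega⟩
  rw [← Fin.sum_univ_eq_sum_range g, ← Fin.sum_univ_eq_sum_range fun k => g ((a + k) % Q),
    ← Equiv.sum_comp (Equiv.addLeft (⟨a, ha⟩ : Fin Q)) fun i : Fin Q => g i]
  refine Finset.sum_congr rfl fun i _ => ?_
  rw [Equiv.coe_addLeft, Fin.val_add]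

/-- The cells to the left of the nodes (i + 1)h below m are disjoint and contained in (0, m). -/
lemma sum_ite_le {h : ℝ} (hh : 0 < h) (Q : ℕ) (m : ℝ≥0∞) :
    ∑ i ∈ Finset.range Q, (if ENNReal.ofReal (((i : ℝ) + 1) * h) < m then ENNReal.ofReal h else 0)
      ≤ m := by
  rcases eq_or_ne m ⊤ with rfl | hm
  · exact le_top
  have hd : ((Finset.range Q : Finset ℕ) : Set ℕ).PairwiseDisjoint fun i : ℕ =>
      (if ENNReal.ofReal (((i : ℝ) + 1) * h) < m then Ioc ((i : ℝ) * h) (((i : ℝ) + 1) * h)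
        else ∅) := by
    intro i _ j _ hij
    refine Set.disjoint_left.2 fun x hx hx' => hij ?_
    simp only at hx hx'
    split_ifs at hx hx' with h1 h2
    · have h3 : (i : ℝ) < j + 1 := lt_of_mul_lt_mul_right (hx.1.trans_le hx'.2) hh.le
      have h4 : (j : ℝ) < i + 1 := lt_of_mul_lt_mul_right (hx'.1.trans_le hx.2) hh.le
      norm_cast at h3 h4
      omega
    all_goals simp_all
  calc ∑ i ∈ Finset.range Q, (if ENNReal.ofReal (((i : ℝ) + 1) * h) < m then ENNReal.ofReal h else 0)
      = ∑ i ∈ Finset.range Q, volume (if ENNReal.ofReal (((i : ℝ) + 1) * h) < m then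
          Ioc ((i : ℝ) * h) (((i : ℝ) + 1) * h) else ∅) := by
        refine Finset.sum_congr rfl fun i _ => ?_
        split_ifs
        · rw [Real.volume_Ioc]
          ring_nf
        · simp
    _ = volume (⋃ i ∈ Finset.range Q, if ENNReal.ofReal (((i : ℝ) + 1) * h) < m then
          Ioc ((i : ℝ) * h) (((i : ℝ) + 1) * h) else ∅) := by
        refine (measure_biUnion_finset hd fun i _ => ?_).symm
        split_ifs
        exacts [measurableSet_Ioc, MeasurableSet.empty]
    _ ≤ volume (Ioo 0 m.toReal) := by
        refine measure_mono (iUnion₂_subset fun i _ => ?_)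
        split_ifs with hi
        · exact fun x hx => ⟨lt_of_le_of_lt (by positivity) hx.1, hx.2.trans_lt
            ((ENNReal.ofReal_lt_iff_lt_toReal (by positivity) hm).1 hi)⟩
        · exact empty_subset _
    _ = m := by rw [Real.volume_Ioo, sub_zero, ENNReal.ofReal_toReal hm]

/-- The cells to the right of the nodes below m, together with the first cell, cover (0, m); the
first cell is the additional h. -/
lemma le_add_sum_ite {h : ℝ} (hh : 0 < h) (Q : ℕ) {m : ℝ≥0∞} (hm : m ≤ ENNReal.ofReal (Q * h)) :
    m ≤ ENNReal.ofReal h + ∑ i ∈ Finset.range Q,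
      (if ENNReal.ofReal (((i : ℝ) + 1) * h) < m then ENNReal.ofReal h else 0) := by
  have hmt : m ≠ ⊤ := (hm.trans_lt ENNReal.ofReal_lt_top).ne
  calc m = volume (Ioo 0 m.toReal) := by
        rw [Real.volume_Ioo, sub_zero, ENNReal.ofReal_toReal hmt]
    _ ≤ volume (Ioc 0 h ∪ ⋃ i ∈ Finset.range Q, if ENNReal.ofReal (((i : ℝ) + 1) * h) < m then
          Ioc (((i : ℝ) + 1) * h) (((i : ℝ) + 2) * h) else ∅) := by
        refine measure_mono fun s hs => ?_
        rcases le_or_gt s h with hsh | hsh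
        · exact Or.inl ⟨hs.1, hsh⟩
        refine Or.inr ?_
        have hsm : s < Q * h := hs.2.trans_le (ENNReal.toReal_le_of_le_ofReal (by positivity) hm)
        obtain ⟨k, hk⟩ : ∃ k, ⌈s / h⌉₊ = k + 2 := by
          refine ⟨⌈s / h⌉₊ - 2, ?_⟩
          have : 1 < ⌈s / h⌉₊ := Nat.lt_ceil.2 (by simpa using (one_lt_div hh).2 hsh)
          omega
        have h1 : ((k : ℝ) + 1) * h < s := by
          rw [← lt_div_iff₀ hh]
          have : k + 1 < ⌈s / h⌉₊ := by omega
          exact_mod_cast Nat.lt_ceil.1 this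
        have h2 : s ≤ ((k : ℝ) + 2) * h := by
          rw [← div_le_iff₀ hh]
          have := Nat.le_ceil (s / h)
          rw [hk] at this
          exact_mod_cast this
        have hkQ : k < Q := by
          have : ((k : ℝ) + 1) < Q := lt_of_mul_lt_mul_right (h1.trans hsm) hh.le
          norm_cast at this
          omega
        refine mem_iUnion₂.2 ⟨k, Finset.mem_range.2 hkQ, ?_⟩
        rw [if_pos ((ENNReal.ofReal_lt_iff_lt_toReal (by positivity) hmt).2 (h1.trans hs.2))]
        exact ⟨h1, h2⟩
    _ ≤ volume (Ioc 0 h) + ∑ i ∈ Finset.range Q, volume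
          (if ENNReal.ofReal (((i : ℝ) + 1) * h) < m then
            Ioc (((i : ℝ) + 1) * h) (((i : ℝ) + 2) * h) else ∅) :=
        (measure_union_le _ _).trans (add_le_add le_rfl (measure_biUnion_finset_le _ _))
    _ = _ := by
        rw [Real.volume_Ioc, sub_zero]
        congr 1
        refine Finset.sum_congr rfl fun i _ => ?_
        split_ifs
        · rw [Real.volume_Ioc]
          ring_nf
        · simp

lemma lintegral_Ioi_ite_ofReal_lt (c : ℝ≥0∞) :
    ∫⁻ t in Ioi (0 : ℝ), (if ENNReal.ofReal t < c then 1 else 0) = c := by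
  have hms : MeasurableSet {t : ℝ | ENNReal.ofReal t < c} :=
    measurableSet_lt ENNReal.measurable_ofReal measurable_const
  have he : (fun t : ℝ => if ENNReal.ofReal t < c then (1 : ℝ≥0∞) else 0) =
      {t : ℝ | ENNReal.ofReal t < c}.indicator 1 := by
    ext t
    simp [indicator_apply]
  rw [he, lintegral_indicator_one hms, Measure.restrict_apply hms]
  rcases eq_or_ne c ⊤ with rfl | hc
  · simp
  · have : {t : ℝ | ENNReal.ofReal t < c} ∩ Ioi 0 = Ioo 0 c.toReal := by
      ext t
      simp only [mem_inter_iff, mem_ofPred_eq, mem_Ioi, mem_Ioo]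
      constructor
      · rintro ⟨h, h0⟩
        exact ⟨h0, (ENNReal.ofReal_lt_iff_lt_toReal h0.le hc).1 h⟩
      · rintro ⟨h0, h⟩
        exact ⟨(ENNReal.ofReal_lt_iff_lt_toReal h0.le hc).2 h, h0⟩
    rw [this, Real.volume_Ioo, sub_zero, ENNReal.ofReal_toReal hc]

variable {α : Type*} [MeasurableSpace α] {μ : Measure α}

lemma lintegral_eq_lintegral_measure_ofReal_lt [SFinite μ] {w : α → ℝ≥0∞} (hw : Measurable w) :
    ∫⁻ x, w x ∂μ = ∫⁻ t in Ioi (0 : ℝ), μ {x | ENNReal.ofReal t < w x} := by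
  have hms : MeasurableSet {p : α × ℝ | ENNReal.ofReal p.2 < w p.1} :=
    measurableSet_lt (ENNReal.measurable_ofReal.comp measurable_snd) (hw.comp measurable_fst)
  calc ∫⁻ x, w x ∂μ
      = ∫⁻ x, (∫⁻ t in Ioi (0 : ℝ), (if ENNReal.ofReal t < w x then 1 else 0)) ∂μ := by
        simp_rw [lintegral_Ioi_ite_ofReal_lt]
    _ = ∫⁻ t in Ioi (0 : ℝ), (∫⁻ x, (if ENNReal.ofReal t < w x then 1 else 0) ∂μ) := by
        refine lintegral_lintegral_swap (Measurable.aemeasurable ?_)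
        exact Measurable.ite hms measurable_const measurable_const
    _ = _ := by
        refine lintegral_congr fun t => ?_
        have hm : MeasurableSet {x | ENNReal.ofReal t < w x} := measurableSet_lt measurable_const hw
        rw [← lintegral_indicator_one hm]
        refine lintegral_congr fun x => ?_
        simp [indicator_apply]

/-- Riemann sums of the decreasing rearrangement recover the integral. -/
lemma lintegral_le_liminf_quantile_sum [IsFiniteMeasure μ] {w : α → ℝ≥0∞} (hw : Measurable w)
    {P : ℕ} (hP : 0 < P) (hsupp : ∀ t, μ {x | t < w x} ≤ ENNReal.ofReal (1 / P)) :
    ∫⁻ x, w x ∂μ ≤ liminf (fun M : ℕ => ENNReal.ofReal (1 / (P * ((M : ℝ) + 1))) *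
      ∑ i ∈ Finset.range (M + 1), quantile μ w (((i : ℝ) + 1) * (1 / (P * ((M : ℝ) + 1))))) atTop := by
  have hP' : (0 : ℝ) < P := by exact_mod_cast hP
  set h : ℕ → ℝ := fun M => 1 / (P * ((M : ℝ) + 1)) with hh
  have hpos : ∀ M, 0 < h M := fun M => by positivity
  have hlim : Tendsto (fun M => ENNReal.ofReal (h M)) atTop (𝓝 0) := by
    have h1 : Tendsto h atTop (𝓝 0) := by
      have := (tendsto_one_div_add_atTop_nhds_zero_nat (𝕜 := ℝ)).const_mul (1 / (P : ℝ))
      rw [mul_zero] at this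
      refine this.congr fun M => ?_
      rw [hh, div_mul_div_comm, one_mul]
    simpa using ENNReal.tendsto_ofReal h1
  have hmt : Measurable fun t : ℝ => μ {x | ENNReal.ofReal t < w x} := by
    refine Antitone.measurable fun s t hst => measure_mono
      fun x (hx : ENNReal.ofReal t < w x) => ?_
    exact lt_of_le_of_lt (ENNReal.ofReal_le_ofReal hst) hx
  calc ∫⁻ x, w x ∂μ = ∫⁻ t in Ioi (0 : ℝ), μ {x | ENNReal.ofReal t < w x} :=
        lintegral_eq_lintegral_measure_ofReal_lt hw
    -- One mesh width is given up in advance, to pay for the first cell in `le_add_sum_ite`; it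
    -- vanishes in the limit.
    _ ≤ ∫⁻ t in Ioi (0 : ℝ),
          liminf (fun M => μ {x | ENNReal.ofReal t < w x} - ENNReal.ofReal (h M)) atTop := by
        refine lintegral_mono fun t => le_of_eq ?_
        have : Tendsto (fun M => μ {x | ENNReal.ofReal t < w x} - ENNReal.ofReal (h M)) atTop
            (𝓝 (μ {x | ENNReal.ofReal t < w x} - 0)) :=
          ENNReal.Tendsto.sub tendsto_const_nhds hlim (Or.inl (measure_ne_top _ _))
        rw [this.liminf_eq, tsub_zero]
    _ ≤ liminf (fun M => ∫⁻ t in Ioi (0 : ℝ),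
          (μ {x | ENNReal.ofReal t < w x} - ENNReal.ofReal (h M))) atTop :=
        lintegral_liminf_le fun M => hmt.sub_const _
    _ ≤ _ := by
        refine liminf_le_liminf (Eventually.of_forall fun M => ?_)
        calc ∫⁻ t in Ioi (0 : ℝ), (μ {x | ENNReal.ofReal t < w x} - ENNReal.ofReal (h M))
            ≤ ∫⁻ t in Ioi (0 : ℝ), ∑ i ∈ Finset.range (M + 1), ENNReal.ofReal (h M) *
              (if ENNReal.ofReal t < quantile μ w (((i : ℝ) + 1) * h M) then 1 else 0) := by
              refine lintegral_mono fun t => ?_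
              simp only
              rw [tsub_le_iff_left]
              have hQ : ((M + 1 : ℕ) : ℝ) * h M = 1 / P := by
                simp only [hh, Nat.cast_add, Nat.cast_one]
                field_simp
              refine (le_add_sum_ite (hpos M) (M + 1) (by rw [hQ]; exact hsupp _)).trans
                (add_le_add le_rfl (Finset.sum_le_sum fun i _ => ?_))
              simp only [lt_quantile_iff, mul_ite, mul_one, mul_zero]
              exact le_rfl
          _ = _ := by
              have hm : ∀ c : ℝ≥0∞, Measurable fun t : ℝ =>
                  if ENNReal.ofReal t < c then (1 : ℝ≥0∞) else 0 := fun c =>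
                Measurable.ite (measurableSet_lt ENNReal.measurable_ofReal measurable_const)
                  measurable_const measurable_const
              rw [lintegral_finsetSum _ fun i _ => (hm _).const_mul _, Finset.mul_sum]
              refine Finset.sum_congr rfl fun i _ => ?_
              rw [lintegral_const_mul _ (hm _), lintegral_Ioi_ite_ofReal_lt]

lemma volume_floor_le (p : ℕ → Prop) [DecidablePred p] {L : ℕ} (hL : 0 < L) :
    volume.restrict (Ioo (0 : ℝ) 1) {s : ℝ | p ⌊s * L⌋₊} ≤
      ∑ l ∈ Finset.range L, if p l then ENNReal.ofReal (1 / L) else 0 := by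
  have hL' : (0 : ℝ) < L := by exact_mod_cast hL
  rw [Measure.restrict_apply' measurableSet_Ioo]
  calc volume ({s : ℝ | p ⌊s * L⌋₊} ∩ Ioo (0 : ℝ) 1)
      ≤ volume (⋃ l ∈ Finset.range L, if p l then Icc ((l : ℝ) / L) (((l : ℝ) + 1) / L) else ∅) := by
        refine measure_mono fun s hs => ?_
        have hlt : ⌊s * L⌋₊ < L := by
          rw [Nat.floor_lt (mul_nonneg hs.2.1.le hL'.le)]
          nlinarith [hs.2.2]
        refine mem_iUnion₂.2 ⟨⌊s * L⌋₊, Finset.mem_range.2 hlt, ?_⟩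
        have hp : p ⌊s * L⌋₊ := hs.1
        rw [if_pos hp]
        refine ⟨(div_le_iff₀ hL').2 (Nat.floor_le (mul_nonneg hs.2.1.le hL'.le)),
          (le_div_iff₀ hL').2 (Nat.lt_floor_add_one _).le⟩
    _ ≤ ∑ l ∈ Finset.range L, volume (if p l then Icc ((l : ℝ) / L) (((l : ℝ) + 1) / L) else ∅) :=
        measure_biUnion_finset_le _ _
    _ = _ := by
        refine Finset.sum_congr rfl fun l _ => ?_
        split_ifs
        · rw [Real.volume_Icc]
          ring_nf
        · simp

variable {T : α → ℝ}

/-- The proof uses only the triangle inequality, invariance and Fatou, no duality. Split each cell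
of T into M + 1 subcells, and let the j-th cell carry the quantiles of w restricted to E_j, one per
subcell. The E_j being disjoint, this step function is distributed no larger than w, and so are its
versions shifted cyclically within the cells. The mean over all shifts is constant on each cell,
with norm at most that of w, and equals P times a Riemann sum of the rearrangement. As M grows, the
lower limit of these sums dominates the integral over E_j. -/
lemma RINorm.partition_average_le [IsProbabilityMeasure μ] (X : RINorm μ)
    (hT : MeasurePreserving T μ (volume.restrict (Ioo (0 : ℝ) 1))) {w : α → ℝ≥0∞}
    (hw : Measurable w) {P : ℕ} (hP : 0 < P) {E : ℕ → Set α} (hE : ∀ j, MeasurableSet (E j))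
    (hd : Pairwise fun i j => Disjoint (E i) (E j))
    (hm : ∀ j < P, μ (E j) ≤ ENNReal.ofReal (1 / P)) :
    X.toFun (fun x => P * ∫⁻ y in E ⌊T x * P⌋₊, w y ∂μ) ≤ X.toFun w := by
  classical
  have hP' : (0 : ℝ) < P := by exact_mod_cast hP
  -- Quantiles are taken at the right ends of the subcells, where they are smallest, so that the
  -- distribution is not enlarged.
  set q : ℕ → ℕ → ℕ → ℝ≥0∞ := fun M j i =>
    quantile μ ((E j).indicator w) (((i : ℝ) + 1) * (1 / (P * ((M : ℝ) + 1)))) with hq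
  set J : ℕ → α → ℕ := fun M x => ⌊T x * (P * (M + 1) : ℕ)⌋₊ with hJ
  have hJm : ∀ M, Measurable (J M) := fun M =>
    Nat.measurable_floor.comp (hT.measurable.mul_const _)
  -- Quotient and remainder of l by M + 1 are the cell and the subcell; k is the cyclic shift.
  set G : ℕ → ℕ → ℕ → ℝ≥0∞ := fun M k l => q M (l / (M + 1)) ((k + l % (M + 1)) % (M + 1)) with hG
  have hum' : ∀ M k, Measurable (fun x => G M k (J M x)) := fun M k =>
    (measurable_from_top (f := G M k)).comp (hJm M)
  have hum : ∀ M k, AEMeasurable (fun x => G M k (J M x)) μ := fun M k => (hum' M k).aemeasurable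
  have hsub : ∀ j t, {x | t < (E j).indicator w x} ⊆ E j ∩ {x | t < w x} := by
    intro j t x (hx : t < (E j).indicator w x)
    by_cases hxE : x ∈ E j
    · rw [indicator_of_mem hxE] at hx
      exact ⟨hxE, hx⟩
    · rw [indicator_of_notMem hxE] at hx
      exact absurd hx not_lt_bot
  have hdist : ∀ M k, k < M + 1 → ∀ t, μ {x | t < G M k (J M x)} ≤ μ {x | t < w x} := by
    intro M k hk t
    have hL : 0 < P * (M + 1) := by positivity
    have hLr : ((P * (M + 1) : ℕ) : ℝ) = P * ((M : ℝ) + 1) := by push_cast; ring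
    have hms : MeasurableSet {s : ℝ | t < G M k ⌊s * (P * (M + 1) : ℕ)⌋₊} :=
      measurableSet_preimage (Nat.measurable_floor.comp (measurable_id.mul_const _))
        (MeasurableSet.of_discrete (s := {l : ℕ | t < G M k l}))
    have hpre : {x | t < G M k (J M x)} = T ⁻¹' {s : ℝ | t < G M k ⌊s * (P * (M + 1) : ℕ)⌋₊} := rfl
    rw [hpre, hT.measure_preimage hms.nullMeasurableSet]
    refine (volume_floor_le (fun l => t < G M k l) hL).trans ?_
    rw [sum_range_mul_div_mod (fun j i => if t < q M j ((k + i) % (M + 1)) then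
      ENNReal.ofReal (1 / (P * (M + 1) : ℕ)) else 0) P M.succ_pos]
    calc ∑ j ∈ Finset.range P, ∑ i ∈ Finset.range (M + 1), (if t < q M j ((k + i) % (M + 1)) then
          ENNReal.ofReal (1 / (P * (M + 1) : ℕ)) else 0)
        ≤ ∑ j ∈ Finset.range P, μ {x | t < (E j).indicator w x} := by
          refine Finset.sum_le_sum fun j _ => ?_
          rw [sum_range_add_mod (fun i => if t < q M j i then
            ENNReal.ofReal (1 / (P * (M + 1) : ℕ)) else 0) hk, hLr]
          simp only [hq, lt_quantile_iff]
          exact sum_ite_le (by positivity) _ _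
      _ = μ (⋃ j ∈ Finset.range P, {x | t < (E j).indicator w x}) := by
          refine (measure_biUnion_finset (fun i _ j _ hij => ?_) fun j _ => ?_).symm
          · exact (hd hij).mono ((hsub i t).trans inter_subset_left)
              ((hsub j t).trans inter_subset_left)
          · exact measurableSet_lt measurable_const (hw.indicator (hE j))
      _ ≤ μ {x | t < w x} :=
          measure_mono (iUnion₂_subset fun j _ => (hsub j t).trans inter_subset_right)
  have hXu : ∀ M k, k < M + 1 → X.toFun (fun x => G M k (J M x)) ≤ X.toFun w := fun M k hk =>
    X.le_of_distribution_le hT (hum M k) hw.aemeasurable (hdist M k hk)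
  set v : ℕ → α → ℝ≥0∞ := fun M x => (((M : ℝ≥0) + 1)⁻¹ : ℝ≥0) *
    ∑ k ∈ Finset.range (M + 1), G M k (J M x) with hv
  have hvm : ∀ M, Measurable (v M) := fun M =>
    (Finset.measurable_fun_sum _ fun k _ => hum' M k).const_mul _
  have hXv : ∀ M, X.toFun (v M) ≤ X.toFun w := by
    intro M
    rw [hv, X.smul _ _ (Finset.aemeasurable_fun_sum _ fun k _ => hum M k)]
    calc ((((M : ℝ≥0) + 1)⁻¹ : ℝ≥0) : ℝ≥0∞) *
          X.toFun (fun x => ∑ k ∈ Finset.range (M + 1), G M k (J M x))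
        ≤ ((((M : ℝ≥0) + 1)⁻¹ : ℝ≥0) : ℝ≥0∞) * ∑ k ∈ Finset.range (M + 1), X.toFun w := by
          gcongr
          exact (X.sum_le _ fun k => hum M k).trans
            (Finset.sum_le_sum fun k hk => hXu M k (Finset.mem_range.1 hk))
      _ = X.toFun w := by
          rw [Finset.sum_const, Finset.card_range, nsmul_eq_mul, ← mul_assoc]
          have : ((((M : ℝ≥0) + 1)⁻¹ : ℝ≥0) : ℝ≥0∞) * ((M + 1 : ℕ) : ℝ≥0∞) = 1 := by
            rw [← ENNReal.coe_natCast, ← ENNReal.coe_mul]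
            norm_cast
            rw [Nat.cast_add, Nat.cast_one, inv_mul_cancel₀ (by positivity)]
          rw [this, one_mul]
  refine le_trans (X.mono _ _ ?_ (Measurable.liminf hvm).aemeasurable ?_)
    (X.liminf_le (fun M => (hvm M).aemeasurable) hXv)
  · exact (((measurable_from_top (f := fun j : ℕ => ∫⁻ y in E j, w y ∂μ)).comp
      (Nat.measurable_floor.comp (hT.measurable.mul_const _))).const_mul _).aemeasurable
  · have hae : ∀ᵐ x ∂μ, T x ∈ Ioo (0 : ℝ) 1 :=
      hT.quasiMeasurePreserving.ae (ae_restrict_mem measurableSet_Ioo)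
    filter_upwards [hae] with x hx
    set j := ⌊T x * P⌋₊ with hj
    have hjP : j < P := by
      rw [hj, Nat.floor_lt (mul_nonneg hx.1.le hP'.le)]
      nlinarith [hx.2]
    have hvx : ∀ M, v M x = P * (ENNReal.ofReal (1 / (P * ((M : ℝ) + 1))) *
        ∑ i ∈ Finset.range (M + 1), q M j i) := by
      intro M
      have hdiv : J M x / (M + 1) = j := by
        rw [hJ, hj]
        simp only
        rw [← Nat.floor_div_natCast]
        congr 1
        push_cast
        field_simp
      have hlt : J M x % (M + 1) < M + 1 := Nat.mod_lt _ M.succ_pos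
      have hsum : ∑ k ∈ Finset.range (M + 1), G M k (J M x) =
          ∑ i ∈ Finset.range (M + 1), q M j i := by
        rw [← sum_range_add_mod (q M j) hlt]
        refine Finset.sum_congr rfl fun k _ => ?_
        simp only [hG]
        rw [hdiv, add_comm k]
      simp only [hv]
      rw [hsum, ← mul_assoc]
      congr 1
      rw [← ENNReal.ofReal_natCast P, ← ENNReal.ofReal_mul hP'.le, ← ENNReal.ofReal_coe_nnreal]
      congr 1
      push_cast
      field_simp
    simp only [hvx]
    rw [ENNReal.liminf_const_mul_of_ne_top (ENNReal.natCast_ne_top P), ← lintegral_indicator (hE j)]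
    gcongr
    refine lintegral_le_liminf_quantile_sum (hw.indicator (hE j)) hP fun t => ?_
    exact (measure_mono ((hsub j t).trans inter_subset_left)).trans (hm j hjP)

end Averaging

end PolyaSzego

end

noncomputable section

namespace PolyaSzego

open Filter Topology

/-! ### Uniformly distributed variables on Ω -/

section UniformVariable

variable {α : Type*} [MeasurableSpace α] {μ : Measure α}

lemma measurePreserving_Ioo_of_measure_le [IsProbabilityMeasure μ] {T : α → ℝ} (hT : Measurable T)
    (h : ∀ a : ℝ, 0 < a → a < 1 → μ {x | T x ≤ a} = ENNReal.ofReal a) :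
    MeasurePreserving T μ (volume.restrict (Ioo (0 : ℝ) 1)) := by
  refine ⟨hT, ?_⟩
  have : IsProbabilityMeasure (μ.map T) := Measure.isProbabilityMeasure_map hT.aemeasurable
  refine Measure.ext_of_Iic _ _ fun a => ?_
  have hmap : ∀ b, (μ.map T) (Iic b) = μ {x | T x ≤ b} := fun b =>
    Measure.map_apply hT measurableSet_Iic
  rw [Measure.restrict_apply measurableSet_Iic, hmap]
  rcases le_or_gt a 0 with ha | ha
  · have h0 : Iic a ∩ Ioo (0 : ℝ) 1 = ∅ :=
      eq_empty_of_forall_notMem fun x hx => absurd (hx.1.trans ha) (not_le.2 hx.2.1)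
    rw [h0, measure_empty]
    have hlim : Tendsto (fun k : ℕ => ENNReal.ofReal (1 / ((k : ℝ) + 1 + 1))) atTop (𝓝 0) := by
      have := (tendsto_add_atTop_iff_nat 1).2 (tendsto_one_div_add_atTop_nhds_zero_nat (𝕜 := ℝ))
      simpa using ENNReal.tendsto_ofReal this
    refine le_bot_iff.1 (ge_of_tendsto' hlim fun k => ?_)
    have hk : (1 : ℝ) / ((k : ℝ) + 1 + 1) < 1 := by
      rw [div_lt_one (by positivity)]
      linarith [(Nat.cast_nonneg k : (0 : ℝ) ≤ k)]
    rw [← h _ (by positivity) hk]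
    exact measure_mono fun x (hx : T x ≤ a) =>
      hx.trans (ha.trans (by positivity : (0 : ℝ) ≤ 1 / ((k : ℝ) + 1 + 1)))
  rcases lt_or_ge a 1 with ha1 | ha1
  · have h0 : Iic a ∩ Ioo (0 : ℝ) 1 = Ioc 0 a := by
      ext x
      simp only [mem_inter_iff, mem_Iic, mem_Ioo, mem_Ioc]
      exact ⟨fun hx => ⟨hx.2.1, hx.1⟩, fun hx => ⟨hx.2, hx.1, hx.2.trans_lt ha1⟩⟩
    rw [h0, h a ha ha1, Real.volume_Ioc, sub_zero]
  · have h0 : Iic a ∩ Ioo (0 : ℝ) 1 = Ioo 0 1 :=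
      inter_eq_right.2 fun x hx => (hx.2.le.trans ha1 : x ≤ a)
    rw [h0, Real.volume_Ioo, sub_zero, ENNReal.ofReal_one]
    refine le_antisymm prob_le_one ?_
    have hlim : Tendsto (fun k : ℕ => ENNReal.ofReal (1 - 1 / ((k : ℝ) + 1 + 1))) atTop (𝓝 1) := by
      have := (tendsto_add_atTop_iff_nat 1).2 (tendsto_one_div_add_atTop_nhds_zero_nat (𝕜 := ℝ))
      simpa using ENNReal.tendsto_ofReal (this.const_sub 1)
    refine le_of_tendsto' hlim fun k => ?_
    have hk : (1 : ℝ) / ((k : ℝ) + 1 + 1) < 1 := by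
      rw [div_lt_one (by positivity)]
      linarith [(Nat.cast_nonneg k : (0 : ℝ) ≤ k)]
    have hk0 : (0 : ℝ) < 1 / ((k : ℝ) + 1 + 1) := by positivity
    rw [← h _ (sub_pos.2 hk) (by linarith)]
    exact measure_mono fun x (hx : T x ≤ _) => (by linarith : T x ≤ a)

/-- The probability integral transform. Absence of atoms makes the distribution function continuous,
so it attains every a in (0, 1), and {cdf ≤ a} is a half-line whose endpoint has value a. -/
lemma measurePreserving_cdf (ν : Measure ℝ) [IsProbabilityMeasure ν] [NullSingletonClass ν] :
    MeasurePreserving (ProbabilityTheory.cdf ν) ν (volume.restrict (Ioo (0 : ℝ) 1)) := by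
  set c := ProbabilityTheory.cdf ν with hc
  have hcm : Monotone c := ProbabilityTheory.monotone_cdf ν
  have hcont : Continuous c := by
    refine continuous_iff_continuousAt.2 fun x => ?_
    have h0 : c.measure {x} = 0 := by
      rw [hc, ProbabilityTheory.measure_cdf]
      exact measure_singleton x
    rw [StieltjesFunction.measure_singleton, ENNReal.ofReal_eq_zero, sub_nonpos] at h0
    rw [hcm.continuousAt_iff_leftLim_eq_rightLim, c.rightLim_eq]
    exact le_antisymm (hcm.leftLim_le le_rfl) h0
  refine measurePreserving_Ioo_of_measure_le hcm.measurable fun a ha ha1 => ?_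
  obtain ⟨x₀, hx₀⟩ : ∃ x, c x = a := by
    obtain ⟨y, hy⟩ := ((ProbabilityTheory.tendsto_cdf_atBot ν).eventually (gt_mem_nhds ha)).exists
    obtain ⟨z, hz⟩ := ((ProbabilityTheory.tendsto_cdf_atTop ν).eventually (lt_mem_nhds ha1)).exists
    exact mem_range_of_exists_le_of_exists_ge hcont ⟨y, hy.le⟩ ⟨z, hz.le⟩
  set S := {x | c x ≤ a} with hS
  have hbdd : BddAbove S := by
    obtain ⟨z, hz⟩ := ((ProbabilityTheory.tendsto_cdf_atTop ν).eventually (lt_mem_nhds ha1)).exists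
    refine ⟨z, fun x (hx : c x ≤ a) => ?_⟩
    by_contra! hzx
    exact absurd (hcm hzx.le) (not_le.2 (hx.trans_lt hz))
  have hmem : sSup S ∈ S :=
    (isClosed_le hcont continuous_const).csSup_mem ⟨x₀, hx₀.le⟩ hbdd
  have hSI : S = Iic (sSup S) :=
    Subset.antisymm (fun x hx => le_csSup hbdd hx) fun x hx => (hcm hx).trans hmem
  have hval : c (sSup S) = a :=
    le_antisymm hmem (hx₀ ▸ hcm (le_csSup hbdd (show x₀ ∈ S from hx₀.le)))
  rw [hSI, ← ProbabilityTheory.ofReal_cdf ν, ← hc, hval]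

/-- A coordinate has no atoms because hyperplanes are null; composing it with its own distribution
function makes it uniform. Through T, functions on (0, 1) acquire equimeasurable copies on Ω. -/
lemma exists_measurePreserving_Ioo {n : ℕ} (hn : 0 < n) {Ω : Set (Eucl n)} (hv : volume Ω = 1) :
    ∃ T : Eucl n → ℝ, MeasurePreserving T (volume.restrict Ω) (volume.restrict (Ioo (0 : ℝ) 1)) := by
  set e : Eucl n → ℝ := fun x => x ⟨0, hn⟩ with he
  have hem : Measurable e := by fun_prop
  have : IsProbabilityMeasure (volume.restrict Ω) := ⟨by simp [hv]⟩
  have : IsProbabilityMeasure ((volume.restrict Ω).map e) :=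
    Measure.isProbabilityMeasure_map hem.aemeasurable
  have : NullSingletonClass ((volume.restrict Ω).map e) := by
    refine ⟨fun t => ?_⟩
    rw [Measure.map_apply hem (measurableSet_singleton t)]
    refine le_bot_iff.1 ((Measure.restrict_apply_le _ _).trans (le_of_eq ?_))
    have hmp := PiLp.volume_preserving_ofLp (Fin n)
    have hpre : e ⁻¹' {t} = (WithLp.ofLp : Eucl n → (Fin n → ℝ)) ⁻¹'
        (Function.eval (⟨0, hn⟩ : Fin n) ⁻¹' {t}) := rfl
    have hms : MeasurableSet (Function.eval (⟨0, hn⟩ : Fin n) ⁻¹' {t} : Set (Fin n → ℝ)) :=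
      measurable_pi_apply (⟨0, hn⟩ : Fin n) (measurableSet_singleton t)
    rw [hpre, hmp.measure_preimage hms.nullMeasurableSet]
    exact Measure.pi_eval_preimage_null _ Real.volume_singleton
  exact ⟨_, (measurePreserving_cdf ((volume.restrict Ω).map e)).comp ⟨hem, rfl⟩⟩

end UniformVariable

/-! ### The norm of the slope of the rearrangement -/

section RearrangedGradient

variable {β : Type*} [MeasurableSpace β] {μ : Measure β} {F : β → ℝ} {w : β → ℝ≥0∞} {α : ℝ}
  {C : ℝ≥0}

lemma measurableSet_partitionBand (hF : Measurable F) (N j : ℕ) :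
    MeasurableSet (partitionBand μ F N j) := by
  rw [partitionBand]
  split_ifs
  exacts [MeasurableSet.empty, measurableSet_levelBand hF _ _]

lemma pairwise_disjoint_partitionBand [IsFiniteMeasure μ] (hF : Measurable F) (N : ℕ) :
    Pairwise fun i j => Disjoint (partitionBand μ F N i) (partitionBand μ F N j) := by
  refine (pairwise_disjoint_on _).2 ?_
  intro i j hij
  simp only [partitionBand]
  split_ifs
  · simp
  · simp
  · simp
  · refine disjoint_levelBand hF (by positivity) ?_
    gcongr
    exact_mod_cast hij

lemma measure_partitionBand_le [IsProbabilityMeasure μ] (hF : Measurable F) {N j : ℕ}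
    (hj : j < N + 1) : μ (partitionBand μ F N j) ≤ ENNReal.ofReal (1 / ((N : ℝ) + 1)) := by
  rw [partitionBand]
  split_ifs with h0
  · simp
  · have hjp : (0 : ℝ) < j := by exact_mod_cast Nat.pos_of_ne_zero h0
    have hjN : (j : ℝ) ≤ (N : ℝ) + 1 := by exact_mod_cast hj.le
    refine (measure_levelBand_le hF (by positivity) ?_ ?_).trans (le_of_eq ?_)
    · gcongr
      linarith
    · exact (div_le_one (by positivity)).2 hjN
    · congr 1
      ring

lemma ae_differentiableAt_rearrangement [IsProbabilityMeasure μ] (hF : Measurable F)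
    (hα : 0 ≤ α) (hw : ∫⁻ x, w x ∂μ ≠ ⊤)
    (hgap : ∀ t₁ t₂ : ℝ, 0 ≤ t₁ → t₁ < t₂ → ENNReal.ofReal (t₂ - t₁) * μ {x | t₂ ≤ |F x|} ^ α ≤
      C * ∫⁻ x in {x | t₁ < |F x| ∧ |F x| < t₂}, w x ∂μ) :
    ∀ᵐ s ∂volume.restrict (Ioo (0 : ℝ) 1), DifferentiableAt ℝ (rearrangement μ F) s := by
  have h : ∀ k : ℕ, ∀ᵐ s : ℝ, s ∈ uIcc (1 / ((k : ℝ) + 1)) 1 →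
      DifferentiableAt ℝ (rearrangement μ F) s := fun k =>
    (absolutelyContinuousOnInterval_rearrangement hF hα hw hgap (by positivity)
      ((div_le_one (by positivity)).2 (by
        linarith [(Nat.cast_nonneg k : (0 : ℝ) ≤ k)]))).ae_differentiableAt
  rw [ae_restrict_iff' measurableSet_Ioo]
  filter_upwards [ae_all_iff.2 h] with s hs hs01
  obtain ⟨k, hk⟩ := exists_nat_one_div_lt hs01.1
  exact hs k (mem_uIcc_of_le hk.le hs01.2.le)

/-- The modulus of the gradient of the spherical rearrangement, up to a constant and as a function
of the measure of the ball. -/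
def rearrangedSlope (μ : Measure β) (F : β → ℝ) (α s : ℝ) : ℝ≥0∞ :=
  ENNReal.ofReal s ^ α * ENNReal.ofReal (-deriv (rearrangement μ F) s)

lemma measurable_rearrangedSlope : Measurable (rearrangedSlope μ F α) :=
  (ENNReal.measurable_ofReal.pow_const α).mul (measurable_deriv _).neg.ennreal_ofReal

/-- Almost everywhere the slope is at most C times the lower limit of the band averages. Each
average has norm at most that of w, and the Fatou property passes this to the lower limit. -/
lemma RINorm.rearrangedSlope_le [IsProbabilityMeasure μ] (X : RINorm μ) {T : β → ℝ}
    (hT : MeasurePreserving T μ (volume.restrict (Ioo (0 : ℝ) 1))) (hF : Measurable F)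
    (hwm : Measurable w) (hα : 0 ≤ α) (hw : ∫⁻ x, w x ∂μ ≠ ⊤)
    (hgap : ∀ t₁ t₂ : ℝ, 0 ≤ t₁ → t₁ < t₂ → ENNReal.ofReal (t₂ - t₁) * μ {x | t₂ ≤ |F x|} ^ α ≤
      C * ∫⁻ x in {x | t₁ < |F x| ∧ |F x| < t₂}, w x ∂μ) :
    X.toFun (fun x => rearrangedSlope μ F α (T x)) ≤ C * X.toFun w := by
  have hbm : ∀ N : ℕ, Measurable fun x => bandAverage μ (partitionBand μ F) w N (T x) := fun N =>
    ((measurable_from_top (f := fun j : ℕ => ∫⁻ y in partitionBand μ F N j, w y ∂μ)).comp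
      (Nat.measurable_floor.comp (hT.measurable.mul_const _))).const_mul _
  have hb : ∀ N : ℕ, X.toFun (fun x => bandAverage μ (partitionBand μ F) w N (T x)) ≤
      X.toFun w := fun N => by
    have h := X.partition_average_le hT hwm N.succ_pos (measurableSet_partitionBand hF N)
      (pairwise_disjoint_partitionBand hF N) fun j hj => by
        simpa using measure_partitionBand_le hF hj
    simpa [bandAverage] using h
  have hlm : AEMeasurable
      (fun x => liminf (fun N => bandAverage μ (partitionBand μ F) w N (T x)) atTop) μ :=
    (Measurable.liminf hbm).aemeasurable
  calc X.toFun (fun x => rearrangedSlope μ F α (T x))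
      ≤ X.toFun (fun x => C * liminf (fun N => bandAverage μ (partitionBand μ F) w N (T x))
          atTop) := by
        refine X.mono _ _ (measurable_rearrangedSlope.comp hT.measurable).aemeasurable
          (hlm.const_mul _) ?_
        have hae := hT.quasiMeasurePreserving.ae
          ((ae_differentiableAt_rearrangement hF hα hw hgap).and
            (ae_restrict_mem measurableSet_Ioo))
        filter_upwards [hae] with x hx
        exact rpow_mul_neg_deriv_le_liminf hF hα hgap hx.2.1 hx.2.2 hx.1
    _ = C * X.toFun (fun x => liminf (fun N => bandAverage μ (partitionBand μ F) w N (T x))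
          atTop) := X.smul _ _ hlm
    _ ≤ C * X.toFun w := by
        gcongr
        exact X.liminf_le (fun N => (hbm N).aemeasurable) hb

end RearrangedGradient

end PolyaSzego

end

noncomputable section

namespace PolyaSzego

open Filter Topology

/-! ### Radial functions on the ball of unit volume -/

section Ball

/-- The measure of the ball of radius `‖x‖`. -/
def ballMeasure {n : ℕ} (x : Eucl n) : ℝ := unitBallVolume n * ‖x‖ ^ n

lemma unitBallVolume_pos (n : ℕ) : 0 < unitBallVolume n :=
  ENNReal.toReal_pos (Metric.measure_ball_pos _ _ one_pos).ne' measure_ball_lt_top.ne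

lemma ofReal_unitBallVolume (n : ℕ) :
    ENNReal.ofReal (unitBallVolume n) = volume (Metric.ball (0 : Eucl n) 1) :=
  ENNReal.ofReal_toReal measure_ball_lt_top.ne

lemma ballMeasure_nonneg {n : ℕ} (x : Eucl n) : 0 ≤ ballMeasure x :=
  mul_nonneg (unitBallVolume_pos n).le (by positivity)

lemma continuous_ballMeasure {n : ℕ} : Continuous (ballMeasure (n := n)) := by
  unfold ballMeasure
  fun_prop

lemma unitBallVolume_mul_rpow_pow {n : ℕ} (hn : n ≠ 0) {a : ℝ} (ha : 0 ≤ a) :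
    unitBallVolume n * ((a / unitBallVolume n) ^ (1 / (n : ℝ))) ^ n = a := by
  have hγ := unitBallVolume_pos n
  rw [one_div, Real.rpow_inv_natCast_pow (by positivity) hn]
  field_simp

lemma ballMeasure_le_iff {n : ℕ} (hn : n ≠ 0) {a : ℝ} (ha : 0 ≤ a) (x : Eucl n) :
    ballMeasure x ≤ a ↔ ‖x‖ ≤ (a / unitBallVolume n) ^ (1 / (n : ℝ)) := by
  have hγ := unitBallVolume_pos n
  conv_lhs => rw [← unitBallVolume_mul_rpow_pow hn ha, ballMeasure]
  rw [mul_le_mul_iff_right₀ hγ, pow_le_pow_iff_left₀ (norm_nonneg x) (by positivity) hn]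

lemma volume_ballMeasure_le {n : ℕ} (hn : n ≠ 0) {a : ℝ} (ha : 0 ≤ a) :
    volume {x : Eucl n | ballMeasure x ≤ a} = ENNReal.ofReal a := by
  have : NeZero n := ⟨hn⟩
  have hγ := unitBallVolume_pos n
  have he : {x : Eucl n | ballMeasure x ≤ a} =
      Metric.closedBall 0 ((a / unitBallVolume n) ^ (1 / (n : ℝ))) := by
    ext x
    rw [mem_ofPred_eq, ballMeasure_le_iff hn ha, mem_closedBall_zero_iff]
  rw [he, Measure.addHaar_closedBall _ _ (by positivity), ← ofReal_unitBallVolume,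
    ← ENNReal.ofReal_mul (by positivity), finrank_euclideanSpace_fin, mul_comm,
    unitBallVolume_mul_rpow_pow hn ha]

lemma mem_unitVolumeBall_iff {n : ℕ} (hn : n ≠ 0) (x : Eucl n) :
    x ∈ unitVolumeBall n ↔ ballMeasure x < 1 := by
  have hγ := unitBallVolume_pos n
  have he : unitBallVolume n ^ (-(1 / (n : ℝ))) = (1 / unitBallVolume n) ^ (1 / (n : ℝ)) := by
    rw [Real.rpow_neg hγ.le, one_div (unitBallVolume n), Real.inv_rpow hγ.le]
  have h1 := unitBallVolume_mul_rpow_pow hn zero_le_one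
  rw [unitVolumeBall, mem_ball_zero_iff, he]
  conv_rhs => rw [← h1, ballMeasure]
  rw [mul_lt_mul_iff_right₀ hγ, pow_lt_pow_iff_left₀ (norm_nonneg x) (by positivity) hn]

lemma measurableSet_unitVolumeBall (n : ℕ) : MeasurableSet (unitVolumeBall n) :=
  Metric.isOpen_ball.measurableSet

lemma volume_unitVolumeBall {n : ℕ} (hn : n ≠ 0) : volume (unitVolumeBall n) = 1 := by
  have : NeZero n := ⟨hn⟩
  have hγ := unitBallVolume_pos n
  rw [unitVolumeBall, Measure.addHaar_ball _ _ (by positivity), ← ofReal_unitBallVolume,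
    ← ENNReal.ofReal_mul (by positivity), finrank_euclideanSpace_fin, Real.rpow_neg hγ.le,
    ← Real.inv_rpow hγ.le, mul_comm, ← one_div, unitBallVolume_mul_rpow_pow hn zero_le_one,
    ENNReal.ofReal_one]

lemma measurePreserving_ballMeasure {n : ℕ} (hn : n ≠ 0) :
    MeasurePreserving (ballMeasure (n := n)) (volume.restrict (unitVolumeBall n))
      (volume.restrict (Ioo (0 : ℝ) 1)) := by
  have : IsProbabilityMeasure (volume.restrict (unitVolumeBall n)) :=
    ⟨by simp [volume_unitVolumeBall hn]⟩
  refine measurePreserving_Ioo_of_measure_le continuous_ballMeasure.measurable fun a ha ha1 => ?_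
  rw [Measure.restrict_apply' (measurableSet_unitVolumeBall n), inter_eq_left.2,
    volume_ballMeasure_le hn ha.le]
  exact fun x (hx : ballMeasure x ≤ a) => (mem_unitVolumeBall_iff hn x).2 (hx.trans_lt ha1)

/-- The gradient of `x ↦ ∫ t in ballMeasure x..1, b t`. -/
def radialField {n : ℕ} (b : ℝ → ℝ) (x : Eucl n) : Eucl n :=
  (-b (ballMeasure x) * (unitBallVolume n * (n * ‖x‖ ^ ((n : ℝ) - 2)))) • x

lemma hasFDerivAt_ballMeasure {n : ℕ} (hn : 2 ≤ n) (x : Eucl n) :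
    HasFDerivAt ballMeasure ((unitBallVolume n * (n * ‖x‖ ^ ((n : ℝ) - 2))) • innerSL ℝ x) x := by
  have h := (hasFDerivAt_norm_rpow x (p := n) (by exact_mod_cast hn)).const_mul (unitBallVolume n)
  simp only [Real.rpow_natCast] at h
  rw [smul_smul] at h
  exact h

lemma continuous_radialField {n : ℕ} (hn : 2 ≤ n) {b : ℝ → ℝ} (hb : Continuous b) :
    Continuous (radialField (n := n) b) := by
  have h2 : (0 : ℝ) ≤ (n : ℝ) - 2 := sub_nonneg.2 (by exact_mod_cast hn)
  refine Continuous.smul (((hb.comp continuous_ballMeasure).neg).mul ?_) continuous_id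
  exact continuous_const.mul (continuous_const.mul
    (continuous_norm.rpow_const fun _ => Or.inr h2))

lemma measurable_radialField {n : ℕ} {b : ℝ → ℝ} (hb : Measurable b) :
    Measurable (radialField (n := n) b) := by
  refine Measurable.smul (((hb.comp continuous_ballMeasure.measurable).neg).mul ?_) measurable_id
  exact measurable_const.mul (measurable_const.mul (measurable_norm.pow_const _))

lemma radialField_sub {n : ℕ} (b b' : ℝ → ℝ) (x : Eucl n) :
    radialField b x - radialField b' x = radialField (fun t => b t - b' t) x := by
  simp only [radialField]
  rw [← sub_smul]
  congr 1
  ring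

/-- With s = γ_n |x|^n, the radial derivative is ds/d|x| = n γ_n |x|^{n-1} = n γ_n^{1/n} s^{1-1/n}.
Here the exponent of the isoperimetric class meets the geometry of the ball. At the origin both
sides vanish. -/
lemma norm_radialField {n : ℕ} (hn : 2 ≤ n) (b : ℝ → ℝ) (x : Eucl n) :
    ‖radialField b x‖ = n * unitBallVolume n ^ (1 / (n : ℝ)) *
      (ballMeasure x ^ (1 - 1 / (n : ℝ)) * |b (ballMeasure x)|) := by
  have hγ := unitBallVolume_pos n
  have hn0 : (n : ℝ) ≠ 0 := by positivity
  have hn1 : 1 - 1 / (n : ℝ) ≠ 0 := by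
    have : 1 / (n : ℝ) ≤ 1 / 2 := by
      gcongr
      exact_mod_cast hn
    linarith
  have hkey : ‖x‖ ^ ((n : ℝ) - 2) * ‖x‖ * unitBallVolume n =
      unitBallVolume n ^ (1 / (n : ℝ)) * ballMeasure x ^ (1 - 1 / (n : ℝ)) := by
    rcases (norm_nonneg x).eq_or_lt with h0 | h0
    · rw [ballMeasure, ← h0, zero_pow (by omega), mul_zero (unitBallVolume n),
        Real.zero_rpow hn1]
      simp
    · rw [ballMeasure, Real.mul_rpow hγ.le (by positivity), ← Real.rpow_natCast ‖x‖ n,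
        ← Real.rpow_mul h0.le, ← mul_assoc, ← Real.rpow_add hγ]
      have e1 : 1 / (n : ℝ) + (1 - 1 / (n : ℝ)) = 1 := by ring
      have e2 : (n : ℝ) * (1 - 1 / (n : ℝ)) = ((n : ℝ) - 2) + 1 := by
        field_simp
        ring
      rw [e1, e2, Real.rpow_add h0, Real.rpow_one, Real.rpow_one]
      ring
  rw [radialField, norm_smul, Real.norm_eq_abs, abs_mul, abs_neg,
    abs_of_nonneg (a := unitBallVolume n * (n * ‖x‖ ^ ((n : ℝ) - 2))) (by positivity)]
  calc |b (ballMeasure x)| * (unitBallVolume n * (n * ‖x‖ ^ ((n : ℝ) - 2))) * ‖x‖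
      = |b (ballMeasure x)| * n * (‖x‖ ^ ((n : ℝ) - 2) * ‖x‖ * unitBallVolume n) := by ring
    _ = _ := by
        rw [hkey]
        ring

lemma enorm_radialField {n : ℕ} (hn : 2 ≤ n) (b : ℝ → ℝ) (x : Eucl n) :
    ‖radialField b x‖ₑ = ENNReal.ofReal (n * unitBallVolume n ^ (1 / (n : ℝ))) *
      (ENNReal.ofReal (ballMeasure x) ^ (1 - 1 / (n : ℝ)) * ‖b (ballMeasure x)‖ₑ) := by
  have hγ := unitBallVolume_pos n
  have hn1 : 0 ≤ 1 - 1 / (n : ℝ) := by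
    have : 1 / (n : ℝ) ≤ 1 / 2 := by
      gcongr
      exact_mod_cast hn
    linarith
  rw [← ofReal_norm, norm_radialField hn, ENNReal.ofReal_mul (by positivity),
    ENNReal.ofReal_mul (Real.rpow_nonneg (ballMeasure_nonneg x) _),
    ENNReal.ofReal_rpow_of_nonneg (ballMeasure_nonneg x) hn1, ← Real.norm_eq_abs, ofReal_norm]

lemma integral_radial_mul_fderiv {n : ℕ} (hn : 2 ≤ n) {b : ℝ → ℝ} (hb : Continuous b) (K : ℝ)
    {φ : Eucl n → ℝ} (hφ : ContDiff ℝ ∞ φ) (hφc : HasCompactSupport φ) (i : Fin n) :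
    ∫ x, (K + ∫ t in ballMeasure x..1, b t) * fderiv ℝ φ x (EuclideanSpace.single i 1) =
      -∫ x, radialField b x i * φ x := by
  have hu : ∀ x : Eucl n, HasFDerivAt (fun x => K + ∫ t in ballMeasure x..1, b t)
      (innerSL ℝ (radialField b x)) x := by
    intro x
    have h1 : HasDerivAt (fun s => ∫ t in s..1, b t) (-b (ballMeasure x)) (ballMeasure x) :=
      intervalIntegral.integral_hasDerivAt_left (hb.intervalIntegrable _ _)
        (hb.stronglyMeasurableAtFilter _ _) hb.continuousAt
    have h2 := (h1.comp_hasFDerivAt x (hasFDerivAt_ballMeasure hn x)).const_add K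
    rw [smul_smul] at h2
    rw [radialField, map_smul]
    exact h2
  have huc : Continuous fun x : Eucl n => K + ∫ t in ballMeasure x..1, b t :=
    continuous_iff_continuousAt.2 fun x => (hu x).continuousAt
  have hφ1 : Continuous fun x => fderiv ℝ φ x (EuclideanSpace.single i 1) :=
    (hφ.continuous_fderiv (by simp)).clm_apply continuous_const
  have hφs : HasCompactSupport fun x => fderiv ℝ φ x (EuclideanSpace.single i 1) :=
    hφc.fderiv_apply (𝕜 := ℝ) _
  have hGi : Continuous fun x : Eucl n => radialField b x i :=
    (continuous_apply i).comp ((PiLp.continuous_ofLp 2 _).comp (continuous_radialField hn hb))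
  have hfd : ∀ x, fderiv ℝ (fun x => K + ∫ t in ballMeasure x..1, b t) x
      (EuclideanSpace.single i 1) = radialField b x i := fun x => by
    rw [(hu x).fderiv, innerSL_apply_single]
  have h := integral_mul_fderiv_eq_neg_fderiv_mul_of_integrable (μ := (volume : Measure (Eucl n)))
    (f := fun x => K + ∫ t in ballMeasure x..1, b t) (g := φ) (v := EuclideanSpace.single i 1)
    (by
      simp only [hfd]
      exact (hGi.mul hφ.continuous).integrable_of_hasCompactSupport hφc.mul_left)
    ((huc.mul hφ1).integrable_of_hasCompactSupport hφs.mul_left)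
    ((huc.mul hφ.continuous).integrable_of_hasCompactSupport hφc.mul_left)
    (fun x _ => (hu x).differentiableAt) (fun x _ => hφ.differentiable (by simp) x)
  simp only [hfd] at h
  exact h

/-- By Tonelli the left side is ∫ t g(t) dt, and t ≤ t^α on (0, 1). -/
lemma lintegral_tail_le {g : ℝ → ℝ≥0∞} (hg : Measurable g) {α : ℝ} (hα1 : α ≤ 1) :
    ∫⁻ s in Ioo (0 : ℝ) 1, ∫⁻ t in Ioo s 1, g t ≤
      ∫⁻ t in Ioo (0 : ℝ) 1, ENNReal.ofReal t ^ α * g t := by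
  have hms : MeasurableSet {p : ℝ × ℝ | p.1 < p.2} := measurableSet_lt measurable_fst measurable_snd
  calc ∫⁻ s in Ioo (0 : ℝ) 1, ∫⁻ t in Ioo s 1, g t
      ≤ ∫⁻ s in Ioo (0 : ℝ) 1, (∫⁻ t in Ioo (0 : ℝ) 1, if s < t then g t else 0) := by
        refine setLIntegral_mono' measurableSet_Ioo fun s hs => ?_
        have he : (fun t => if s < t then g t else 0) = (Ioi s).indicator g := by
          ext t
          simp [indicator_apply]
        rw [he, lintegral_indicator measurableSet_Ioi, Measure.restrict_restrict measurableSet_Ioi]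
        exact lintegral_mono_set fun t ht => ⟨ht.1, hs.1.trans ht.1, ht.2⟩
    _ = ∫⁻ t in Ioo (0 : ℝ) 1, (∫⁻ s in Ioo (0 : ℝ) 1, if s < t then g t else 0) := by
        refine lintegral_lintegral_swap (Measurable.aemeasurable ?_)
        exact Measurable.ite hms (hg.comp measurable_snd) measurable_const
    _ ≤ _ := by
        refine setLIntegral_mono' measurableSet_Ioo fun t ht => ?_
        have he : (fun s => if s < t then g t else 0) = (Iio t).indicator fun _ => g t := by
          ext s
          simp [indicator_apply]
        rw [he, lintegral_indicator_const measurableSet_Iio,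
          Measure.restrict_apply measurableSet_Iio, mul_comm]
        gcongr
        calc volume (Iio t ∩ Ioo 0 1) ≤ volume (Ioo 0 t) :=
              measure_mono fun s hs => ⟨hs.2.1, hs.1⟩
          _ = ENNReal.ofReal t ^ (1 : ℝ) := by simp
          _ ≤ ENNReal.ofReal t ^ α :=
              ENNReal.rpow_le_rpow_of_exponent_ge (by simpa using ht.2.le) hα1

end Ball

end PolyaSzego

end

/-! ### Weak gradients of radial functions -/

noncomputable section

namespace PolyaSzego

open Filter Topology

lemma intervalIntegrable_of_lintegral_rpow_mul {b : ℝ → ℝ} (hb : Measurable b) {α : ℝ} (hα : 0 ≤ α)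
    (hint : ∫⁻ t in Ioo (0 : ℝ) 1, ENNReal.ofReal t ^ α * ‖b t‖ₑ ≠ ⊤) {s : ℝ} (hs : 0 < s)
    (hs1 : s ≤ 1) : IntervalIntegrable b volume s 1 := by
  rw [intervalIntegrable_iff_integrableOn_Ioo_of_le hs1]
  refine ⟨hb.aestronglyMeasurable, ?_⟩
  have h : ENNReal.ofReal s ^ α * ∫⁻ t in Ioo s 1, ‖b t‖ₑ ≤
      ∫⁻ t in Ioo (0 : ℝ) 1, ENNReal.ofReal t ^ α * ‖b t‖ₑ := by
    rw [← lintegral_const_mul _ hb.enorm]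
    calc ∫⁻ t in Ioo s 1, ENNReal.ofReal s ^ α * ‖b t‖ₑ
        ≤ ∫⁻ t in Ioo s 1, ENNReal.ofReal t ^ α * ‖b t‖ₑ := by
          refine setLIntegral_mono' measurableSet_Ioo fun t ht => ?_
          gcongr
          exact ht.1.le
      _ ≤ _ := lintegral_mono_set (Ioo_subset_Ioo_left hs.le)
  have h0 : ENNReal.ofReal s ^ α ≠ 0 := by
    simp [ENNReal.rpow_eq_zero_iff, hs, not_lt.2 hα]
  exact ENNReal.lt_top_of_mul_ne_top_right (h.trans_lt (lt_top_iff_ne_top.2 hint)).ne h0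

lemma exists_continuous_lintegral_rpow_mul_sub_le {b : ℝ → ℝ} (hb : Measurable b) {α : ℝ}
    (hα : 0 ≤ α) (hint : ∫⁻ t in Ioo (0 : ℝ) 1, ENNReal.ofReal t ^ α * ‖b t‖ₑ ≠ ⊤) {ε : ℝ≥0∞}
    (hε : ε ≠ 0) : ∃ g : ℝ → ℝ, Continuous g ∧
      ∫⁻ t in Ioo (0 : ℝ) 1, ENNReal.ofReal t ^ α * ‖b t - g t‖ₑ ≤ ε := by
  have hm : Measurable fun t => ENNReal.ofReal t ^ α := ENNReal.measurable_ofReal.pow_const α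
  set ν := (volume.restrict (Ioo (0 : ℝ) 1)).withDensity fun t => ENNReal.ofReal t ^ α with hν
  have hν1 : ∫⁻ t in Ioo (0 : ℝ) 1, ENNReal.ofReal t ^ α ≠ ⊤ := by
    refine ne_top_of_le_ne_top (b := ∫⁻ t in Ioo (0 : ℝ) 1, 1) (by simp) ?_
    exact setLIntegral_mono' measurableSet_Ioo fun t ht =>
      ENNReal.rpow_le_one (by simpa using ht.2.le) hα
  have : IsFiniteMeasure ν := isFiniteMeasure_withDensity hν1
  have heq : ∀ f : ℝ → ℝ≥0∞, Measurable f →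
      ∫⁻ t, f t ∂ν = ∫⁻ t in Ioo (0 : ℝ) 1, ENNReal.ofReal t ^ α * f t := fun f hf =>
    lintegral_withDensity_eq_lintegral_mul _ hm hf
  have hbi : Integrable b ν := by
    refine ⟨hb.aestronglyMeasurable, ?_⟩
    rw [HasFiniteIntegral, heq _ hb.enorm]
    exact lt_top_iff_ne_top.2 hint
  obtain ⟨g, -, hg, hgc, -⟩ := hbi.exists_hasCompactSupport_lintegral_sub_le hε
  exact ⟨g, hgc, by
    have hm' : Measurable fun t => ‖b t - g t‖ₑ := (hb.sub hgc.measurable).enorm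
    rwa [heq _ hm'] at hg⟩

lemma lintegral_enorm_integral_sub_le {b g : ℝ → ℝ} (hb : Measurable b) (hg : Measurable g)
    {α : ℝ} (hα1 : α ≤ 1) (hbi : ∀ s ∈ Ioo (0 : ℝ) 1, IntervalIntegrable b volume s 1)
    (hgi : ∀ s ∈ Ioo (0 : ℝ) 1, IntervalIntegrable g volume s 1) :
    ∫⁻ s in Ioo (0 : ℝ) 1, ‖(∫ t in s..1, b t) - ∫ t in s..1, g t‖ₑ ≤
      ∫⁻ t in Ioo (0 : ℝ) 1, ENNReal.ofReal t ^ α * ‖b t - g t‖ₑ := by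
  refine le_trans (setLIntegral_mono' measurableSet_Ioo fun s hs => ?_)
    (lintegral_tail_le (hb.sub hg).enorm hα1)
  rw [← intervalIntegral.integral_sub (hbi s hs) (hgi s hs),
    intervalIntegral.integral_of_le hs.2.le, ← restrict_Ioo_eq_restrict_Ioc]
  exact enorm_integral_le_lintegral_enorm _

lemma continuous_integral_tail {g : ℝ → ℝ} (hg : Continuous g) :
    Continuous fun s : ℝ => ∫ t in s..1, g t :=
  continuous_iff_continuousAt.2 fun _ => (intervalIntegral.integral_hasDerivAt_left
    (hg.intervalIntegrable _ _) (hg.stronglyMeasurableAtFilter _ _)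
    hg.continuousAt).continuousAt

/-- A function of `‖x‖` with an integrable radial derivative has a weak gradient on the ball. -/
theorem hasWeakGradient_radial {n : ℕ} (hn : 2 ≤ n) {r b : ℝ → ℝ} {K : ℝ} (hb : Measurable b)
    (hr : ∀ s ∈ Ioo (0 : ℝ) 1, r s = K + ∫ t in s..1, b t)
    (hrm : AEMeasurable r (volume.restrict (Ioo (0 : ℝ) 1)))
    (hint : ∫⁻ t in Ioo (0 : ℝ) 1, ENNReal.ofReal t ^ (1 - 1 / (n : ℝ)) * ‖b t‖ₑ ≠ ⊤) :
    HasWeakGradient (unitVolumeBall n) (fun x => r (ballMeasure x)) (radialField b) := by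
  have hn0 : n ≠ 0 := by omega
  have hα : 0 ≤ 1 - 1 / (n : ℝ) := by
    have : 1 / (n : ℝ) ≤ 1 / 2 := by
      gcongr
      exact_mod_cast hn
    linarith
  have hα1 : 1 - 1 / (n : ℝ) ≤ 1 := by
    have : 0 ≤ 1 / (n : ℝ) := by positivity
    linarith
  set α := 1 - 1 / (n : ℝ) with hαdef
  set B := unitVolumeBall n with hB
  have hmp := measurePreserving_ballMeasure hn0
  have hbi : ∀ s ∈ Ioo (0 : ℝ) 1, IntervalIntegrable b volume s 1 := fun s hs =>
    intervalIntegrable_of_lintegral_rpow_mul hb hα hint hs.1 hs.2.le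
  -- The L¹ norm of the field on the ball is a weighted L¹ norm on (0, 1), in which continuous
  -- functions are dense.
  have hGle : ∀ g : ℝ → ℝ, Measurable g → ∫⁻ x in B, ‖radialField (n := n) g x‖ₑ =
      ENNReal.ofReal (n * unitBallVolume n ^ (1 / (n : ℝ))) *
        ∫⁻ t in Ioo (0 : ℝ) 1, ENNReal.ofReal t ^ α * ‖g t‖ₑ := by
    intro g hg
    simp_rw [enorm_radialField hn]
    have hm : Measurable fun t => ENNReal.ofReal t ^ α * ‖g t‖ₑ :=
      (ENNReal.measurable_ofReal.pow_const α).mul hg.enorm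
    rw [← hmp.lintegral_comp hm]
    exact lintegral_const_mul' _ _ ENNReal.ofReal_ne_top
  have hu : IntegrableOn (fun x : Eucl n => r (ballMeasure x)) B := by
    refine (hmp.integrable_comp hrm.aestronglyMeasurable).2 ?_
    refine ⟨hrm.aestronglyMeasurable, ?_⟩
    have h0 := lintegral_enorm_integral_sub_le hb measurable_zero hα1 hbi
      fun s _ => intervalIntegrable_const
    simp only [Pi.zero_apply, intervalIntegral.integral_zero, sub_zero] at h0
    calc ∫⁻ s in Ioo (0 : ℝ) 1, ‖r s‖ₑ
        ≤ ∫⁻ s in Ioo (0 : ℝ) 1, (‖K‖ₑ + ‖∫ t in s..1, b t‖ₑ) := by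
          refine setLIntegral_mono' measurableSet_Ioo fun s hs => ?_
          rw [hr s hs]
          exact enorm_add_le _ _
      _ = ‖K‖ₑ + ∫⁻ s in Ioo (0 : ℝ) 1, ‖∫ t in s..1, b t‖ₑ := by
          rw [lintegral_add_left measurable_const]
          simp
      _ < ⊤ := ENNReal.add_lt_top.2 ⟨enorm_lt_top, h0.trans_lt (lt_top_iff_ne_top.2 hint)⟩
  have hG : IntegrableOn (radialField (n := n) b) B := by
    refine ⟨(measurable_radialField hb).aestronglyMeasurable, ?_⟩
    rw [HasFiniteIntegral, hGle b hb]
    exact ENNReal.mul_lt_top ENNReal.ofReal_lt_top (lt_top_iff_ne_top.2 hint)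
  refine ⟨hu.locallyIntegrableOn, hG.locallyIntegrableOn, fun φ hφ hφc hφB i => ?_⟩
  have hφ1 : Continuous fun x => fderiv ℝ φ x (EuclideanSpace.single i 1) :=
    (hφ.continuous_fderiv (by simp)).clm_apply continuous_const
  obtain ⟨D₀, hD₀⟩ := hφc.exists_bound_of_continuous hφ.continuous
  obtain ⟨D₁, hD₁⟩ := (hφc.fderiv_apply (𝕜 := ℝ) (EuclideanSpace.single i 1)).exists_bound_of_continuous
    hφ1
  set D : ℝ≥0∞ := ENNReal.ofReal D₁ + ENNReal.ofReal D₀ *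
    ENNReal.ofReal (n * unitBallVolume n ^ (1 / (n : ℝ))) with hD
  have hDt : D ≠ ⊤ := by
    refine ENNReal.add_ne_top.2 ⟨ENNReal.ofReal_ne_top, ENNReal.mul_ne_top ?_ ?_⟩ <;>
      exact ENNReal.ofReal_ne_top
  have hcoord : ∀ v : Eucl n, ‖v i‖ₑ ≤ ‖v‖ₑ := fun v => by
    rw [← ofReal_norm, ← ofReal_norm]
    exact ENNReal.ofReal_le_ofReal (PiLp.norm_apply_le v i)
  have hGi : ∀ {g : Eucl n → Eucl n}, IntegrableOn g B → IntegrableOn (fun x => g x i) B :=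
    fun hg => hg.norm.mono ((EuclideanSpace.proj (𝕜 := ℝ) i).continuous.comp_aestronglyMeasurable
      hg.aestronglyMeasurable) (ae_of_all _ fun x => by
        simpa using PiLp.norm_apply_le (_ : Eucl n) i)
  have hGφ : ∀ {g : Eucl n → Eucl n}, IntegrableOn g B → IntegrableOn (fun x => g x i * φ x) B :=
    fun hg => (hGi hg).mul_bdd (c := D₀) hφ.continuous.aestronglyMeasurable (ae_of_all _ hD₀)
  have huφ : ∀ {u : Eucl n → ℝ}, IntegrableOn u B → IntegrableOn
      (fun x => u x * fderiv ℝ φ x (EuclideanSpace.single i 1)) B :=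
    fun hg => hg.mul_bdd (c := D₁) hφ1.aestronglyMeasurable (ae_of_all _ hD₁)
  -- The function may be singular at the origin, which test functions may see. Replacing b by a
  -- continuous g makes it C¹ on the whole space, where integration by parts holds; the weighted
  -- distance of b and g bounds the errors in the function and in the field alike.
  have key : ∀ ε : ℝ≥0∞, ε ≠ 0 →
      ‖(∫ x in B, r (ballMeasure x) * fderiv ℝ φ x (EuclideanSpace.single i 1)) +
        ∫ x in B, radialField b x i * φ x‖ₑ ≤ D * ε := by
    intro ε hε
    obtain ⟨g, hgc, hg⟩ := exists_continuous_lintegral_rpow_mul_sub_le hb hα hint hε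
    have hcl := integral_radial_mul_fderiv hn hgc K hφ hφc i
    have hφ0 : ∀ x, x ∉ B → φ x = 0 := fun x hx => image_eq_zero_of_notMem_tsupport
      fun h => hx (hφB h)
    have hφ10 : ∀ x, x ∉ B → fderiv ℝ φ x (EuclideanSpace.single i 1) = 0 := fun x hx => by
      rw [image_eq_zero_of_notMem_tsupport (f := fderiv ℝ φ)
        fun h => hx (hφB (tsupport_fderiv_subset ℝ h))]
      rfl
    rw [← setIntegral_eq_integral_of_forall_compl_eq_zero (s := B)
        (fun x hx => by rw [hφ10 x hx, mul_zero]),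
      ← setIntegral_eq_integral_of_forall_compl_eq_zero (s := B)
        (f := fun x => radialField g x i * φ x) (fun x hx => by rw [hφ0 x hx, mul_zero])] at hcl
    have htail := continuous_integral_tail hgc
    have hugc : Continuous fun x : Eucl n => K + ∫ t in ballMeasure x..1, g t :=
      continuous_const.add (htail.comp continuous_ballMeasure)
    have hug : IntegrableOn (fun x : Eucl n => K + ∫ t in ballMeasure x..1, g t) B :=
      (hugc.continuousOn.integrableOn_compact (isCompact_closedBall 0 _)).mono_set
        Metric.ball_subset_closedBall
    have hGg : IntegrableOn (radialField (n := n) g) B :=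
      ((continuous_radialField hn hgc).continuousOn.integrableOn_compact
        (isCompact_closedBall 0 _)).mono_set Metric.ball_subset_closedBall
    have hsplit : (∫ x in B, r (ballMeasure x) * fderiv ℝ φ x (EuclideanSpace.single i 1)) +
        ∫ x in B, radialField b x i * φ x =
        (∫ x in B, (r (ballMeasure x) - (K + ∫ t in ballMeasure x..1, g t)) *
          fderiv ℝ φ x (EuclideanSpace.single i 1)) +
        ∫ x in B, radialField (fun t => b t - g t) x i * φ x := by
      have e1 : ∀ x : Eucl n, radialField (fun t => b t - g t) x i * φ x =
          radialField b x i * φ x - radialField g x i * φ x := fun x => by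
        rw [← radialField_sub, PiLp.sub_apply, sub_mul]
      simp_rw [e1, sub_mul]
      rw [integral_sub (huφ hu) (huφ hug), integral_sub (hGφ hG) (hGφ hGg), hcl]
      ring
    rw [hsplit]
    refine (enorm_add_le _ _).trans ?_
    have hA : ‖∫ x in B, (r (ballMeasure x) - (K + ∫ t in ballMeasure x..1, g t)) *
        fderiv ℝ φ x (EuclideanSpace.single i 1)‖ₑ ≤ ENNReal.ofReal D₁ * ε := by
      have hgi : ∀ s ∈ Ioo (0 : ℝ) 1, IntervalIntegrable g volume s 1 :=
        fun s _ => hgc.intervalIntegrable _ _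
      have hle := (lintegral_enorm_integral_sub_le hb hgc.measurable hα1 hbi hgi).trans hg
      have hc1 : AEMeasurable (fun s => ‖r s - (K + ∫ t in s..1, g t)‖ₑ)
          (volume.restrict (Ioo (0 : ℝ) 1)) :=
        (hrm.sub (continuous_const.add htail).aemeasurable).enorm
      calc ‖∫ x in B, (r (ballMeasure x) - (K + ∫ t in ballMeasure x..1, g t)) *
            fderiv ℝ φ x (EuclideanSpace.single i 1)‖ₑ
          ≤ ∫⁻ x in B, ‖(r (ballMeasure x) - (K + ∫ t in ballMeasure x..1, g t)) *
            fderiv ℝ φ x (EuclideanSpace.single i 1)‖ₑ := enorm_integral_le_lintegral_enorm _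
        _ ≤ ∫⁻ x in B, ENNReal.ofReal D₁ *
              ‖r (ballMeasure x) - (K + ∫ t in ballMeasure x..1, g t)‖ₑ := by
            refine lintegral_mono fun x => ?_
            simp only
            rw [enorm_mul, mul_comm]
            gcongr
            rw [← ofReal_norm]
            exact ENNReal.ofReal_le_ofReal (hD₁ x)
        _ = ENNReal.ofReal D₁ * ∫⁻ x in B,
              ‖r (ballMeasure x) - (K + ∫ t in ballMeasure x..1, g t)‖ₑ :=
            lintegral_const_mul' _ _ ENNReal.ofReal_ne_top
        _ = ENNReal.ofReal D₁ * ∫⁻ s in Ioo (0 : ℝ) 1, ‖r s - (K + ∫ t in s..1, g t)‖ₑ := by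
            rw [← hmp.map_eq] at hc1
            rw [← hmp.map_eq, lintegral_map' hc1 hmp.aemeasurable]
        _ ≤ ENNReal.ofReal D₁ * ε := by
            gcongr
            refine le_trans (setLIntegral_mono' measurableSet_Ioo fun s hs => ?_) hle
            rw [hr s hs, add_sub_add_left_eq_sub]
    have hA' : ‖∫ x in B, radialField (fun t => b t - g t) x i * φ x‖ₑ ≤
        ENNReal.ofReal D₀ * (ENNReal.ofReal (n * unitBallVolume n ^ (1 / (n : ℝ))) * ε) := by
      calc ‖∫ x in B, radialField (fun t => b t - g t) x i * φ x‖ₑ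
          ≤ ∫⁻ x in B, ‖radialField (fun t => b t - g t) x i * φ x‖ₑ :=
            enorm_integral_le_lintegral_enorm _
        _ ≤ ∫⁻ x in B, ENNReal.ofReal D₀ * ‖radialField (n := n) (fun t => b t - g t) x‖ₑ := by
            refine lintegral_mono fun x => ?_
            simp only
            rw [enorm_mul, mul_comm]
            gcongr
            · rw [← ofReal_norm]
              exact ENNReal.ofReal_le_ofReal (hD₀ x)
            · exact hcoord _
        _ = ENNReal.ofReal D₀ * ∫⁻ x in B, ‖radialField (n := n) (fun t => b t - g t) x‖ₑ :=
            lintegral_const_mul' _ _ ENNReal.ofReal_ne_top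
        _ ≤ _ := by
            rw [hGle (fun t => b t - g t) (hb.sub hgc.measurable)]
            gcongr
    refine (add_le_add hA hA').trans (le_of_eq ?_)
    rw [hD]
    ring
  have hzero : ‖(∫ x in B, r (ballMeasure x) * fderiv ℝ φ x (EuclideanSpace.single i 1)) +
        ∫ x in B, radialField b x i * φ x‖ₑ = 0 := by
    have hlim : Tendsto (fun k : ℕ => D * ((k : ℝ≥0∞) + 1)⁻¹) atTop (𝓝 (D * 0)) := by
      refine ENNReal.Tendsto.const_mul ?_ (Or.inr hDt)
      have := (tendsto_add_atTop_iff_nat 1).2 ENNReal.tendsto_inv_nat_nhds_zero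
      simpa using this
    rw [mul_zero] at hlim
    exact le_bot_iff.1 (ge_of_tendsto' hlim fun k => key _ (by simp))
  exact eq_neg_of_add_eq_zero_left (enorm_eq_zero.1 hzero)

end PolyaSzego

end

/-! ### Transfer to the ball and conclusion -/

noncomputable section

namespace PolyaSzego

open Filter Topology

lemma decreasingRearrangement_eq {n : ℕ} {Ω : Set (Eucl n)} (hΩ : MeasurableSet Ω)
    {f F : Eucl n → ℝ} (hfF : ∀ᵐ x ∂volume.restrict Ω, f x = F x) (s : ℝ) :
    decreasingRearrangement Ω f s = rearrangement (volume.restrict Ω) F s := by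
  have h : ∀ l : ℝ, volume {x ∈ Ω | l < |f x|} = volume.restrict Ω {x | l < |F x|} := by
    intro l
    have he : {x ∈ Ω | l < |f x|} = {x | l < |f x|} ∩ Ω := by
      ext x
      exact and_comm
    rw [he, ← Measure.restrict_apply' hΩ]
    refine measure_congr ?_
    filter_upwards [hfF] with x hx
    exact congrArg (fun v => l < |v|) hx
  simp only [decreasingRearrangement, rearrangement, h]

lemma deriv_rearrangement_nonpos {X : Type*} [MeasurableSpace X] {μ : Measure X}
    [IsFiniteMeasure μ] {F : X → ℝ} (hF : Measurable F) {s : ℝ} (hs : 0 < s) :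
    deriv (rearrangement μ F) s ≤ 0 := by
  have h : AntitoneOn (rearrangement μ F) (Ioi 0) := fun a ha b _ hab =>
    rearrangement_antitone hF ha hab
  rw [← derivWithin_of_isOpen isOpen_Ioi (mem_Ioi.2 hs)]
  exact h.derivWithin_nonpos

lemma rpow_mul_enorm_neg_deriv {X : Type*} [MeasurableSpace X] {μ : Measure X}
    [IsFiniteMeasure μ] {F : X → ℝ} (hF : Measurable F) (α : ℝ) {s : ℝ} (hs : 0 < s) :
    ENNReal.ofReal s ^ α * ‖-deriv (rearrangement μ F) s‖ₑ = rearrangedSlope μ F α s := by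
  rw [rearrangedSlope, Real.enorm_eq_ofReal (neg_nonneg.2 (deriv_rearrangement_nonpos hF hs))]

/-- The gradient of the spherical rearrangement is controlled by any weight that satisfies the
level gap inequality. -/
theorem gradNorm_rearrangement_le {n : ℕ} (hn : 2 ≤ n) {β : Type*} [MeasurableSpace β]
    {μ : Measure β} [IsProbabilityMeasure μ] (X : RINorm μ) {T : β → ℝ}
    (hT : MeasurePreserving T μ (volume.restrict (Ioo (0 : ℝ) 1))) {C : ℝ≥0} {F : β → ℝ}
    (hF : Measurable F) {w : β → ℝ≥0∞} (hw : Measurable w) (hX : X.toFun w ≠ ⊤)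
    (hgap : ∀ t₁ t₂ : ℝ, 0 ≤ t₁ → t₁ < t₂ → ENNReal.ofReal (t₂ - t₁) *
      μ {x | t₂ ≤ |F x|} ^ (1 - 1 / (n : ℝ)) ≤
        C * ∫⁻ x in {x | t₁ < |F x| ∧ |F x| < t₂}, w x ∂μ) :
    gradNorm (unitVolumeBall n) (X.version (volume.restrict (unitVolumeBall n)))
      (fun x => rearrangement μ F (ballMeasure x)) ≤
        ENNReal.ofReal (n * unitBallVolume n ^ (1 / (n : ℝ))) * (C * X.toFun w) := by
  have hn0 : n ≠ 0 := by omega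
  have hα : 0 ≤ 1 - 1 / (n : ℝ) := by
    have : 1 / (n : ℝ) ≤ 1 / 2 := by
      gcongr
      exact_mod_cast hn
    linarith
  set α := 1 - 1 / (n : ℝ) with hαdef
  -- On a space of total measure 1 the norm controls the L¹ norm. This makes w integrable, as
  -- absolute continuity of the rearrangement requires, and likewise the slope.
  obtain ⟨D, hD⟩ := X.lintegral_le univ MeasurableSet.univ (measure_lt_top _ _)
  simp only [Measure.restrict_univ] at hD
  have hfin : ∫⁻ x, w x ∂μ ≠ ⊤ :=
    ((hD w hw.aemeasurable).trans_lt
      (ENNReal.mul_lt_top ENNReal.coe_lt_top (lt_top_iff_ne_top.2 hX))).ne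
  have hslope := X.rearrangedSlope_le hT hF hw hα hfin hgap
  set b : ℝ → ℝ := fun s => -deriv (rearrangement μ F) s with hb
  have hbm : Measurable b := (measurable_deriv _).neg
  have hslope_fin : ∫⁻ t in Ioo (0 : ℝ) 1, ENNReal.ofReal t ^ α * ‖b t‖ₑ ≠ ⊤ := by
    have h1 : ∫⁻ t in Ioo (0 : ℝ) 1, ENNReal.ofReal t ^ α * ‖b t‖ₑ =
        ∫⁻ t in Ioo (0 : ℝ) 1, rearrangedSlope μ F α t :=
      setLIntegral_congr_fun measurableSet_Ioo fun t ht => rpow_mul_enorm_neg_deriv hF α ht.1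
    rw [h1, ← hT.lintegral_comp measurable_rearrangedSlope]
    refine ((hD _ (measurable_rearrangedSlope.comp hT.measurable).aemeasurable).trans_lt
      (ENNReal.mul_lt_top ENNReal.coe_lt_top (hslope.trans_lt
        (ENNReal.mul_lt_top ENNReal.coe_lt_top (lt_top_iff_ne_top.2 hX))))).ne
  have hanti : AntitoneOn (rearrangement μ F) (Ioo 0 1) := fun s hs t _ hst =>
    rearrangement_antitone hF hs.1 hst
  have hwg : HasWeakGradient (unitVolumeBall n) (fun x => rearrangement μ F (ballMeasure x))
      (radialField b) :=
    hasWeakGradient_radial hn hbm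
      (fun s hs => rearrangement_eq_integral hF hα hfin hgap hs.1 hs.2.le)
      (aemeasurable_restrict_of_antitoneOn measurableSet_Ioo hanti) hslope_fin
  set κ : ℝ≥0 := (n * unitBallVolume n ^ (1 / (n : ℝ))).toNNReal with hκ
  have hκe : ENNReal.ofReal (n * unitBallVolume n ^ (1 / (n : ℝ))) = κ := rfl
  rw [hκe]
  have hhm : Measurable fun s => (κ : ℝ≥0∞) * (ENNReal.ofReal s ^ α * ‖b s‖ₑ) :=
    ((ENNReal.measurable_ofReal.pow_const α).mul hbm.enorm).const_mul _
  have hum : AEMeasurable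
      (fun x => (κ : ℝ≥0∞) * (ENNReal.ofReal (T x) ^ α * ‖b (T x)‖ₑ)) μ :=
    (hhm.comp hT.measurable).aemeasurable
  -- T on the original space and the ball measure on B are both uniform on (0, 1), so the same
  -- function of either has the same distribution.
  have heq : Equimeasurable μ (volume.restrict (unitVolumeBall n))
      (fun x => (κ : ℝ≥0∞) * (ENNReal.ofReal (T x) ^ α * ‖b (T x)‖ₑ))
      (fun x => ‖radialField (n := n) b x‖ₑ) := by
    intro t
    have hms : MeasurableSet {s | t < (κ : ℝ≥0∞) * (ENNReal.ofReal s ^ α * ‖b s‖ₑ)} :=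
      measurableSet_lt measurable_const hhm
    simp_rw [enorm_radialField hn, hκe]
    exact (hT.measure_preimage hms.nullMeasurableSet).trans
      ((measurePreserving_ballMeasure hn0).measure_preimage hms.nullMeasurableSet).symm
  calc gradNorm (unitVolumeBall n) (X.version (volume.restrict (unitVolumeBall n)))
        (fun x => rearrangement μ F (ballMeasure x))
      ≤ X.version (volume.restrict (unitVolumeBall n)) (fun x => ‖radialField b x‖ₑ) :=
        iInf₂_le _ hwg
    _ ≤ X.toFun (fun x => (κ : ℝ≥0∞) * (ENNReal.ofReal (T x) ^ α * ‖b (T x)‖ₑ)) :=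
        (iInf_le _ _).trans (iInf₂_le hum heq)
    _ ≤ X.toFun (fun x => (κ : ℝ≥0∞) * rearrangedSlope μ F α (T x)) := by
        refine X.mono _ _ hum
          ((measurable_rearrangedSlope.comp hT.measurable).const_mul _).aemeasurable ?_
        filter_upwards [hT.quasiMeasurePreserving.ae (ae_restrict_mem measurableSet_Ioo)]
          with x hx
        rw [rpow_mul_enorm_neg_deriv hF α hx.1]
    _ = κ * X.toFun (fun x => rearrangedSlope μ F α (T x)) :=
        X.smul _ _ (measurable_rearrangedSlope.comp hT.measurable).aemeasurable
    _ ≤ κ * (C * X.toFun w) := by gcongr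

end PolyaSzego

end

theorem theorem3 (n : ℕ) (hn : 2 ≤ n) (Ω : Set (PolyaSzego.Eucl n))
    (hΩ_open : IsOpen Ω) (hΩ_conn : IsConnected Ω) (hΩ_vol : volume Ω = 1)
    (hΩ : PolyaSzego.MazyaClass Ω (1 - 1 / (n : ℝ))) :
    ∃ C : ℝ≥0, ∀ (X : PolyaSzego.RINorm (volume.restrict Ω)) (f : PolyaSzego.Eucl n → ℝ),
      PolyaSzego.MemW11 Ω f →
        (⨅ c : ℝ, PolyaSzego.gradNorm (PolyaSzego.unitVolumeBall n)
            (X.version (volume.restrict (PolyaSzego.unitVolumeBall n)))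
            (PolyaSzego.sphericalRearrangement Ω (fun x => f x - c))) ≤
          C * PolyaSzego.gradNorm Ω X.toFun f := by
  have hα : 0 ≤ 1 - 1 / (n : ℝ) := by
    have : 1 / (n : ℝ) ≤ 1 / 2 := by
      gcongr
      exact_mod_cast hn
    linarith
  have hα1 : 1 - 1 / (n : ℝ) ≤ 1 := by
    have : 0 ≤ 1 / (n : ℝ) := by positivity
    linarith
  obtain ⟨C, hC⟩ := PolyaSzego.exists_level_gap_median hn hΩ_open hΩ_conn.isPreconnected hΩ_vol
    hα hα1 hΩ
  set κ : ℝ≥0 := (n * PolyaSzego.unitBallVolume n ^ (1 / (n : ℝ))).toNNReal with hκ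
  -- The constant is fixed before the space and the function. The added 1 makes it nonzero, so that
  -- it passes through the infima over gradients and multiplies ∞ to ∞.
  refine ⟨κ * C + 1, fun X f hf => ?_⟩
  have hC0 : ((κ * C + 1 : ℝ≥0) : ℝ≥0∞) ≠ 0 := by
    exact_mod_cast (by positivity : κ * C + 1 ≠ 0)
  have hprob : IsProbabilityMeasure (volume.restrict Ω) := ⟨by simp [hΩ_vol]⟩
  obtain ⟨T, hT⟩ := PolyaSzego.exists_measurePreserving_Ioo (by omega : 0 < n) hΩ_vol
  rw [PolyaSzego.gradNorm, ENNReal.mul_iInf_of_ne hC0 ENNReal.coe_ne_top]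
  refine le_iInf fun G => ?_
  rw [ENNReal.mul_iInf_of_ne hC0 ENNReal.coe_ne_top]
  refine le_iInf fun hG => ?_
  rcases eq_or_ne (X.toFun fun x => ‖G x‖ₑ) ⊤ with htop | htop
  · rw [htop, ENNReal.mul_top hC0]
    exact le_top
  have hGm : AEStronglyMeasurable G (volume.restrict Ω) := hG.2.1.aestronglyMeasurable
  have hGi : IntegrableOn G Ω := by
    obtain ⟨D, hD⟩ := X.lintegral_le univ MeasurableSet.univ (measure_lt_top _ _)
    simp only [Measure.restrict_univ] at hD
    exact ⟨hGm, (hD _ hGm.enorm).trans_lt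
      (ENNReal.mul_lt_top ENNReal.coe_lt_top (lt_top_iff_ne_top.2 htop))⟩
  obtain ⟨c, F, hF, -, hfF, hgap⟩ := hC f G hf.1 hGi hG
  -- The length of a measurable version of G; the rearrangement lemmas ask for a measurable weight,
  -- and neither norm nor integrals change.
  set w : PolyaSzego.Eucl n → ℝ≥0∞ := fun x => ‖hGm.mk G x‖ₑ with hw
  have hwm : Measurable w := hGm.stronglyMeasurable_mk.measurable.enorm
  have hwG : w =ᵐ[volume.restrict Ω] fun x => ‖G x‖ₑ := by
    filter_upwards [hGm.ae_eq_mk] with x hx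
    rw [hw, hx]
  have hXw : X.toFun w ≤ X.toFun fun x => ‖G x‖ₑ :=
    X.mono _ _ hwm.aemeasurable hGm.enorm hwG.le
  have hgap' : ∀ t₁ t₂ : ℝ, 0 ≤ t₁ → t₁ < t₂ → ENNReal.ofReal (t₂ - t₁) *
      volume.restrict Ω {x | t₂ ≤ |F x|} ^ (1 - 1 / (n : ℝ)) ≤
        C * ∫⁻ x in {x | t₁ < |F x| ∧ |F x| < t₂}, w x ∂volume.restrict Ω := by
    intro t₁ t₂ h1 h2
    have hms : MeasurableSet {x | t₁ < |F x| ∧ |F x| < t₂} :=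
      (measurableSet_lt measurable_const hF.abs).inter (measurableSet_lt hF.abs measurable_const)
    rw [Measure.restrict_apply' hΩ_open.measurableSet, inter_comm,
      lintegral_congr_ae (ae_restrict_of_ae hwG), Measure.restrict_restrict hms, inter_comm _ Ω]
    exact hgap t₁ t₂ h1 h2
  have hsph : PolyaSzego.sphericalRearrangement Ω (fun x => f x - c) =
      fun x => PolyaSzego.rearrangement (volume.restrict Ω) F (PolyaSzego.ballMeasure x) :=
    funext fun x => PolyaSzego.decreasingRearrangement_eq hΩ_open.measurableSet hfF _
  -- The median c is the competitor in the infimum.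
  refine (iInf_le _ c).trans ?_
  rw [hsph]
  calc _ ≤ (κ : ℝ≥0∞) * (C * X.toFun w) := PolyaSzego.gradNorm_rearrangement_le hn X hT hF hwm
        (hXw.trans_lt (lt_top_iff_ne_top.2 htop)).ne hgap'
    _ ≤ (κ * C + 1 : ℝ≥0) * X.toFun fun x => ‖G x‖ₑ := by
        rw [← mul_assoc]
        refine mul_le_mul' ?_ hXw
        push_cast
        exact le_self_add
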